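/- **Definitions.** Let $K$ be a field of characteristic $p>0$ and let $\Xi=(S_n,R_n\mid n\ge 0)$ be a tuple of positive integers. Let $R(\Xi)$ be the divided power algebra over $K$ in the variables $x_n,y_n,z_n$ ($n\ge0$): its basis consists of the monomials $\prod_{n} x_n^{(\alpha_n)}y_n^{(\beta_n)}z_n^{(\gamma_n)}$ with $0\le\alpha_n<p^{S_n}$, $0\le\beta_n,\gamma_n<p^{R_n}$, only finitely many exponents being nonzero, and its product is given by $t^{(i)}t^{(j)}=\binom{i+j}{i}t^{(i+j)}$ in each variable $t$ (a monomial with an exponent out of range is $0$). Let $\partial_t$ be the derivation with $\partial_t(t^{(i)})=t^{(i-1)}$, $\partial_t(t^{(0)})=0$, acting trivially on the other variables. Define derivations of $R(\Xi)$ recursively by $$v_i=\partial_{x_i}+x_i^{(p^{S_i}-1)}y_i^{(p^{R_i}-1)}v_{i+1},\quad w_i=\partial_{y_i}+y_i^{(p^{R_i}-1)}x_i^{(p^{S_i}-1)}w_{i+1},\quad u_i=\partial_{z_i}+z_i^{(p^{R_i}-1)}x_i^{(p^{S_i}-1)}u_{i+1}$$ (that is, by the infinite sums obtained by iterating these formulas).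 The clover restricted Lie algebra is $\mathbf T(\Xi)=\mathrm{Lie}_p(v_0,w_0,u_0)\subset\mathrm{Der}\,R(\Xi)$, the smallest Lie subalgebra that contains $v_0,w_0,u_0$ and is closed under the $p$-mapping $D\mapsto D^p$. For a restricted Lie algebra $L$ generated by a finite set $X$, the growth function is $$\gamma_L(X,n)=\dim_K\big\langle [a_1,[a_2,\dots,[a_{s-1},a_s]]]^{[p^k]}\ \big|\ a_j\in X,\ s\ge1,\ k\ge 0,\ sp^k\le n\big\rangle_K .$$ For $f,g:\mathbb N\to\mathbb R$ write $f\preccurlyeq g$ if there are positive integers $N,C$ with $f(n)\le g(Cn)$ for all $n\ge N$, and $f\sim g$ if $f\preccurlyeq g$ and $g\preccurlyeq f$. The growth is linear if $\gamma_L\sim n$. Put $\mathrm{GKdim}\,L=\limsup_n \ln\gamma_L(n)/\ln n$ and $\underline{\mathrm{GKdim}}\,L=\liminf_n \ln\gamma_L(n)/\ln n$. Let $\mathrm{Ldim}^0L$ be the infimum of all $\beta\in(0,1)$ with $\gamma_L(m)\preccurlyeq m\exp((\ln m)^\beta)$ (it is $1$ if there are none), and let $\underline{\mathrm{Ldim}}^0L$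 be the supremum of all $\beta\in(0,1)$ with $m\exp((\ln m)^\beta)\preccurlyeq\gamma_L(m)$ (it is $0$ if there are none). **Theorem.** Let $K$ be a field of characteristic $p>0$. For $\kappa\in(0,1)$ let $\Xi_\kappa$ be the tuple $S_i=\lfloor (i+1)^{1/\kappa-1}\rfloor$, $R_i=1$ ($i\ge0$), and put $\mathbf T_\kappa=\mathbf T(\Xi_\kappa)$. Then: 1. with respect to the generators $v_0,w_0,u_0$ one has $\gamma_{\mathbf T_\kappa}(m)=m\exp\big((C+o(1))(\ln m)^\kappa\big)$ as $m\to\infty$, where $C=2(\ln p)^{1-\kappa}/\kappa^\kappa$; 2. $\mathrm{GKdim}\,\mathbf T_\kappa=\underline{\mathrm{GKdim}}\,\mathbf T_\kappa=1$; 3. $\mathrm{Ldim}^0\,\mathbf T_\kappa=\underline{\mathrm{Ldim}}^0\,\mathbf T_\kappa=\kappa$; 4. the growth of $\mathbf T_\kappa$ is not linear; 5. for different $\kappa,\kappa'\in(0,1)$ the restricted Lie algebras $\mathbf T_\kappa$ and $\mathbf T_{\kappa'}$ over $K$ are not isomorphic. Claims 2, 3 and 4 hold for the growth function with respect to every finite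 generating set of the restricted Lie algebra $\mathbf T_\kappa$. -/

import Mathlib

open Filter Topology

attribute [local instance 100] LieRing.ofAssociativeRing

noncomputable section

namespace Clover

/-! ### Divided power algebras -/

/-- Exponent vectors of the monomials `∏ t_a^{(i_a)}` with `0 ≤ i_a < p ^ S_a`,
only finitely many `i_a` being non-zero. -/
abbrev DPIndex {Θ : Type} (p : ℕ) (S : Θ → ℕ) : Type :=
  {a : Θ →₀ ℕ // ∀ t, a t < p ^ S t}

/-- The divided power algebra `R(Θ, S)`: the vector space with basis the monomials. -/
def DPAlgebra (K : Type*) [Field K] {Θ : Type} (p : ℕ) (S : Θ → ℕ) : Type _ :=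
  DPIndex p S →₀ K

namespace DPAlgebra

variable {K : Type*} [Field K] {Θ : Type} {p : ℕ} {S : Θ → ℕ}

instance : AddCommGroup (DPAlgebra K p S) := inferInstanceAs (AddCommGroup (DPIndex p S →₀ K))

instance : Module K (DPAlgebra K p S) := inferInstanceAs (Module K (DPIndex p S →₀ K))

/-- The basis monomial with a given bounded exponent vector. -/
def basisElt (K : Type*) [Field K] {Θ : Type} (p : ℕ) (S : Θ → ℕ) (a : DPIndex p S) :
    DPAlgebra K p S :=
  (Finsupp.single a (1 : K) : DPIndex p S →₀ K)

open Classical in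
/-- The monomial `∏ t^{(a t)}`; it is `0` if some exponent `a t` is not below `p ^ S t`. -/
def mono (K : Type*) [Field K] {Θ : Type} (p : ℕ) (S : Θ → ℕ) (a : Θ →₀ ℕ) : DPAlgebra K p S :=
  if h : ∀ t, a t < p ^ S t then basisElt K p S ⟨a, h⟩ else 0

/-- The product of binomial coefficients `∏ t, (a t + b t).choose (a t)`. -/
def coef (a b : Θ →₀ ℕ) : ℕ := (a + b).prod fun t n => n.choose (a t)

/-- The linear map with prescribed values on the basis of monomials. -/
def lift {M : Type*} [AddCommGroup M] [Module K M] (f : (Θ →₀ ℕ) → M) :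
    DPAlgebra K p S →ₗ[K] M :=
  (Finsupp.linearCombination K (fun a : DPIndex p S => f a.1) : (DPIndex p S →₀ K) →ₗ[K] M)

/-- The bilinear multiplication
`(∏ t^{(a t)}) * (∏ t^{(b t)}) = ∏ (a t + b t).choose (a t) t^{(a t + b t)}`. -/
def mulHom : DPAlgebra K p S →ₗ[K] DPAlgebra K p S →ₗ[K] DPAlgebra K p S :=
  lift fun a => lift fun b => (coef a b : K) • mono K p S (a + b)

theorem lift_mono {M : Type*} [AddCommGroup M] [Module K M] (f : (Θ →₀ ℕ) → M) (a : Θ →₀ ℕ)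
    (h : ∀ t, a t < p ^ S t) : lift f (mono K p S a) = f a := by
  rw [mono, dif_pos h]
  exact (Finsupp.linearCombination_single K (1 : K) (⟨a, h⟩ : DPIndex p S)).trans (one_smul K _)

theorem mono_eq_zero (a : Θ →₀ ℕ) (h : ¬ ∀ t, a t < p ^ S t) : mono K p S a = 0 := by
  rw [mono, dif_neg h]

/-- Linear maps that agree on monomials are equal. -/
theorem hom_ext {M : Type*} [AddCommGroup M] [Module K M] {f g : DPAlgebra K p S →ₗ[K] M}
    (h : ∀ a : Θ →₀ ℕ, (∀ t, a t < p ^ S t) → f (mono K p S a) = g (mono K p S a)) : f = g := by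
  refine Finsupp.lhom_ext' (R := K) (M := K) (α := DPIndex p S) fun a => ?_
  refine LinearMap.ext_ring ?_
  have h2 := h a.1 a.2
  rw [mono, dif_pos a.2] at h2
  exact h2

theorem mulHom_mono (a b : Θ →₀ ℕ) :
    mulHom (mono K p S a) (mono K p S b) = (coef a b : K) • mono K p S (a + b) := by
  by_cases ha : ∀ t, a t < p ^ S t
  · by_cases hb : ∀ t, b t < p ^ S t
    · rw [mulHom, lift_mono _ _ ha, lift_mono _ _ hb]
    · rw [mono_eq_zero b hb, map_zero, mono_eq_zero (a + b), smul_zero]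
      exact fun h => hb fun t => lt_of_le_of_lt (by simp) (h t)
  · rw [mono_eq_zero a ha, map_zero, mono_eq_zero (a + b), smul_zero, LinearMap.zero_apply]
    exact fun h => ha fun t => lt_of_le_of_lt (by simp) (h t)

theorem coef_mul (a b : Θ →₀ ℕ) :
    coef a b * ((a.prod fun _ n => n.factorial) * (b.prod fun _ n => n.factorial)) =
      (a + b).prod fun _ n => n.factorial := by
  have ha : a.support ⊆ (a + b).support := fun t ht => by
    simp only [Finsupp.mem_support_iff, Finsupp.add_apply] at ht ⊢; omega
  have hb : b.support ⊆ (a + b).support := fun t ht => by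
    simp only [Finsupp.mem_support_iff, Finsupp.add_apply] at ht ⊢; omega
  rw [a.prod_of_support_subset ha _ (by simp), b.prod_of_support_subset hb _ (by simp), coef,
    Finsupp.prod, Finsupp.prod, ← Finset.prod_mul_distrib, ← Finset.prod_mul_distrib]
  refine Finset.prod_congr rfl fun t _ => ?_
  rw [← mul_assoc, Finsupp.add_apply]
  rw [Nat.choose_symm_add]; exact Nat.add_choose_mul_factorial_mul_factorial _ _

theorem prod_factorial_pos (a : Θ →₀ ℕ) : 0 < a.prod fun _ n => n.factorial :=
  Finset.prod_pos fun _ _ => Nat.factorial_pos _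

theorem coef_comm (a b : Θ →₀ ℕ) : coef a b = coef b a := by
  refine Nat.eq_of_mul_eq_mul_right (Nat.mul_pos (prod_factorial_pos a) (prod_factorial_pos b)) ?_
  rw [coef_mul, mul_comm (a.prod _), coef_mul, add_comm]

theorem coef_assoc (a b c : Θ →₀ ℕ) :
    coef a b * coef (a + b) c = coef b c * coef a (b + c) := by
  have h1 := coef_mul a b
  have h2 := coef_mul (a + b) c
  have h3 := coef_mul b c
  have h4 := coef_mul a (b + c)
  refine Nat.eq_of_mul_eq_mul_right (Nat.mul_pos (prod_factorial_pos a)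
    (Nat.mul_pos (prod_factorial_pos b) (prod_factorial_pos c))) ?_
  rw [← h1, add_assoc] at h2
  rw [← h3, ← h2] at h4
  linarith

theorem coef_zero_left (a : Θ →₀ ℕ) : coef 0 a = 1 := by
  simp [coef, Finsupp.prod]

theorem mulHom_comm (f g : DPAlgebra K p S) : mulHom f g = mulHom g f := by
  have : (mulHom : DPAlgebra K p S →ₗ[K] _) = mulHom.flip :=
    hom_ext fun a _ => hom_ext fun b _ => by
      rw [LinearMap.flip_apply, mulHom_mono, mulHom_mono, coef_comm, add_comm]
  exact LinearMap.congr_fun₂ this f g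

theorem mulHom_assoc (f g h : DPAlgebra K p S) :
    mulHom (mulHom f g) h = mulHom f (mulHom g h) := by
  have h1 : ∀ a b : Θ →₀ ℕ, mulHom (mulHom (mono K p S a) (mono K p S b)) =
      (mulHom (mono K p S a)).comp (mulHom (mono K p S b)) := fun a b => hom_ext fun c _ => by
    simp only [mulHom_mono, map_smul, LinearMap.smul_apply, LinearMap.comp_apply, smul_smul,
      ← Nat.cast_mul, coef_assoc, add_assoc]
  have h2 : ∀ a : Θ →₀ ℕ, mulHom.comp (mulHom (mono K p S a)) =
      (LinearMap.llcomp K _ _ _ (mulHom (mono K p S a))).comp mulHom :=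
    fun a => hom_ext fun b _ => h1 a b
  have h3 : (mulHom.flip h).comp (mulHom.flip g) =
      (mulHom (K := K) (p := p) (S := S)).flip (mulHom g h) :=
    hom_ext fun a _ => LinearMap.congr_fun₂ (h2 a) g h
  exact LinearMap.congr_fun h3 f

theorem mulHom_one (f : DPAlgebra K p S) : mulHom (mono K p S 0) f = f := by
  have : mulHom (mono K p S 0) = LinearMap.id := hom_ext fun a _ => by
    rw [mulHom_mono, coef_zero_left, Nat.cast_one, one_smul, zero_add, LinearMap.id_apply]
  exact LinearMap.congr_fun this f

instance : CommRing (DPAlgebra K p S) :=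
  { (inferInstance : AddCommGroup (DPAlgebra K p S)) with
    mul := fun f g => mulHom f g
    one := mono K p S 0
    mul_assoc := mulHom_assoc
    mul_comm := mulHom_comm
    one_mul := mulHom_one
    mul_one := fun f => (mulHom_comm _ _).trans (mulHom_one f)
    zero_mul := fun f => by
      change mulHom 0 f = 0
      rw [map_zero, LinearMap.zero_apply]
    mul_zero := fun f => map_zero (mulHom f)
    left_distrib := fun f g h => map_add (mulHom f) g h
    right_distrib := fun f g h => by
      change mulHom (f + g) h = mulHom f h + mulHom g h
      rw [map_add, LinearMap.add_apply] }

instance : Algebra K (DPAlgebra K p S) :=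
  Algebra.ofModule
    (fun r f g => by
      change mulHom (r • f) g = r • mulHom f g
      rw [map_smul, LinearMap.smul_apply])
    (fun r f g => map_smul (mulHom f) r g)

theorem mono_mul_mono (a b : Θ →₀ ℕ) :
    mono K p S a * mono K p S b = (coef a b : K) • mono K p S (a + b) :=
  mulHom_mono a b

open Classical in
/-- The partial derivative `∂_t`, sending `t^{(i)}` to `t^{(i - 1)}` and `t^{(0)}` to `0`. -/
def partialD (t : Θ) : Module.End K (DPAlgebra K p S) :=
  lift fun a => if a t = 0 then 0 else mono K p S (a - Finsupp.single t 1)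

/-- The divided power `t^{(k)}`. -/
def dpow (K : Type*) [Field K] {Θ : Type} (p : ℕ) (S : Θ → ℕ) (t : Θ) (k : ℕ) :
    DPAlgebra K p S :=
  mono K p S (Finsupp.single t k)

end DPAlgebra

/-! ### Pivot elements -/

/-- The divided variables `x_n`, `y_n`, `z_n`. -/
inductive Letter : Type
  | x (n : ℕ) : Letter
  | y (n : ℕ) : Letter
  | z (n : ℕ) : Letter

/-- The generation of a divided variable. -/
def Letter.gen : Letter → ℕ
  | .x n => n
  | .y n => n
  | .z n => n

/-- The heights of the divided variables: `S n` for `x_n`, and `R n` for both `y_n` and `z_n`. -/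
def height (S R : ℕ → ℕ) : Letter → ℕ
  | .x n => S n
  | .y n => R n
  | .z n => R n

/-- The divided power algebra `R(Ξ)` of a tuple `Ξ = (S_n, R_n | n ≥ 0)`. -/
abbrev CloverRing (K : Type*) [Field K] (p : ℕ) (S R : ℕ → ℕ) : Type _ :=
  DPAlgebra K p (height S R)

section Pivot

variable (K : Type*) [Field K] (p : ℕ) (S R : ℕ → ℕ)

/-- The divided power `t^{(p ^ N - 1)}`, where `N` is the height of `t`. -/
def top (t : Letter) : CloverRing K p S R :=
  DPAlgebra.dpow K p (height S R) t (p ^ height S R t - 1)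

/-- A bound for the generations of the variables that occur in a monomial. -/
def genBound (a : Letter →₀ ℕ) : ℕ := a.support.sup fun t => t.gen + 1

/-- The infinite sum `∂_{t_i} + c_i (∂_{t_{i+1}} + c_{i+1} (∂_{t_{i+2}} + ⋯))`. On a monomial
only the terms `∂_{t_j}` with `t_j` occurring in it contribute. -/
def pivot (t : ℕ → Letter) (c : ℕ → CloverRing K p S R) (i : ℕ) :
    Module.End K (CloverRing K p S R) :=
  DPAlgebra.lift fun a => ∑ j ∈ Finset.Ico i (genBound a),
    (∏ k ∈ Finset.Ico i j, c k) * DPAlgebra.partialD (t j) (DPAlgebra.mono K p (height S R) a)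

/-- `v_i = ∂_{x_i} + x_i^{(p^{S_i} - 1)} y_i^{(p^{R_i} - 1)} v_{i+1}`. -/
def v (i : ℕ) : Module.End K (CloverRing K p S R) :=
  pivot K p S R .x (fun k => top K p S R (.x k) * top K p S R (.y k)) i

/-- `w_i = ∂_{y_i} + y_i^{(p^{R_i} - 1)} x_i^{(p^{S_i} - 1)} w_{i+1}`. -/
def w (i : ℕ) : Module.End K (CloverRing K p S R) :=
  pivot K p S R .y (fun k => top K p S R (.y k) * top K p S R (.x k)) i

/-- `u_i = ∂_{z_i} + z_i^{(p^{R_i} - 1)} x_i^{(p^{S_i} - 1)} u_{i+1}`. -/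
def u (i : ℕ) : Module.End K (CloverRing K p S R) :=
  pivot K p S R .z (fun k => top K p S R (.z k) * top K p S R (.x k)) i

variable {K p S R}

theorem partialD_eq_zero (t : Letter) (a : Letter →₀ ℕ) (h : genBound a ≤ t.gen) :
    DPAlgebra.partialD t (DPAlgebra.mono K p (height S R) a) = 0 := by
  by_cases ha : ∀ t, a t < p ^ height S R t
  · rw [DPAlgebra.partialD, DPAlgebra.lift_mono _ _ ha, if_pos]
    by_contra h0
    have := Finset.le_sup (f := fun t : Letter => t.gen + 1) (Finsupp.mem_support_iff.2 h0)
    rw [genBound] at h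
    omega
  · rw [DPAlgebra.mono_eq_zero a ha, map_zero]

theorem pivot_rec (t : ℕ → Letter) (ht : ∀ i, (t i).gen = i) (c : ℕ → CloverRing K p S R)
    (i : ℕ) (f : CloverRing K p S R) :
    pivot K p S R t c i f = DPAlgebra.partialD (t i) f + c i * pivot K p S R t c (i + 1) f := by
  have : pivot K p S R t c i = DPAlgebra.partialD (t i) +
      (LinearMap.mulLeft K (c i)).comp (pivot K p S R t c (i + 1)) :=
    DPAlgebra.hom_ext fun a ha => by
      rw [LinearMap.add_apply, LinearMap.comp_apply, LinearMap.mulLeft_apply, pivot, pivot,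
        DPAlgebra.lift_mono _ _ ha, DPAlgebra.lift_mono _ _ ha]
      rcases lt_or_ge i (genBound a) with h | h
      · rw [Finset.sum_eq_sum_Ico_succ_bot h, Finset.Ico_self, Finset.prod_empty, one_mul,
          Finset.mul_sum]
        congr 1
        refine Finset.sum_congr rfl fun j hj => ?_
        rw [← mul_assoc, Finset.prod_eq_prod_Ico_succ_bot (by simp at hj; omega)]
      · rw [Finset.Ico_eq_empty (by omega), Finset.Ico_eq_empty (by omega), Finset.sum_empty,
          Finset.sum_empty, mul_zero, add_zero, partialD_eq_zero _ _ (by rw [ht]; exact h)]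
  exact LinearMap.congr_fun this f

theorem v_rec (i : ℕ) (f : CloverRing K p S R) :
    v K p S R i f = DPAlgebra.partialD (.x i) f +
      top K p S R (.x i) * top K p S R (.y i) * v K p S R (i + 1) f :=
  pivot_rec _ (fun _ => rfl) _ i f

theorem w_rec (i : ℕ) (f : CloverRing K p S R) :
    w K p S R i f = DPAlgebra.partialD (.y i) f +
      top K p S R (.y i) * top K p S R (.x i) * w K p S R (i + 1) f :=
  pivot_rec _ (fun _ => rfl) _ i f

theorem u_rec (i : ℕ) (f : CloverRing K p S R) :
    u K p S R i f = DPAlgebra.partialD (.z i) f +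
      top K p S R (.z i) * top K p S R (.x i) * u K p S R (i + 1) f :=
  pivot_rec _ (fun _ => rfl) _ i f

end Pivot

/-! ### Restricted Lie algebras of linear operators and their growth -/

section Restricted

variable (K : Type*) [Field K] (p : ℕ) {A : Type*} [Ring A] [Algebra K A]

/-- `Lie_p(X)`: the smallest Lie subalgebra of the associative algebra `A` (of characteristic `p`,
with bracket `a * b - b * a`) that contains `X` and is closed under the `p`-mapping `a ↦ a ^ p`. -/
def lieP (X : Set A) : LieSubalgebra K A :=
  sInf {L | X ⊆ L ∧ ∀ a ∈ L, a ^ p ∈ L}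

theorem pow_mem_lieP (X : Set A) {a : A} (ha : a ∈ lieP K p X) : a ^ p ∈ lieP K p X := by
  rw [lieP, ← SetLike.mem_coe, LieSubalgebra.coe_sInf, Set.mem_iInter₂] at ha ⊢
  exact fun L hL => hL.2 a (ha L hL)

variable {K p} in
/-- The `p`-mapping of `Lie_p(X)`. -/
def pMap {X : Set A} (a : lieP K p X) : lieP K p X := ⟨(a : A) ^ p, pow_mem_lieP K p X a.2⟩

/-- Isomorphisms of restricted Lie algebras: isomorphisms of Lie algebras over `K` that commute
with the `p`-mappings. -/
def RestrictedIsomorphic {B : Type*} [Ring B] [Algebra K B] (X : Set A) (Y : Set B) : Prop :=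
  ∃ φ : lieP K p X ≃ₗ⁅K⁆ lieP K p Y, ∀ a, φ (pMap a) = pMap (φ a)

/-- The right-normed commutator `[a_1, [a_2, [⋯, a_s]]]`. -/
def rightNormed : List A → A
  | [] => 0
  | [a] => a
  | a :: b :: l => ⁅a, rightNormed (b :: l)⁆

/-- The span of all `[a_1, …, a_s] ^ (p ^ k)` with `a_j ∈ X` and `s * p ^ k ≤ n`. -/
def growthSpace (X : Set A) (n : ℕ) : Submodule K A :=
  Submodule.span K {b | ∃ (l : List A) (k : ℕ), l ≠ [] ∧ (∀ a ∈ l, a ∈ X) ∧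
    l.length * p ^ k ≤ n ∧ b = rightNormed l ^ p ^ k}

/-- The growth function of `Lie_p(X)` with respect to the finite generating set `X`. -/
def growth (X : Set A) (n : ℕ) : ℕ := Module.finrank K (growthSpace K p X n)

end Restricted

/-- `f ≼ g`: there are positive integers `N`, `C` with `f n ≤ g (C n)` for all `n ≥ N`. -/
def GrowthLE (f g : ℕ → ℝ) : Prop :=
  ∃ N C : ℕ, 0 < N ∧ 0 < C ∧ ∀ n, N ≤ n → f n ≤ g (C * n)

/-- `f ∼ g`. -/
def GrowthEquiv (f g : ℕ → ℝ) : Prop := GrowthLE f g ∧ GrowthLE g f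

/-- The upper Gelfand-Kirillov dimension of an algebra with growth function `γ`. -/
def upperGKdim (γ : ℕ → ℝ) : EReal :=
  limsup (fun n : ℕ => ((Real.log (γ n) / Real.log n : ℝ) : EReal)) atTop

/-- The lower Gelfand-Kirillov dimension of an algebra with growth function `γ`. -/
def lowerGKdim (γ : ℕ → ℝ) : EReal :=
  liminf (fun n : ℕ => ((Real.log (γ n) / Real.log n : ℝ) : EReal)) atTop

/-- The quasi-linear function `m exp ((ln m) ^ β)`. -/
def quasiLin (β : ℝ) (m : ℕ) : ℝ := m * Real.exp (Real.log m ^ β)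

/-- A growth function is linear if it is equivalent to `m ↦ m`. -/
def LinearGrowth (γ : ℕ → ℝ) : Prop := GrowthEquiv γ fun m => (m : ℝ)

/-- `Ldim⁰`: the infimum of all `β ∈ (0, 1)` with `γ ≼ m exp ((ln m) ^ β)`, which is `1` if there
are none. -/
def upperLdim (γ : ℕ → ℝ) : ℝ :=
  sInf ({β | β ∈ Set.Ioo (0 : ℝ) 1 ∧ GrowthLE γ (quasiLin β)} ∪ {1})

/-- Lower `Ldim⁰`: the supremum of all `β ∈ (0, 1)` with `m exp ((ln m) ^ β) ≼ γ`, which is `0` if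
there are none. -/
def lowerLdim (γ : ℕ → ℝ) : ℝ :=
  sSup ({β | β ∈ Set.Ioo (0 : ℝ) 1 ∧ GrowthLE (quasiLin β) γ} ∪ {0})

/-! ### Clover restricted Lie algebras -/

/-- The generators `v_0, w_0, u_0` of the clover restricted Lie algebra
`T(Ξ) = Lie_p(v_0, w_0, u_0)`. -/
def cloverGen (K : Type*) [Field K] (p : ℕ) (S R : ℕ → ℕ) :
    Set (Module.End K (CloverRing K p S R)) :=
  {v K p S R 0, w K p S R 0, u K p S R 0}

/-- The integers `S_i = [(i + 1) ^ (1 / κ - 1)]`. -/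
def paramS (κ : ℝ) (i : ℕ) : ℕ := ⌊((i : ℝ) + 1) ^ (1 / κ - 1)⌋₊

/-- The integers `R_i = 1`. -/
def paramR (_ : ℕ) : ℕ := 1

end Clover

end

/-! Write `q_i = p ^ S_i` and `ℓ_n = ∏_{i<n} (q_i + p - 1)`, and let `d_n` be any of the pivot
elements `v_n`, `w_n`, `u_n`. Give each variable of generation `n` the weight `ℓ_n`. The tail
coefficient of `d_n` then has weight `ℓ_{n+1} - ℓ_n`, so `d_n` is homogeneous of degree `-ℓ_n`. An
element `t^(a) d_n` behaves as if it had length `ℓ_n - wt a` in the generators, and growth amounts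
to counting the exponents `a`.

Upper bound. The products `t^(a) d_n`, with `a` in generations `< n` and of degree at most `q_{n-1}
+ p - 3` in generation `n - 1`, span a Lie filtration (`pivotMonomials_isLieFiltration`). Their
`p`-th powers vanish unless `a = 0`. Once the exponents of the `y_i` and `z_i` are fixed, the weight
determines those of the `x_i` as digits in a mixed radix system. This leaves at most `p^(2n) m`
exponents of length at most `m`, and only `n ≤ N + 2` occurs when `ℓ_N ≤ m < ℓ_{N+1}`
(`card_admissibleSet`, `admissible_level_le`, `growth_le`).

Lower bound. The power `d_n ^ (p ^ h)`, where `h` is the height of its variable, is a monomial times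
`d_{n+1}`; bracketing lowers that monomial to `1` and shows that `d_{n+1}` has length `ℓ_{n+1}`
(`der_pow_eq`, `der_mem_and`). Starting from `[v_n, u_n]`, nearly all `t^(a) u_{n+1}` are reached in
length `ℓ_{n+1} - wt a` (`lowerExponent_mem`), and they are linearly independent (`le_growth`).

Both bounds give `ln (γ(m) / m) ~ 2 N ln p`. Since `ln ℓ_n ~ κ ln p · n^(1/κ)`, also `N ~ (ln m / (κ
ln p))^κ`, whence the constant `C` (`tendsto_log_div`).

Jacobson's formula makes the growth spaces a filtration compatible with brackets and `p`-th powers.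
Another finite generating set therefore changes the growth only by a linear substitution, to which
the dimensions are insensitive (`isQuasiLinear_growth`). An isomorphism carries generators to
generators with the same growth, so `Ldim⁰` separates the algebras. -/

set_option linter.unusedSectionVars false
set_option linter.style.haveILetI false

noncomputable section

namespace Clover

/-! ### Filtrations compatible with brackets and `p`-th powers; growth spaces -/

section Jacobson

theorem neg_one_pow_mul_choose_prime_sub_one {p : ℕ} (hp : p.Prime) {E : Type*} [Ring E]
    (hE : (p : E) = 0) (k : ℕ) (hk : k < p) :
    (((p - 1).choose k : ℕ) : E) = (-1) ^ k := by
  induction k with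
  | zero => simp
  | succ k ih =>
    have h1 : (p - 1).choose k + (p - 1).choose (k + 1) = p.choose (k + 1) := by
      conv_rhs => rw [← Nat.sub_add_cancel hp.one_le]
      rw [Nat.choose_succ_succ]
    obtain ⟨c, hc⟩ := hp.dvd_choose_self (k := k + 1) (by omega) hk
    have h2 : (((p - 1).choose k : ℕ) : E) + (((p - 1).choose (k + 1) : ℕ) : E) = 0 := by
      rw [← Nat.cast_add, h1, hc, Nat.cast_mul, hE, zero_mul]
    rw [ih (by omega)] at h2
    rw [pow_succ, mul_neg_one]
    exact (neg_eq_of_add_eq_zero_right h2).symm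

/-- The signs of the binomial expansion cancel against those of `(p - 1).choose k`. The application
is to left and right multiplication by one element, which commute. -/
theorem sub_pow_prime_sub_one {p : ℕ} (hp : p.Prime) {E : Type*} [Ring E]
    (hE : (p : E) = 0) {x y : E} (h : Commute x y) :
    (x - y) ^ (p - 1) = ∑ i ∈ Finset.range p, x ^ i * y ^ (p - 1 - i) := by
  have h1 : Commute (-y) x := h.symm.neg_left
  rw [sub_eq_neg_add, h1.add_pow, Nat.sub_add_cancel hp.one_le, ← Finset.sum_range_reflect]
  refine Finset.sum_congr rfl fun i hi => ?_
  have hi' := Finset.mem_range.1 hi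
  have h3 : p - 1 - (p - 1 - i) = i := by omega
  rw [neg_one_pow_mul_choose_prime_sub_one hp hE _ (by omega), h3, neg_pow, mul_assoc, mul_assoc,
    (Commute.neg_one_right _).pow_right _ |>.eq, ← mul_assoc, ← mul_assoc,
    (Commute.neg_one_left _).pow_left _ |>.eq, mul_assoc _ ((-1) ^ _) ((-1) ^ _), ← (Commute.refl (-1 : E)).mul_pow]
  simp only [mul_neg, mul_one, neg_neg, one_pow]
  exact ((h.pow_pow _ _).symm).eq

variable (K : Type*) [Field K] {A : Type*} [Ring A] [Algebra K A]

theorem lie_iterate_eq (x y : A) (n : ℕ) :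
    (fun z => ⁅x, z⁆)^[n] y = ((LinearMap.mulLeft K x - LinearMap.mulRight K x) ^ n) y := by
  rw [Module.End.coe_pow]
  congr 2

variable (p : ℕ) [Fact p.Prime] [CharP K p]

theorem natCast_prime_eq_zero {B : Type*} [Ring B] [Algebra K B] : (p : B) = 0 := by
  rw [← map_natCast (algebraMap K B), CharP.cast_eq_zero, map_zero]

/-- The operator `ad x` is the difference of the commuting left and right multiplications by `x`,
and Frobenius is additive on commuting elements. -/
theorem lie_iterate_prime_pow (K : Type*) [Field K] {A : Type*} [Ring A] [Algebra K A] (p : ℕ)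
    [Fact p.Prime] [CharP K p] (x y : A) (k : ℕ) :
    (fun z => ⁅x, z⁆)^[p ^ k] y = ⁅x ^ p ^ k, y⁆ := by
  rw [lie_iterate_eq K]
  have hc : Commute (LinearMap.mulLeft K x) (LinearMap.mulRight K x) :=
    LinearMap.commute_mulLeft_right x x
  -- The endomorphism ring has characteristic `p` only if it is nontrivial, so a zero algebra is
  -- treated apart.
  rcases subsingleton_or_nontrivial (Module.End K A) with hs | hn
  · have : ∀ z : A, z = 0 := fun z => by
      have := LinearMap.congr_fun (hs.elim (LinearMap.id : A →ₗ[K] A) 0) z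
      simpa using this
    rw [this (⁅x ^ p ^ k, y⁆)]; exact this _
  haveI : CharP (Module.End K A) p := charP_of_injective_algebraMap
    (FaithfulSMul.algebraMap_injective K (Module.End K A)) p
  rw [sub_pow_char_pow_of_commute p k hc]
  simp [Ring.lie_def, LinearMap.pow_mulLeft, LinearMap.pow_mulRight]

/-- The right side is the derivative of a `p`-th power in noncommuting terms; this is the link with
brackets that Jacobson's formula needs. -/
theorem lie_iterate_prime_sub_one (K : Type*) [Field K] {A : Type*} [Ring A] [Algebra K A] (p : ℕ)
    [Fact p.Prime] [CharP K p] (x y : A) :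
    (fun z => ⁅x, z⁆)^[p - 1] y = ∑ i ∈ Finset.range p, x ^ i * y * x ^ (p - 1 - i) := by
  rw [lie_iterate_eq K, sub_pow_prime_sub_one (Fact.out : p.Prime) (natCast_prime_eq_zero K p)
    (LinearMap.commute_mulLeft_right x x)]
  simp [LinearMap.pow_mulLeft, LinearMap.pow_mulRight, LinearMap.sum_apply, mul_assoc]

open Polynomial in
theorem derivative_pow_noncomm {B : Type*} [Ring B] (P : B[X]) (n : ℕ) :
    derivative (P ^ n) = ∑ i ∈ Finset.range n, P ^ i * derivative P * P ^ (n - 1 - i) := by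
  induction n with
  | zero => simp
  | succ n ih =>
    rw [pow_succ, derivative_mul, ih, Finset.sum_range_succ, Finset.sum_mul]
    congr 1
    · refine Finset.sum_congr rfl fun i hi => ?_
      have hi' := Finset.mem_range.1 hi
      rw [mul_assoc, ← pow_succ]
      congr 2; omega
    · simp

/-- An increasing filtration compatible with the commutator. -/
structure IsLieFiltration (W : ℕ → Submodule K A) : Prop where
  mono : Monotone W
  lie_mem : ∀ {s t : ℕ} {a b : A}, a ∈ W s → b ∈ W t → ⁅a, b⁆ ∈ W (s + t)

variable {K}

theorem IsLieFiltration.iterate_mem {W : ℕ → Submodule K A} (hW : IsLieFiltration K W)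
    {s t : ℕ} {a b : A} (ha : a ∈ W s) (hb : b ∈ W t) (n : ℕ) :
    (fun z => ⁅a, z⁆)^[n] b ∈ W (n * s + t) := by
  induction n with
  | zero => simpa using hb
  | succ n ih =>
    rw [Function.iterate_succ_apply']
    have := hW.lie_mem ha ih
    rwa [show (n + 1) * s + t = s + (n * s + t) by ring]

open Polynomial in
/-- Jacobson's formula, in the form needed for filtrations. -/
theorem IsLieFiltration.add_pow_sub_mem {W : ℕ → Submodule K A} (hW : IsLieFiltration K W)
    {s : ℕ} {a b : A} (ha : a ∈ W s) (hb : b ∈ W s) :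
    (a + b) ^ p - a ^ p - b ^ p ∈ W (p * s) := by
  have hp : p.Prime := Fact.out
  -- Since `X` is central, the derivative of `P ^ p` is `(ad P)^(p-1) a`, whose coefficients are
  -- combinations of brackets of `p` factors `a` and `b`. Integrating recovers the middle
  -- coefficients of `P ^ p`; the outer ones are `a ^ p` and `b ^ p`, and `X = 1` gives `(a + b) ^
  -- p`.
  set P : A[X] := C a * X + C b with hP
  have hd : derivative P = C a := by simp [hP]
  have hcoef : ∀ n i, ((fun z => ⁅P, z⁆)^[n] (C a)).coeff i ∈ W ((n + 1) * s) := by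
    intro n
    induction n with
    | zero =>
      intro i
      rw [Function.iterate_zero_apply, coeff_C]
      split_ifs
      · simpa using ha
      · exact zero_mem _
    | succ n ih =>
      intro i
      rw [Function.iterate_succ_apply']
      set Q := (fun z => ⁅P, z⁆)^[n] (C a) with hQ
      have h0 : ⁅P, Q⁆ = (C a * Q - Q * C a) * X + (C b * Q - Q * C b) := by
        rw [Ring.lie_def, hP, add_mul, mul_add, mul_assoc (C a) X Q, X_mul, ← mul_assoc,
          ← mul_assoc, sub_mul]
        abel
      have h1 : ∀ {c : A} (_ : c ∈ W s) (j : ℕ),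
          (C c * Q - Q * C c).coeff j ∈ W ((n + 1 + 1) * s) := fun {c} hc j => by
        rw [coeff_sub, coeff_C_mul, coeff_mul_C, ← Ring.lie_def]
        have := hW.lie_mem hc (ih j)
        rwa [show (n + 1 + 1) * s = s + (n + 1) * s by ring]
      change (⁅P, Q⁆).coeff i ∈ _
      rw [h0, coeff_add]
      refine add_mem ?_ (h1 hb i)
      cases i with
      | zero => simp
      | succ i => rw [coeff_mul_X]; exact h1 ha i
  have hder : derivative (P ^ p) = (fun z => ⁅P, z⁆)^[p - 1] (C a) := by
    rw [derivative_pow_noncomm, lie_iterate_prime_sub_one K p, hd]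
  -- Integration divides by `i + 1`, which is invertible because `0 < i + 1 < p`.
  have hmid : ∀ i, i + 1 < p → (P ^ p).coeff (i + 1) ∈ W (p * s) := by
    intro i hi
    have h1 := hcoef (p - 1) i
    rw [← hder, coeff_derivative, Nat.sub_add_cancel hp.one_le] at h1
    have h2 : ((i : A) + 1) = algebraMap K A ((i + 1 : ℕ) : K) := by simp
    rw [h2, ← Algebra.commutes, ← Algebra.smul_def] at h1
    refine (Submodule.smul_mem_iff _ ?_).1 h1
    rw [Ne, CharP.cast_eq_zero_iff K p]
    exact fun h => by have := Nat.le_of_dvd (by omega) h; omega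
  have hdeg : P.natDegree ≤ 1 := natDegree_linear_le
  have hdegp : (P ^ p).natDegree < p + 1 := by
    have := natDegree_pow_le_of_le p hdeg
    omega
  have hev : (P ^ p).eval 1 = (a + b) ^ p := by
    have : ∀ Q : A[X], Q.eval 1 = eval₂RingHom' (RingHom.id A) 1 (fun _ => Commute.one_right _) Q :=
      fun Q => rfl
    rw [this, map_pow, ← this]
    simp [hP]
  have htop : (P ^ p).coeff p = a ^ p := by
    have := coeff_pow_of_natDegree_le (m := p) hdeg
    rw [mul_one] at this
    rw [this]; simp [hP]
  have hbot : (P ^ p).coeff 0 = b ^ p := by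
    rw [← constantCoeff_apply, map_pow]; simp [hP]
  rw [← hev, eval_eq_sum_range' hdegp, Finset.sum_range_succ]
  obtain ⟨r, hr⟩ : ∃ r, p = r + 1 := ⟨p - 1, (Nat.sub_add_cancel hp.one_le).symm⟩
  have hsum : ∑ i ∈ Finset.range p, (P ^ p).coeff i * 1 ^ i =
      ∑ i ∈ Finset.range r, (P ^ p).coeff (i + 1) + b ^ p := by
    conv_lhs => rw [hr, Finset.sum_range_succ', ← hr]
    simp [hbot]
  rw [hsum, htop]
  simp only [one_pow, mul_one]
  rw [show ∀ x y z : A, x + y + z - z - y = x from fun x y z => by abel]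
  refine Submodule.sum_mem _ fun i hi => hmid i ?_
  have := Finset.mem_range.1 hi
  omega

/-- The `p`-mapping is not additive, but by Jacobson's formula its defect already lies in the right
level, so a spanning set suffices. -/
theorem IsLieFiltration.pow_mem_of_span {W : ℕ → Submodule K A} (hW : IsLieFiltration K W)
    {s : ℕ} {Y : Set A} (hY : W s = Submodule.span K Y) (hp : ∀ y ∈ Y, y ^ p ∈ W (p * s))
    {b : A} (hb : b ∈ W s) : b ^ p ∈ W (p * s) := by
  have hpr : p.Prime := Fact.out
  have key : b ∈ W s ∧ b ^ p ∈ W (p * s) := by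
    rw [hY] at hb
    induction hb using Submodule.span_induction with
    | mem y hy => exact ⟨hY ▸ Submodule.subset_span hy, hp y hy⟩
    | zero => exact ⟨zero_mem _, by rw [zero_pow hpr.ne_zero]; exact zero_mem _⟩
    | add x y _ _ hx hy =>
      refine ⟨add_mem hx.1 hy.1, ?_⟩
      have := hW.add_pow_sub_mem p hx.1 hy.1
      have h2 := add_mem (add_mem this hx.2) hy.2
      rwa [show ∀ u v w : A, u - v - w + v + w = u from fun u v w => by abel] at h2
    | smul c x _ hx =>
      refine ⟨Submodule.smul_mem _ _ hx.1, ?_⟩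
      rw [smul_pow]
      exact Submodule.smul_mem _ _ hx.2
  exact key.2

variable (K)

/-- The span of the `p ^ k`-th powers of the elements of `Y s`, where `s * p ^ k ≤ n`. -/
def powerHull (Y : ℕ → Set A) (n : ℕ) : Submodule K A :=
  Submodule.span K {b | ∃ s k, s * p ^ k ≤ n ∧ ∃ y ∈ Y s, b = y ^ p ^ k}

variable {K}

theorem span_le_powerHull (Y : ℕ → Set A) (n : ℕ) :
    Submodule.span K (Y n) ≤ powerHull K p Y n :=
  Submodule.span_mono fun y hy => ⟨n, 0, by simp, y, hy, by simp⟩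

/-- `Y` spans a filtration compatible with brackets. -/
theorem powerHull_isLieFiltration {Y : ℕ → Set A}
    (hY : IsLieFiltration K fun n => Submodule.span K (Y n)) :
    IsLieFiltration K (powerHull K p Y) := by
  have hpr : p.Prime := Fact.out
  have hmono : Monotone (powerHull K p Y) := fun m n hmn =>
    Submodule.span_mono fun b ⟨s, k, hs, h⟩ => ⟨s, k, hs.trans hmn, h⟩
  -- brackets of a power with an element of the filtration
  have h1 : ∀ {s t k : ℕ} {y b : A}, y ∈ Y s → b ∈ Submodule.span K (Y t) →
      ⁅y ^ p ^ k, b⁆ ∈ Submodule.span K (Y (s * p ^ k + t)) := fun {s t k y b} hy hb => by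
    rw [← lie_iterate_prime_pow K p, mul_comm]
    exact hY.iterate_mem (Submodule.subset_span hy) hb _
  -- A bracket of two powers needs no powers at all: `ad (b ^ p ^ l)` is `p ^ l` brackets with `b`,
  -- of which the first already lands in the span of `Y`.
  have h2 : ∀ {s t k l : ℕ} {y b : A}, y ∈ Y s → b ∈ Y t →
      ⁅y ^ p ^ k, b ^ p ^ l⁆ ∈ Submodule.span K (Y (s * p ^ k + t * p ^ l)) :=
    fun {s t k l y b} hy hb => by
      have h3 : ⁅b, y ^ p ^ k⁆ ∈ Submodule.span K (Y (s * p ^ k + t)) := by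
        rw [← lie_skew]
        exact neg_mem (h1 hy (Submodule.subset_span hb))
      have h4 := hY.iterate_mem (Submodule.subset_span hb) h3 (p ^ l - 1)
      rw [← Function.iterate_succ_apply, Nat.succ_eq_add_one,
        Nat.sub_add_cancel (Nat.one_le_pow _ _ hpr.pos), lie_iterate_prime_pow K p] at h4
      rw [← lie_skew]
      refine neg_mem ?_
      have h5 : (p ^ l - 1) * t + (s * p ^ k + t) = s * p ^ k + t * p ^ l := by
        obtain ⟨r, hr⟩ : ∃ r, p ^ l = r + 1 :=
          ⟨p ^ l - 1, (Nat.sub_add_cancel (Nat.one_le_pow _ _ hpr.pos)).symm⟩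
        rw [hr, Nat.add_sub_cancel]; ring
      rwa [h5] at h4
  refine ⟨hmono, fun {s t a b} ha hb => ?_⟩
  induction ha using Submodule.span_induction with
  | zero => rw [zero_lie]; exact zero_mem _
  | add x y _ _ hx hy => rw [add_lie]; exact add_mem hx hy
  | smul c x _ hx => rw [smul_lie]; exact Submodule.smul_mem _ _ hx
  | mem x hx =>
    obtain ⟨s', k, hs, y, hy, rfl⟩ := hx
    induction hb using Submodule.span_induction with
    | zero => rw [lie_zero]; exact zero_mem _
    | add x y _ _ hx hy => rw [lie_add]; exact add_mem hx hy
    | smul c x _ hx => rw [lie_smul]; exact Submodule.smul_mem _ _ hx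
    | mem x hx =>
      obtain ⟨t', l, ht, z, hz, rfl⟩ := hx
      exact hmono (Nat.add_le_add hs ht) (span_le_powerHull p Y _ (h2 hy hz))

theorem powerHull_pow_mem {Y : ℕ → Set A}
    (hY : IsLieFiltration K fun n => Submodule.span K (Y n)) {s : ℕ} {b : A}
    (hb : b ∈ powerHull K p Y s) : b ^ p ∈ powerHull K p Y (p * s) := by
  refine (powerHull_isLieFiltration p hY).pow_mem_of_span p rfl ?_ hb
  rintro _ ⟨t, k, ht, y, hy, rfl⟩
  refine Submodule.subset_span ⟨t, k + 1, ?_, y, hy, by rw [← pow_mul, pow_succ]⟩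
  rw [pow_succ, ← mul_assoc, mul_comm]
  exact Nat.mul_le_mul_left _ ht

variable (K) in
/-- A Lie filtration that is compatible with the `p`-mapping. -/
structure IsRestrictedFiltration (W : ℕ → Submodule K A) : Prop extends IsLieFiltration K W where
  pow_mem : ∀ {s : ℕ} {a : A}, a ∈ W s → a ^ p ∈ W (p * s)

theorem powerHull_isRestrictedFiltration {Y : ℕ → Set A}
    (hY : IsLieFiltration K fun n => Submodule.span K (Y n)) :
    IsRestrictedFiltration K p (powerHull K p Y) :=
  ⟨powerHull_isLieFiltration p hY, powerHull_pow_mem p hY⟩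

theorem IsRestrictedFiltration.pow_pow_mem {W : ℕ → Submodule K A}
    (hW : IsRestrictedFiltration K p W) {s : ℕ} {a : A} (ha : a ∈ W s) (k : ℕ) :
    a ^ p ^ k ∈ W (s * p ^ k) := by
  induction k with
  | zero => simpa using ha
  | succ k ih =>
    have := hW.pow_mem ih
    rwa [← pow_mul, ← pow_succ, mul_comm p, mul_assoc, ← pow_succ] at this

theorem IsRestrictedFiltration.rightNormed_mem {W : ℕ → Submodule K A}
    (hW : IsRestrictedFiltration K p W) {X : Set A} {C : ℕ} (hX : X ⊆ W C) :
    ∀ l : List A, (∀ a ∈ l, a ∈ X) → rightNormed l ∈ W (C * l.length)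
  | [], _ => zero_mem _
  | [a], h => by simpa [rightNormed] using hX (h a (by simp))
  | a :: b :: l, h => by
    have h1 := hX (h a (by simp))
    have h2 := hW.rightNormed_mem hX (b :: l) fun c hc => h c (List.mem_cons_of_mem _ hc)
    have := hW.lie_mem h1 h2
    rw [rightNormed, show C * (a :: b :: l).length = C + C * (b :: l).length by
      simp only [List.length_cons]; ring]
    exact this

/-- Minimality of the growth filtration. It serves both for upper bounds, with a filtration made by
hand, and for changing generators, with `C` the length of the old generators in the new ones. -/
theorem IsRestrictedFiltration.growthSpace_le {W : ℕ → Submodule K A}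
    (hW : IsRestrictedFiltration K p W) {X : Set A} {C : ℕ} (hX : X ⊆ W C) (n : ℕ) :
    growthSpace K p X n ≤ W (C * n) := by
  refine Submodule.span_le.2 ?_
  rintro _ ⟨l, k, -, hl, hn, rfl⟩
  refine hW.mono (Nat.mul_le_mul_left C hn) ?_
  rw [← mul_assoc]
  exact hW.pow_pow_mem p (hW.rightNormed_mem p hX l hl) k

/-- The right-normed commutators of length at most `s`. -/
def rightNormedSet (X : Set A) (s : ℕ) : Set A :=
  {b | ∃ l : List A, l ≠ [] ∧ (∀ a ∈ l, a ∈ X) ∧ l.length ≤ s ∧ b = rightNormed l}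

theorem growthSpace_eq_powerHull (X : Set A) (n : ℕ) :
    growthSpace K p X n = powerHull K p (rightNormedSet X) n := by
  refine le_antisymm (Submodule.span_mono ?_) (Submodule.span_mono ?_)
  · rintro _ ⟨l, k, h0, hl, hn, rfl⟩
    exact ⟨l.length, k, hn, _, ⟨l, h0, hl, le_rfl, rfl⟩, rfl⟩
  · rintro _ ⟨s, k, hs, _, ⟨l, h0, hl, hn, rfl⟩, rfl⟩
    exact ⟨l, k, h0, hl, (Nat.mul_le_mul_right _ hn).trans hs, rfl⟩

theorem rightNormed_cons (a : A) {l : List A} (hl : l ≠ []) :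
    rightNormed (a :: l) = ⁅a, rightNormed l⁆ := by
  cases l with
  | nil => exact absurd rfl hl
  | cons b l => rfl

theorem rightNormedSet_lie (X : Set A) {t : ℕ} {c : A}
    (hc : c ∈ Submodule.span K (rightNormedSet X t)) {a : A} (ha : a ∈ X) :
    ⁅a, c⁆ ∈ Submodule.span K (rightNormedSet X (t + 1)) := by
  induction hc using Submodule.span_induction with
  | zero => rw [lie_zero]; exact zero_mem _
  | add x y _ _ hx hy => rw [lie_add]; exact add_mem hx hy
  | smul c x _ hx => rw [lie_smul]; exact Submodule.smul_mem _ _ hx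
  | mem x hx =>
    obtain ⟨l, h0, hl, hn, rfl⟩ := hx
    refine Submodule.subset_span ⟨a :: l, by simp, ?_, by simpa using hn, ?_⟩
    · intro b hb
      rcases List.mem_cons.1 hb with rfl | hb
      exacts [ha, hl b hb]
    · rw [rightNormed_cons a h0]

/-- Induction on the left factor by the Jacobi identity `[[a, x], c] = [a, [x, c]] - [x, [a, c]]`,
which preserves the total length. -/
theorem rightNormed_lie_mem (X : Set A) (l : List A) (h0 : l ≠ []) (hl : ∀ a ∈ l, a ∈ X) :
    ∀ {t : ℕ} {c : A}, c ∈ Submodule.span K (rightNormedSet X t) →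
      ⁅rightNormed l, c⁆ ∈ Submodule.span K (rightNormedSet X (l.length + t)) := by
  induction l with
  | nil => exact absurd rfl h0
  | cons a l ih =>
    intro t c hc
    rcases eq_or_ne l [] with rfl | hne
    · have := rightNormedSet_lie X hc (hl a (by simp))
      rwa [add_comm] at this
    · have hl' : ∀ b ∈ l, b ∈ X := fun b hb => hl b (List.mem_cons_of_mem _ hb)
      have ha := hl a (by simp)
      rw [rightNormed_cons a hne, lie_lie]
      refine sub_mem ?_ ?_
      · have := rightNormedSet_lie X (ih hne hl' hc) ha
        rwa [List.length_cons, show l.length + 1 + t = l.length + t + 1 by ring]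
      · have := ih hne hl' (rightNormedSet_lie X hc ha)
        rwa [List.length_cons, show l.length + 1 + t = l.length + (t + 1) by ring]

theorem rightNormedSet_isLieFiltration (X : Set A) :
    IsLieFiltration K fun n => Submodule.span K (rightNormedSet X n) := by
  have hm : Monotone fun n => Submodule.span K (rightNormedSet X n) := fun m n hmn =>
    Submodule.span_mono fun b ⟨l, h0, hl, hn, hb⟩ => ⟨l, h0, hl, hn.trans hmn, hb⟩
  refine ⟨hm, fun {s t a b} ha hb => ?_⟩
  induction ha using Submodule.span_induction with
  | zero => rw [zero_lie]; exact zero_mem _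
  | add x y _ _ hx hy => rw [add_lie]; exact add_mem hx hy
  | smul c x _ hx => rw [smul_lie]; exact Submodule.smul_mem _ _ hx
  | mem x hx =>
    obtain ⟨l, h0, hl, hn, rfl⟩ := hx
    exact hm (Nat.add_le_add_right hn t) (rightNormed_lie_mem X l h0 hl hb)

/-- The definition takes powers only of right-normed commutators. This shows that nothing is lost:
brackets of powers and powers of sums stay within the expected length. -/
theorem growthSpace_isRestrictedFiltration (X : Set A) :
    IsRestrictedFiltration K p (growthSpace K p X) := by
  rw [show growthSpace K p X = powerHull K p (rightNormedSet X) from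
    funext (growthSpace_eq_powerHull p X)]
  exact powerHull_isRestrictedFiltration p (rightNormedSet_isLieFiltration X)

theorem subset_growthSpace_one (X : Set A) : X ⊆ growthSpace K p X 1 := fun a ha =>
  Submodule.subset_span ⟨[a], 0, by simp, by simpa using ha, by simp, by simp [rightNormed]⟩

theorem subset_lieP (X : Set A) : X ⊆ lieP K p X := fun a ha => by
  rw [lieP, LieSubalgebra.coe_sInf, Set.mem_iInter₂]
  exact fun L hL => hL.1 ha

theorem lieP_le {X : Set A} {L : LieSubalgebra K A} (h1 : X ⊆ L) (h2 : ∀ a ∈ L, a ^ p ∈ L) :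
    lieP K p X ≤ L := sInf_le ⟨h1, h2⟩

theorem mem_growthSpace_of_mem_lieP {X : Set A} {a : A} (ha : a ∈ lieP K p X) :
    ∃ n, a ∈ growthSpace K p X n := by
  have hW := growthSpace_isRestrictedFiltration (K := K) p X
  let L : LieSubalgebra K A :=
    { carrier := {a | ∃ n, a ∈ growthSpace K p X n}
      zero_mem' := ⟨0, zero_mem _⟩
      add_mem' := fun {a b} ⟨m, hm⟩ ⟨n, hn⟩ => ⟨max m n,
        add_mem (hW.mono (le_max_left m n) hm) (hW.mono (le_max_right m n) hn)⟩
      smul_mem' := fun c a ⟨n, hn⟩ => ⟨n, Submodule.smul_mem _ _ hn⟩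
      lie_mem' := fun {a b} ⟨m, hm⟩ ⟨n, hn⟩ => ⟨m + n, hW.lie_mem hm hn⟩ }
  exact lieP_le (K := K) p (L := L) (fun a ha => ⟨1, subset_growthSpace_one p X ha⟩)
    (fun a ⟨n, hn⟩ => ⟨p * n, hW.pow_mem hn⟩) ha

theorem exists_subset_growthSpace {X Y : Set A} (hX : X.Finite) (h : X ⊆ lieP K p Y) :
    ∃ C, 0 < C ∧ X ⊆ growthSpace K p Y C := by
  have hW := growthSpace_isRestrictedFiltration (K := K) p Y
  induction X, hX using Set.Finite.induction_on with
  | empty => exact ⟨1, one_pos, Set.empty_subset _⟩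
  | @insert a s _ _ ih =>
    obtain ⟨C, hC, hs⟩ := ih ((Set.subset_insert _ _).trans h)
    obtain ⟨n, hn⟩ := mem_growthSpace_of_mem_lieP p (h (Set.mem_insert _ _))
    refine ⟨C + n, by omega, Set.insert_subset (hW.mono (by omega) hn) fun x hx =>
      hW.mono (by omega) (hs hx)⟩

theorem growthSpace_finite {X : Set A} (hX : X.Finite) (n : ℕ) :
    Module.Finite K (growthSpace K p X n) := by
  have hpr : p.Prime := Fact.out
  have hfin : {l : List A | l.length ≤ n ∧ ∀ a ∈ l, a ∈ X}.Finite := by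
    haveI := hX.to_subtype
    have := (List.finite_length_le X n).image (List.map Subtype.val)
    refine this.subset ?_
    rintro l ⟨h1, h2⟩
    refine ⟨l.attach.map fun a => ⟨a.1, h2 a.1 a.2⟩, by simpa using h1, ?_⟩
    simp [List.map_map, Function.comp_def]
  have hfin2 := (hfin.prod (Set.finite_lt_nat n)).image
    fun q : List A × ℕ => rightNormed q.1 ^ p ^ q.2
  refine Module.Finite.iff_fg.2 (Submodule.fg_span (hfin2.subset ?_))
  rintro _ ⟨l, k, h0, hl, hn, rfl⟩
  have h1 : 0 < l.length := List.length_pos_iff.2 h0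
  have h2 : k < p ^ k := Nat.lt_pow_self hpr.one_lt
  refine ⟨(l, k), ⟨⟨?_, hl⟩, ?_⟩, rfl⟩
  · exact (Nat.le_mul_of_pos_right _ (pow_pos hpr.pos k)).trans hn
  · exact h2.trans_le ((Nat.le_mul_of_pos_left _ h1).trans hn)

theorem growth_mono {X : Set A} (hX : X.Finite) : Monotone (growth K p X) := fun m n hmn => by
  haveI := growthSpace_finite (K := K) p hX n
  exact Submodule.finrank_mono ((growthSpace_isRestrictedFiltration p X).mono hmn)

/-- Finitely many elements of the algebra lie in a common growth space of level `C`; minimality of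
the growth filtration does the rest. -/
theorem exists_growth_le {X Y : Set A} (hX : X.Finite) (hY : Y.Finite) (h : X ⊆ lieP K p Y) :
    ∃ C, 0 < C ∧ ∀ n, growth K p X n ≤ growth K p Y (C * n) := by
  obtain ⟨C, hC, hs⟩ := exists_subset_growthSpace p hX h
  refine ⟨C, hC, fun n => ?_⟩
  haveI := growthSpace_finite (K := K) p hY (C * n)
  exact Submodule.finrank_mono
    ((growthSpace_isRestrictedFiltration p Y).growthSpace_le p hs n)

end Jacobson

/-! ### Transport of generators and growth by restricted isomorphisms -/

section Isomorphism

variable {K : Type*} [Field K] {p : ℕ} [Fact p.Prime] [CharP K p] {A B : Type*} [Ring A]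
  [Algebra K A] [Ring B] [Algebra K B] {X : Set A} {Y : Set B}

/-- Commutators are formed in the ambient associative algebras, where an isomorphism is not defined.
The witness `c` in the Lie algebra connects the two sides. -/
theorem rightNormed_transport (φ : lieP K p X →ₗ⁅K⁆ lieP K p Y) :
    ∀ l : List (lieP K p X),
      ∃ c : lieP K p X, (c : A) = rightNormed (l.map Subtype.val) ∧
        ((φ c : lieP K p Y) : B) = rightNormed (l.map fun a => ((φ a : lieP K p Y) : B))
  | [] => ⟨0, by simp [rightNormed]⟩
  | [a] => ⟨a, by simp [rightNormed]⟩
  | a :: b :: l => by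
    obtain ⟨c, h1, h2⟩ := rightNormed_transport φ (b :: l)
    refine ⟨⁅a, c⁆, ?_, ?_⟩
    · rw [LieSubalgebra.coe_bracket, h1]; rfl
    · rw [LieHom.map_lie, LieSubalgebra.coe_bracket, h2]; rfl

theorem pMap_iterate (a : lieP K p X) (k : ℕ) : ((pMap^[k] a : lieP K p X) : A) = (a : A) ^ p ^ k := by
  induction k with
  | zero => simp
  | succ k ih =>
    rw [Function.iterate_succ_apply', pow_succ, pow_mul, ← ih]
    rfl

/-- A finite generating set and its growth are transported by isomorphisms. -/
theorem RestrictedIsomorphic.exists_generators (h : RestrictedIsomorphic K p X Y)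
    (hX : X.Finite) :
    ∃ Y' : Set B, Y'.Finite ∧ lieP K p Y' = lieP K p Y ∧ growth K p Y' = growth K p X := by
  obtain ⟨φ, hφ⟩ := h
  let X' : Set (lieP K p X) := Subtype.val ⁻¹' X
  let Y' : Set B := (fun a : lieP K p X => ((φ a : lieP K p Y) : B)) '' X'
  have hX' : X'.Finite := hX.preimage Subtype.val_injective.injOn
  have hYY : Y' ⊆ lieP K p Y := by
    rintro _ ⟨a, -, rfl⟩
    exact (φ a).2
  have hle : lieP K p Y' ≤ lieP K p Y := lieP_le p hYY fun a ha => pow_mem_lieP K p Y ha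
  refine ⟨Y', hX'.image _, le_antisymm hle ?_, ?_⟩
  · -- the preimage of `lieP Y'`
    let L : LieSubalgebra K A :=
      { carrier := {a | ∃ c : lieP K p X, (c : A) = a ∧ ((φ c : lieP K p Y) : B) ∈ lieP K p Y'}
        zero_mem' := ⟨0, by simp⟩
        add_mem' := by
          rintro _ _ ⟨c, rfl, hc⟩ ⟨d, rfl, hd⟩
          exact ⟨c + d, rfl, by rw [map_add]; exact add_mem hc hd⟩
        smul_mem' := by
          rintro r _ ⟨c, rfl, hc⟩
          exact ⟨r • c, rfl, by rw [map_smul]; exact (lieP K p Y').smul_mem r hc⟩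
        lie_mem' := by
          rintro _ _ ⟨c, rfl, hc⟩ ⟨d, rfl, hd⟩
          refine ⟨⁅c, d⁆, rfl, ?_⟩
          rw [LieEquiv.map_lie]
          exact (lieP K p Y').lie_mem hc hd }
    have hL : lieP K p X ≤ L := by
      refine lieP_le p (fun a ha => ⟨⟨a, subset_lieP p X ha⟩, rfl, ?_⟩) ?_
      · exact subset_lieP p Y' ⟨⟨a, subset_lieP p X ha⟩, ha, rfl⟩
      · rintro _ ⟨c, rfl, hc⟩
        refine ⟨pMap c, rfl, ?_⟩
        rw [hφ]
        exact pow_mem_lieP K p Y' hc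
    intro b hb
    obtain ⟨c, hc1, hc2⟩ := hL (φ.symm ⟨b, hb⟩).2
    rw [Subtype.ext hc1] at hc2
    simpa using hc2
  · funext n
    -- the growth space inside the algebra
    let G : Submodule K (lieP K p X) := Submodule.span K
      {c | ∃ (l : List (lieP K p X)) (k : ℕ), l ≠ [] ∧ (∀ a ∈ l, a ∈ X') ∧
        l.length * p ^ k ≤ n ∧ (c : A) = rightNormed (l.map Subtype.val) ^ p ^ k ∧
        ((φ c : lieP K p Y) : B) =
          rightNormed (l.map fun a => ((φ a : lieP K p Y) : B)) ^ p ^ k}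
    have hφit : ∀ (k : ℕ) (c : lieP K p X), φ (pMap^[k] c) = pMap^[k] (φ c) := fun k c => by
      induction k with
      | zero => rfl
      | succ k ih => rw [Function.iterate_succ_apply', hφ, ih, Function.iterate_succ_apply']
    have hex : ∀ (l : List (lieP K p X)) (k : ℕ), ∃ c : lieP K p X,
        (c : A) = rightNormed (l.map Subtype.val) ^ p ^ k ∧ ((φ c : lieP K p Y) : B) =
          rightNormed (l.map fun a => ((φ a : lieP K p Y) : B)) ^ p ^ k := fun l k => by
      obtain ⟨c, h1, h2⟩ := rightNormed_transport (φ : lieP K p X →ₗ⁅K⁆ lieP K p Y) l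
      refine ⟨pMap^[k] c, ?_, ?_⟩
      · rw [pMap_iterate, h1]
      · rw [hφit, pMap_iterate]
        exact congrArg (· ^ p ^ k) h2
    let f1 : lieP K p X →ₗ[K] A := (lieP K p X).toSubmodule.subtype
    let f2 : lieP K p X →ₗ[K] B :=
      (lieP K p Y).toSubmodule.subtype.comp (φ : lieP K p X →ₗ[K] lieP K p Y)
    have e1 : G.map f1 = growthSpace K p X n := by
      rw [Submodule.map_span, growthSpace]
      congr 1
      ext b
      constructor
      · rintro ⟨c, ⟨l, k, h0, hl, hn, h1, -⟩, rfl⟩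
        refine ⟨l.map Subtype.val, k, fun h => h0 (List.map_eq_nil_iff.1 h), ?_, by simpa using hn,
          h1⟩
        intro a ha
        obtain ⟨a', ha', rfl⟩ := List.mem_map.1 ha
        exact hl a' ha'
      · rintro ⟨l, k, h0, hl, hn, rfl⟩
        obtain ⟨l', rfl⟩ : ∃ l' : List (lieP K p X), l'.map Subtype.val = l :=
          ⟨l.attach.map fun a => ⟨a.1, subset_lieP p X (hl a.1 a.2)⟩, by
            simp [List.map_map, Function.comp_def]⟩
        obtain ⟨c, h1, h2⟩ := hex l' k
        refine ⟨c, ⟨l', k, fun h => h0 (by rw [h]; rfl), ?_, by simpa using hn, h1, h2⟩, h1⟩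
        exact fun a ha => hl _ (List.mem_map_of_mem ha)
    have e2 : G.map f2 = growthSpace K p Y' n := by
      rw [Submodule.map_span, growthSpace]
      congr 1
      ext b
      constructor
      · rintro ⟨c, ⟨l, k, h0, hl, hn, -, h1⟩, rfl⟩
        refine ⟨l.map fun a => ((φ a : lieP K p Y) : B), k, by simpa using h0, ?_,
          by simpa using hn, h1⟩
        intro a ha
        obtain ⟨a', ha', rfl⟩ := List.mem_map.1 ha
        exact ⟨a', hl a' ha', rfl⟩
      · rintro ⟨l, k, h0, hl, hn, rfl⟩
        obtain ⟨l', hl', rfl⟩ : ∃ l' : List (lieP K p X), (∀ a ∈ l', a ∈ X') ∧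
            (l'.map fun a => ((φ a : lieP K p Y) : B)) = l := by
          choose! g hg1 hg2 using hl
          refine ⟨l.map g, fun a ha => ?_, ?_⟩
          · obtain ⟨b, hb, rfl⟩ := List.mem_map.1 ha
            exact hg1 b hb
          · rw [List.map_map]
            conv_rhs => rw [← List.map_id l]
            exact List.map_congr_left fun b hb => hg2 b hb
        obtain ⟨c, h1, h2⟩ := hex l' k
        exact ⟨c, ⟨l', k, by simpa using h0, hl', by simpa using hn, h1, h2⟩, h2⟩
    -- Both growth spaces are injective linear images of the single space `G`, hence of equal
    -- dimension.
    have i1 : Function.Injective f1 := Subtype.val_injective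
    have i2 : Function.Injective f2 := Subtype.val_injective.comp φ.injective
    rw [growth, growth, ← e1, ← e2, ← (Submodule.equivMapOfInjective f1 i1 G).finrank_eq,
      ← (Submodule.equivMapOfInjective f2 i2 G).finrank_eq]

end Isomorphism

/-! ### Partial derivatives and `p`-th powers in divided power algebras -/

namespace DPAlgebra

variable {K : Type*} [Field K] {Θ : Type} {p : ℕ} {S : Θ → ℕ}

theorem coef_eq_prod (a b : Θ →₀ ℕ) {T : Finset Θ} (hT : (a + b).support ⊆ T) :
    coef a b = ∏ t ∈ T, (a t + b t).choose (a t) := by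
  rw [coef, Finsupp.prod]
  refine Finset.prod_subset hT fun t _ ht => ?_
  rw [Finsupp.notMem_support_iff, Finsupp.add_apply] at ht
  have h1 : a t = 0 := by omega
  rw [Finsupp.add_apply, ht, h1, Nat.choose_self]

open Classical in
theorem coef_eq_mul (a b : Θ →₀ ℕ) (t : Θ) {T : Finset Θ} (hT : (a + b).support ⊆ T)
    (ht : t ∈ T) :
    coef a b = (a t + b t).choose (a t) * ∏ s ∈ T.erase t, (a s + b s).choose (a s) := by
  rw [coef_eq_prod a b hT, Finset.mul_prod_erase _ (fun s => (a s + b s).choose (a s)) ht]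

theorem choose_dvd_coef (a b : Θ →₀ ℕ) (t : Θ) : (a t + b t).choose (a t) ∣ coef a b := by
  classical
  rw [coef_eq_mul a b t (Finset.subset_insert t _) (Finset.mem_insert_self t _)]
  exact dvd_mul_right _ _

/-- Pascal's rule in the factor of `t`, the other binomials being common to all terms. It becomes
the Leibniz rule for `∂_t`. -/
theorem coef_pascal (a b : Θ →₀ ℕ) (t : Θ) (h : a t + b t ≠ 0) :
    coef a b = (if a t = 0 then 0 else coef (a - Finsupp.single t 1) b) +
      (if b t = 0 then 0 else coef a (b - Finsupp.single t 1)) := by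
  classical
  set T := insert t (a + b).support with hT
  have htT : t ∈ T := Finset.mem_insert_self t _
  have hsub : ∀ c : Θ →₀ ℕ, c ≤ a + b → c.support ⊆ T := fun c hc s hs => by
    rw [hT, Finset.mem_insert, Finsupp.mem_support_iff]
    rw [Finsupp.mem_support_iff] at hs
    have := hc s
    right; omega
  have hne : ∀ c : Θ →₀ ℕ, ∀ s ∈ T.erase t, (c - Finsupp.single t 1 : Θ →₀ ℕ) s = c s := fun c s hs => by
    have := Finset.ne_of_mem_erase hs
    simp [Finsupp.tsub_apply, this.symm]
  have hself : ∀ c : Θ →₀ ℕ, (c - Finsupp.single t 1 : Θ →₀ ℕ) t = c t - 1 := fun c => by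
    simp [Finsupp.tsub_apply]
  have e1 : coef (a - Finsupp.single t 1) b = (a t - 1 + b t).choose (a t - 1) *
      ∏ s ∈ T.erase t, (a s + b s).choose (a s) := by
    rw [coef_eq_mul _ b t (hsub _ fun s => by simp) htT, hself]
    congr 1
    exact Finset.prod_congr rfl fun s hs => by rw [hne a s hs]
  have e2 : coef a (b - Finsupp.single t 1) = (a t + (b t - 1)).choose (a t) *
      ∏ s ∈ T.erase t, (a s + b s).choose (a s) := by
    rw [coef_eq_mul a _ t (hsub _ fun s => by simp) htT, hself]
    congr 1
    exact Finset.prod_congr rfl fun s hs => by rw [hne b s hs]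
  rw [e1, e2, coef_eq_mul a b t (hsub _ le_rfl) htT]
  rcases Nat.eq_zero_or_pos (a t) with ha | ha
  · simp [ha, show b t ≠ 0 by omega]
  · rcases Nat.eq_zero_or_pos (b t) with hb | hb
    · simp [hb, ha.ne']
    · rw [if_neg ha.ne', if_neg hb.ne', ← add_mul]
      congr 1
      obtain ⟨i, hi⟩ := Nat.exists_eq_succ_of_ne_zero ha.ne'
      obtain ⟨j, hj⟩ := Nat.exists_eq_succ_of_ne_zero hb.ne'
      rw [hi, hj]
      simp only [Nat.succ_eq_add_one, Nat.add_sub_cancel]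
      rw [show i + 1 + (j + 1) = (i + (j + 1)) + 1 by ring, Nat.choose_succ_succ]
      congr 2; ring

theorem mono_induction {P : DPAlgebra K p S → Prop} (zero : P 0)
    (add : ∀ f g, P f → P g → P (f + g))
    (mono : ∀ (c : K) (a : Θ →₀ ℕ), (∀ t, a t < p ^ S t) → P (c • mono K p S a))
    (f : DPAlgebra K p S) : P f := by
  induction f using Finsupp.induction_linear with
  | zero => exact zero
  | add f g hf hg => exact add f g hf hg
  | single a c =>
    have := mono c a.1 a.2
    rw [DPAlgebra.mono, dif_pos a.2] at this
    have h2 : c • basisElt K p S a = Finsupp.single a c :=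
      (Finsupp.smul_single c a (1 : K)).trans (by rw [smul_eq_mul, mul_one])
    rw [← h2]
    exact this

open Classical in
theorem partialD_mono (t : Θ) (a : Θ →₀ ℕ) (ha : ∀ t, a t < p ^ S t) :
    partialD t (mono K p S a) =
      if a t = 0 then 0 else mono K p S (a - Finsupp.single t 1) := by
  rw [partialD, lift_mono _ _ ha]

theorem partialD_mono_of_eq_zero (t : Θ) (a : Θ →₀ ℕ) (ha : a t = 0) :
    partialD t (mono K p S a) = 0 := by
  by_cases h : ∀ t, a t < p ^ S t
  · rw [partialD_mono t a h, if_pos ha]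
  · rw [mono_eq_zero a h, map_zero]

theorem partialD_comm (s t : Θ) (f : DPAlgebra K p S) :
    partialD s (partialD t f) = partialD t (partialD s f) := by
  induction f using mono_induction with
  | zero => simp
  | add f g hf hg => simp only [map_add, hf, hg]
  | mono c a ha =>
    rcases eq_or_ne s t with rfl | hst
    · rfl
    · simp only [map_smul]
      congr 1
      have hv : ∀ u : Θ, ∀ s, (a - Finsupp.single u 1 : Θ →₀ ℕ) s < p ^ S s := fun u s =>
        (Nat.sub_le _ _).trans_lt (ha s)
      have e1 : (a - Finsupp.single t 1 : Θ →₀ ℕ) s = a s := by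
        simp [Finsupp.tsub_apply, hst.symm]
      have e2 : (a - Finsupp.single s 1 : Θ →₀ ℕ) t = a t := by
        simp [Finsupp.tsub_apply, hst]
      rw [partialD_mono t a ha, partialD_mono s a ha]
      split_ifs with h1 h2 h2
      · rfl
      · rw [map_zero, partialD_mono_of_eq_zero _ _ (e2.trans h1)]
      · rw [map_zero, partialD_mono_of_eq_zero _ _ (e1.trans h2)]
      · rw [partialD_mono _ _ (hv t), partialD_mono _ _ (hv s), e1, e2, if_neg h1, if_neg h2,
          tsub_right_comm]

variable [Fact p.Prime] [CharP K p]

/-- The danger is the truncation: if `a t + b t = p ^ S t`, the product monomial is zero while its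
formal derivative need not be. In that case the coefficient contains `(p ^ S t).choose (a t)`, which
is divisible by `p`. -/
theorem coef_smul_partialD (t : Θ) (a b : Θ →₀ ℕ) (ha : ∀ t, a t < p ^ S t)
    (hb : ∀ t, b t < p ^ S t) :
    (coef a b : K) • partialD t (mono K p S (a + b)) =
      (coef a b : K) • if a t + b t = 0 then 0 else mono K p S (a + b - Finsupp.single t 1) := by
  classical
  have hpr : p.Prime := Fact.out
  by_cases h : ∀ t, (a + b) t < p ^ S t
  · rw [partialD_mono t _ h, Finsupp.add_apply]
  · rw [mono_eq_zero _ h, map_zero, smul_zero]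
    by_cases h2 : ∀ s, (a + b - Finsupp.single t 1 : Θ →₀ ℕ) s < p ^ S s
    · obtain ⟨s, hs⟩ := not_forall.1 h
      have hst : s = t := by
        by_contra hst
        have := h2 s
        rw [Finsupp.tsub_apply, Finsupp.single_apply, if_neg (Ne.symm hst)] at this
        exact hs this
      subst hst
      have h3 := h2 s
      rw [Finsupp.tsub_apply, Finsupp.single_eq_same] at h3
      rw [Finsupp.add_apply] at hs h3
      have h4 : a s + b s = p ^ S s := by omega
      have h5 : p ∣ (a s + b s).choose (a s) := by
        rw [h4]
        have := hb s
        exact hpr.dvd_choose_pow (by omega) (ha s).ne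
      have h6 : (coef a b : K) = 0 :=
        (CharP.cast_eq_zero_iff K p _).2 (h5.trans (choose_dvd_coef a b s))
      rw [h6, zero_smul]
    · rw [mono_eq_zero _ h2, ite_self, smul_zero]

theorem partialD_mul (t : Θ) (f g : DPAlgebra K p S) :
    partialD t (f * g) = f • partialD t g + g • partialD t f := by
  classical
  simp only [smul_eq_mul]
  induction f using mono_induction with
  | zero => simp
  | add f f' hf hf' => rw [add_mul, map_add, hf, hf', map_add]; ring
  | mono c a ha =>
    induction g using mono_induction with
    | zero => simp
    | add g g' hg hg' => rw [mul_add, map_add, hg, hg', map_add]; ring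
    | mono d b hb =>
      simp only [smul_mul_smul_comm, map_smul, mul_comm d c, ← smul_add]
      congr 1
      rw [mono_mul_mono, map_smul, coef_smul_partialD t a b ha hb, partialD_mono t a ha,
        partialD_mono t b hb]
      by_cases h : a t + b t = 0
      · have h1 : a t = 0 := by omega
        have h2 : b t = 0 := by omega
        simp [h1, h2]
      · rw [if_neg h, coef_pascal a b t h, Nat.cast_add, add_smul, add_comm]
        congr 1
        · split_ifs with h1
          · simp
          · rw [mono_mul_mono, add_tsub_assoc_of_le]
            intro s
            rw [Finsupp.single_apply]
            split_ifs with hs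
            · subst hs; omega
            · exact Nat.zero_le _
        · split_ifs with h1
          · simp
          · rw [mono_mul_mono, coef_comm b]
            congr 2
            rw [add_comm a b, add_tsub_assoc_of_le]
            intro s
            rw [Finsupp.single_apply]
            split_ifs with hs
            · subst hs; omega
            · exact Nat.zero_le _

/-- The partial derivative as a derivation. -/
def partialDer (t : Θ) : Derivation K (DPAlgebra K p S) (DPAlgebra K p S) :=
  Derivation.mk' (partialD t) (partialD_mul t)

theorem partialDer_apply (t : Θ) (f : DPAlgebra K p S) : partialDer t f = partialD t f := rfl

theorem dvd_choose_mul_self {i : ℕ} (hi : i ≠ 0) : p ∣ (p * i).choose i := by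
  obtain ⟨j, rfl⟩ := Nat.exists_eq_succ_of_ne_zero hi
  have hpr : p.Prime := Fact.out
  have hpos : 0 < p * j.succ := Nat.mul_pos hpr.pos (Nat.succ_pos _)
  have := Nat.add_one_mul_choose_eq (p * j.succ - 1) j
  rw [Nat.sub_add_cancel hpos, mul_right_comm] at this
  exact ⟨_, (Nat.eq_of_mul_eq_mul_right (Nat.succ_pos j) this).symm⟩

theorem mono_pow (a : Θ →₀ ℕ) (n : ℕ) : ∃ c : K, mono K p S a ^ n = c • mono K p S (n • a) := by
  induction n with
  | zero => exact ⟨1, by rw [pow_zero, zero_smul, one_smul]; rfl⟩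
  | succ n ih =>
    obtain ⟨c, hc⟩ := ih
    refine ⟨c * (coef (n • a) a : K), ?_⟩
    rw [pow_succ, hc, smul_mul_assoc, mono_mul_mono, smul_smul, succ_nsmul]

/-- The last multiplication contributes the binomial of `p * a t` over `a t`, divisible by `p` as
soon as `a t ≠ 0`. -/
theorem mono_pow_prime {a : Θ →₀ ℕ} (ha : a ≠ 0) : mono K p S a ^ p = 0 := by
  have hpr : p.Prime := Fact.out
  obtain ⟨t, ht⟩ := Finsupp.ne_iff.1 ha
  rw [Finsupp.coe_zero, Pi.zero_apply] at ht
  obtain ⟨c, hc⟩ := mono_pow (K := K) (p := p) (S := S) a (p - 1)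
  rw [← pow_sub_one_mul hpr.ne_zero, hc, smul_mul_assoc, mono_mul_mono]
  have h1 : p ∣ coef ((p - 1) • a) a := by
    rw [coef_comm]
    refine dvd_trans ?_ (choose_dvd_coef a ((p - 1) • a) t)
    have : a t + ((p - 1) • a) t = p * a t := by
      rw [Finsupp.smul_apply, smul_eq_mul, ← one_add_mul, add_comm, Nat.sub_add_cancel hpr.one_le]
    rw [this]
    exact dvd_choose_mul_self ht
  rw [(CharP.cast_eq_zero_iff K p _).2 h1, zero_smul, smul_zero]

end DPAlgebra

open DPAlgebra

theorem smul_lie_smul_derivation {K A : Type*} [CommRing K] [CommRing A] [Algebra K A]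
    (f g : A) (D E : Derivation K A A) :
    ⁅f • D, g • E⁆ = (f * D g) • E - (g * E f) • D + (f * g) • ⁅D, E⁆ := by
  ext a
  simp only [Derivation.commutator_apply, Derivation.add_apply, Derivation.sub_apply,
    Derivation.smul_apply, smul_eq_mul, Derivation.leibniz]
  ring

/-- Together with `mono_pow_prime`, this makes higher powers of nonconstant monomials times pivot
elements vanish. -/
theorem smul_derivation_pow {K A : Type*} [CommRing K] [CommRing A] [Algebra K A]
    (f : A) (D : Derivation K A A) (h : D f = 0) (n : ℕ) (g : A) :
    (((f • D : Derivation K A A) : Module.End K A) ^ n) g =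
      f ^ n * ((D : Module.End K A) ^ n) g := by
  induction n generalizing g with
  | zero => simp
  | succ n ih =>
    rw [pow_succ', pow_succ' (D : Module.End K A), Module.End.mul_apply, Module.End.mul_apply, ih]
    simp only [Derivation.coeFn_coe, Derivation.smul_apply, smul_eq_mul, Derivation.leibniz,
      Derivation.leibniz_pow, h]
    ring

theorem derivation_sum_apply {K A ι : Type*} [CommRing K] [CommRing A] [Algebra K A]
    (s : Finset ι) (D : ι → Derivation K A A) (f : A) : (∑ i ∈ s, D i) f = ∑ i ∈ s, D i f := by
  classical
  induction s using Finset.induction_on with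
  | empty => simp
  | insert a s ha ih => rw [Finset.sum_insert ha, Finset.sum_insert ha, Derivation.add_apply, ih]

/-! ### Pivot elements as derivations; monomials and tail coefficients -/

section Pivot

variable {K : Type*} [Field K] {p : ℕ} {S R : ℕ → ℕ} [Fact p.Prime] [CharP K p]

/-- The partial sums of a pivot element. -/
def pivotTrunc (t : ℕ → Letter) (c : ℕ → CloverRing K p S R) (i N : ℕ) :
    Derivation K (CloverRing K p S R) (CloverRing K p S R) :=
  ∑ j ∈ Finset.Ico i N, (∏ k ∈ Finset.Ico i j, c k) • partialDer (t j)

theorem pivotTrunc_apply (t : ℕ → Letter) (c : ℕ → CloverRing K p S R) (i N : ℕ)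
    (f : CloverRing K p S R) : pivotTrunc t c i N f =
      ∑ j ∈ Finset.Ico i N, (∏ k ∈ Finset.Ico i j, c k) * partialD (t j) f := by
  rw [pivotTrunc, derivation_sum_apply]
  rfl

/-- The infinite sum is locally finite, so identities such as the Leibniz rule are inherited from
its partial sums, which are derivations. -/
theorem pivot_eventually (t : ℕ → Letter) (ht : ∀ i, (t i).gen = i)
    (c : ℕ → CloverRing K p S R) (i : ℕ) (f : CloverRing K p S R) :
    ∃ N₀, ∀ N, N₀ ≤ N → pivot K p S R t c i f = pivotTrunc t c i N f := by
  induction f using mono_induction with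
  | zero => exact ⟨0, fun N _ => by simp⟩
  | add f g hf hg =>
    obtain ⟨N₁, h₁⟩ := hf
    obtain ⟨N₂, h₂⟩ := hg
    exact ⟨max N₁ N₂, fun N hN => by
      rw [map_add, map_add, h₁ N (by omega), h₂ N (by omega)]⟩
  | mono d a ha =>
    refine ⟨genBound a, fun N hN => ?_⟩
    rw [map_smul, Derivation.map_smul, pivot, lift_mono _ _ ha, pivotTrunc_apply]
    congr 1
    refine Finset.sum_subset (Finset.Ico_subset_Ico_right hN) fun j hj hj' => ?_
    rw [partialD_eq_zero _ _ (by rw [ht]; simp at hj hj'; omega), mul_zero]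

/-- Pivot elements as derivations. -/
def pivotDer (t : ℕ → Letter) (ht : ∀ i, (t i).gen = i) (c : ℕ → CloverRing K p S R) (i : ℕ) :
    Derivation K (CloverRing K p S R) (CloverRing K p S R) :=
  Derivation.mk' (pivot K p S R t c i) fun f g => by
    obtain ⟨N₁, h₁⟩ := pivot_eventually t ht c i f
    obtain ⟨N₂, h₂⟩ := pivot_eventually t ht c i g
    obtain ⟨N₃, h₃⟩ := pivot_eventually t ht c i (f * g)
    rw [h₁ (max N₁ (max N₂ N₃)) (by omega), h₂ (max N₁ (max N₂ N₃)) (by omega),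
      h₃ (max N₁ (max N₂ N₃)) (by omega), Derivation.leibniz]

/-- The three families of pivot elements. -/
inductive Kind : Type
  | v : Kind
  | w : Kind
  | u : Kind
  deriving DecidableEq

instance : Fintype Kind := ⟨{.v, .w, .u}, fun k => by cases k <;> simp⟩

/-- The variable that belongs to a pivot element. -/
def Kind.letter : Kind → ℕ → Letter
  | .v => .x
  | .w => .y
  | .u => .z

/-- The family whose variable occurs in the coefficient of the tail. -/
def Kind.other : Kind → Kind
  | .v => .w
  | .w => .v
  | .u => .v

theorem Kind.gen_letter (k : Kind) (n : ℕ) : (k.letter n).gen = n := by cases k <;> rfl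

theorem Kind.letter_other_ne (k : Kind) (n : ℕ) : k.other.letter n ≠ k.letter n := by
  cases k <;> simp [Kind.letter, Kind.other]

variable (K p S R) in
/-- The coefficient of the tail of a pivot element. -/
def tailCoeff (k : Kind) (n : ℕ) : CloverRing K p S R :=
  top K p S R (k.letter n) * top K p S R (k.other.letter n)

variable (K p S R) in
/-- The pivot elements `v_n`, `w_n`, `u_n`. -/
def der (k : Kind) (n : ℕ) : Derivation K (CloverRing K p S R) (CloverRing K p S R) :=
  pivotDer k.letter k.gen_letter (tailCoeff K p S R k) n

theorem der_eventually (k : Kind) (n : ℕ) (f : CloverRing K p S R) :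
    ∃ N₀, ∀ N, N₀ ≤ N → der K p S R k n f = pivotTrunc k.letter (tailCoeff K p S R k) n N f :=
  pivot_eventually k.letter k.gen_letter _ n f

theorem der_rec (k : Kind) (n : ℕ) :
    der K p S R k n = partialDer (k.letter n) + tailCoeff K p S R k n • der K p S R k (n + 1) :=
  Derivation.ext fun f => pivot_rec k.letter k.gen_letter _ n f

/-- `der k n` acts on a monomial in variables of generations `< m` through finitely many terms. -/
theorem der_mono (k : Kind) (n : ℕ) {m : ℕ} {a : Letter →₀ ℕ} (ha : ∀ t, m ≤ t.gen → a t = 0) :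
    der K p S R k n (mono K p _ a) = ∑ j ∈ Finset.Ico n m,
      (∏ i ∈ Finset.Ico n j, tailCoeff K p S R k i) * partialD (k.letter j) (mono K p _ a) := by
  obtain ⟨N, hN⟩ := der_eventually (K := K) (p := p) (S := S) (R := R) k n (mono K p _ a)
  rw [hN (max N m) (le_max_left _ _), pivotTrunc_apply]
  refine (Finset.sum_subset (Finset.Ico_subset_Ico_right (le_max_right _ _)) ?_).symm
  intro j hj hj'
  rw [partialD_mono_of_eq_zero _ _ (ha _ _), mul_zero]
  rw [k.gen_letter]
  simp at hj hj'
  omega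

theorem der_mono_eq_zero (k : Kind) (n : ℕ) {a : Letter →₀ ℕ} (ha : ∀ t, n ≤ t.gen → a t = 0) :
    der K p S R k n (mono K p _ a) = 0 := by
  rw [der_mono k n ha, Finset.Ico_self, Finset.sum_empty]

/-! ### Scalar multiples of a monomial -/

/-- `f` is a scalar multiple of the monomial with exponents `a`. -/
def IsScalarMono (f : CloverRing K p S R) (a : Letter →₀ ℕ) : Prop :=
  ∃ c : K, f = c • mono K p _ a

theorem isScalarMono_mono (a : Letter →₀ ℕ) :
    IsScalarMono (mono K p (height S R) a) a := ⟨1, (one_smul _ _).symm⟩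

theorem isScalarMono_one : IsScalarMono (1 : CloverRing K p S R) 0 := isScalarMono_mono 0

theorem IsScalarMono.mul {f g : CloverRing K p S R} {a b : Letter →₀ ℕ} (hf : IsScalarMono f a)
    (hg : IsScalarMono g b) : IsScalarMono (f * g) (a + b) := by
  obtain ⟨c, rfl⟩ := hf
  obtain ⟨d, rfl⟩ := hg
  exact ⟨c * d * (coef a b : K), by rw [smul_mul_smul_comm, mono_mul_mono, smul_smul]⟩

theorem IsScalarMono.prod {s : Finset ℕ} {f : ℕ → CloverRing K p S R} {a : ℕ → Letter →₀ ℕ}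
    (h : ∀ i ∈ s, IsScalarMono (f i) (a i)) : IsScalarMono (∏ i ∈ s, f i) (∑ i ∈ s, a i) := by
  classical
  induction s using Finset.induction_on with
  | empty => simpa using isScalarMono_one
  | insert i s hi ih =>
    rw [Finset.prod_insert hi, Finset.sum_insert hi]
    exact (h i (Finset.mem_insert_self i s)).mul
      (ih fun j hj => h j (Finset.mem_insert_of_mem hj))

theorem IsScalarMono.partialD_eq_zero {f : CloverRing K p S R} {a : Letter →₀ ℕ}
    (hf : IsScalarMono f a) {t : Letter} (h : a t = 0) : partialD t f = 0 := by
  obtain ⟨c, rfl⟩ := hf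
  rw [map_smul, partialD_mono_of_eq_zero t a h, smul_zero]

theorem IsScalarMono.partialD {f : CloverRing K p S R} {a : Letter →₀ ℕ}
    (hf : IsScalarMono f a) (t : Letter) :
    IsScalarMono (partialD t f) (a - Finsupp.single t 1) := by
  obtain ⟨c, rfl⟩ := hf
  by_cases h : ∀ t, a t < p ^ height S R t
  · rw [map_smul, partialD_mono t a h]
    split_ifs
    · exact ⟨0, by simp⟩
    · exact ⟨c, rfl⟩
  · rw [mono_eq_zero a h, smul_zero, map_zero]
    exact ⟨0, by simp⟩

theorem IsScalarMono.der_eq_zero {f : CloverRing K p S R} {a : Letter →₀ ℕ}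
    (hf : IsScalarMono f a) (k : Kind) {n : ℕ} (ha : ∀ t, n ≤ t.gen → a t = 0) :
    der K p S R k n f = 0 := by
  obtain ⟨c, rfl⟩ := hf
  rw [Derivation.map_smul, der_mono_eq_zero k n ha, smul_zero]

variable (p S R) in
/-- The exponents of `tailCoeff`. -/
def tailExp (k : Kind) (n : ℕ) : Letter →₀ ℕ :=
  Finsupp.single (k.letter n) (p ^ height S R (k.letter n) - 1) +
    Finsupp.single (k.other.letter n) (p ^ height S R (k.other.letter n) - 1)

theorem isScalarMono_tailCoeff (k : Kind) (n : ℕ) :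
    IsScalarMono (tailCoeff K p S R k n) (tailExp p S R k n) :=
  (isScalarMono_mono _).mul (isScalarMono_mono _)

theorem tailExp_eq_zero (k : Kind) {n : ℕ} {t : Letter} (h : t.gen ≠ n) :
    tailExp p S R k n t = 0 := by
  have h1 : ∀ l : Kind, l.letter n ≠ t := fun l e => h (by rw [← e, l.gen_letter])
  rw [tailExp, Finsupp.add_apply, Finsupp.single_eq_of_ne (h1 _).symm,
    Finsupp.single_eq_of_ne (h1 _).symm, add_zero]

theorem der_tailCoeff_eq_zero (k l : Kind) {m n : ℕ} (h : m < n) :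
    der K p S R l n (tailCoeff K p S R k m) = 0 :=
  (isScalarMono_tailCoeff k m).der_eq_zero l fun t ht => tailExp_eq_zero k (by omega)

theorem dpow_mul_dpow (t : Letter) (i j : ℕ) :
    dpow K p (height S R) t i * dpow K p (height S R) t j =
      ((i + j).choose i : K) • dpow K p (height S R) t (i + j) := by
  classical
  rw [dpow, dpow, mono_mul_mono, dpow, Finsupp.single_add]
  congr 2
  rw [coef_eq_prod (T := {t})]
  · simp
  · rw [← Finsupp.single_add]; exact Finsupp.support_single_subset

theorem dpow_eq_zero {t : Letter} {i : ℕ} (h : p ^ height S R t ≤ i) :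
    dpow K p (height S R) t i = 0 :=
  mono_eq_zero _ fun h' => by
    have := h' t
    rw [Finsupp.single_eq_same] at this
    omega

theorem dpow_mul_top {t : Letter} {i : ℕ} (hi : i ≠ 0) :
    dpow K p (height S R) t i * top K p S R t = 0 := by
  rw [top, dpow_mul_dpow, dpow_eq_zero, smul_zero]
  omega

theorem top_x_mul_top_x (hS : ∀ n, 0 < S n) (n : ℕ) : top K p S R (.x n) * top K p S R (.x n) = 0 := by
  have hpr : p.Prime := Fact.out
  refine dpow_mul_top ?_
  have := Nat.one_lt_pow (hS n).ne' hpr.one_lt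
  simp only [height]
  omega

/-- All three tail coefficients of generation `n` share the factor `x_n^(p^S_n - 1)`, whose square
is out of range because `S_n > 0`. -/
theorem tailCoeff_mul_tailCoeff (hS : ∀ n, 0 < S n) (k l : Kind) (n : ℕ) :
    tailCoeff K p S R k n * tailCoeff K p S R l n = 0 := by
  have h : ∀ k : Kind, ∃ e, tailCoeff K p S R k n = top K p S R (.x n) * e := fun k => by
    cases k
    exacts [⟨_, rfl⟩, ⟨_, mul_comm _ _⟩, ⟨_, mul_comm _ _⟩]
  obtain ⟨e, he⟩ := h k
  obtain ⟨f, hf⟩ := h l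
  rw [he, hf, mul_mul_mul_comm, top_x_mul_top_x hS, zero_mul]

end Pivot

open DPAlgebra

/-- Derivations of the divided power algebra. -/
abbrev CloverDer (K : Type*) [Field K] (p : ℕ) (S R : ℕ → ℕ) : Type _ :=
  Derivation K (CloverRing K p S R) (CloverRing K p S R)

/-! ### Brackets of pivot elements -/

section Brackets

variable {K : Type*} [Field K] {p : ℕ} {S R : ℕ → ℕ} [Fact p.Prime] [CharP K p]

theorem partialDer_lie_partialDer (s t : Letter) :
    ⁅(partialDer s : CloverDer K p S R), (partialDer t : CloverDer K p S R)⁆ = 0 := by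
  ext f
  rw [Derivation.commutator_apply, Derivation.zero_apply, sub_eq_zero]
  exact partialD_comm s t f

theorem partialDer_lie_der {t : Letter} (k : Kind) {n : ℕ} (h : t.gen < n) :
    ⁅(partialDer t : CloverDer K p S R), der K p S R k n⁆ = 0 := by
  ext f
  rw [Derivation.commutator_apply, Derivation.zero_apply, sub_eq_zero]
  obtain ⟨N₁, h₁⟩ := der_eventually (K := K) (p := p) (S := S) (R := R) k n f
  obtain ⟨N₂, h₂⟩ := der_eventually (K := K) (p := p) (S := S) (R := R) k n (partialDer t f)
  rw [h₁ _ (le_max_left N₁ N₂), h₂ _ (le_max_right N₁ N₂), pivotTrunc_apply, pivotTrunc_apply,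
    map_sum]
  refine Finset.sum_congr rfl fun j _ => ?_
  have h0 : partialDer t (∏ i ∈ Finset.Ico n j, tailCoeff K p S R k i) = 0 := by
    refine (IsScalarMono.prod fun i _ => isScalarMono_tailCoeff k i).partialD_eq_zero ?_
    rw [Finsupp.finsetSum_apply]
    refine Finset.sum_eq_zero fun i hi => tailExp_eq_zero k ?_
    have := (Finset.mem_Ico.1 hi).1
    omega
  rw [Derivation.leibniz, h0, smul_zero, add_zero, smul_eq_mul, partialDer_apply,
    partialDer_apply, partialD_comm]

/-- Unrolling the recursion for the lower pivot element, each `∂` of generation `< m` commutes with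
`d_m`, and `d_m` kills the coefficients passed on the way. Only the part of generation `m` is left.
-/
theorem der_lie_der_of_le (k l : Kind) {n m : ℕ} (h : n ≤ m) :
    ⁅der K p S R k n, der K p S R l m⁆ =
      (∏ i ∈ Finset.Ico n m, tailCoeff K p S R k i) • ⁅der K p S R k m, der K p S R l m⁆ := by
  induction h using Nat.decreasingInduction with
  | self => rw [Finset.Ico_self, Finset.prod_empty, one_smul]
  | of_succ n hn ih =>
    have h1 := smul_lie_smul_derivation (tailCoeff K p S R k n) 1 (der K p S R k (n + 1))
      (der K p S R l m)
    rw [one_smul, mul_one, one_mul, der_tailCoeff_eq_zero k l hn, Derivation.map_one_eq_zero,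
      mul_zero, zero_smul, zero_smul, sub_zero, zero_add] at h1
    rw [der_rec k n, add_lie, partialDer_lie_der l (by rw [k.gen_letter]; exact hn), zero_add, h1,
      ih, smul_smul, ← Finset.prod_eq_prod_Ico_succ_bot hn]

/-- Of the four brackets of heads and tails, the two heads commute and the two tails have tail
coefficients with product zero. In the mixed brackets a head only differentiates the other tail
coefficient. -/
theorem der_lie_der_same (hS : ∀ n, 0 < S n) (k l : Kind) (m : ℕ) :
    ⁅der K p S R k m, der K p S R l m⁆ =
      partialD (k.letter m) (tailCoeff K p S R l m) • der K p S R l (m + 1) -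
        partialD (l.letter m) (tailCoeff K p S R k m) • der K p S R k (m + 1) := by
  have h1 := smul_lie_smul_derivation (1 : CloverRing K p S R) (tailCoeff K p S R l m)
    (partialDer (k.letter m) : CloverDer K p S R) (der K p S R l (m + 1))
  rw [one_smul, one_mul, one_mul, Derivation.map_one_eq_zero, mul_zero, zero_smul, sub_zero,
    partialDer_lie_der l (by rw [k.gen_letter]; exact Nat.lt_succ_self m), smul_zero,
    add_zero] at h1
  have h2 := smul_lie_smul_derivation (tailCoeff K p S R k m) 1
    (der K p S R k (m + 1)) (partialDer (l.letter m))
  rw [one_smul, mul_one, one_mul, Derivation.map_one_eq_zero, mul_zero, zero_smul, zero_sub,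
    ← lie_skew (der K p S R k (m + 1)), partialDer_lie_der k (by rw [l.gen_letter]; exact Nat.lt_succ_self m),
    neg_zero, smul_zero, add_zero] at h2
  have h3 := smul_lie_smul_derivation (tailCoeff K p S R k m) (tailCoeff K p S R l m)
    (der K p S R k (m + 1)) (der K p S R l (m + 1))
  rw [der_tailCoeff_eq_zero l k (Nat.lt_succ_self m), der_tailCoeff_eq_zero k l (Nat.lt_succ_self m),
    tailCoeff_mul_tailCoeff hS, mul_zero, mul_zero, zero_smul, zero_smul, zero_smul, sub_zero,
    zero_add] at h3
  rw [der_rec k m, der_rec l m, add_lie, lie_add, lie_add, partialDer_lie_partialDer, h1, h2, h3,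
    zero_add, add_zero, ← sub_eq_add_neg]
  rfl

end Brackets

/-! ### Lengths of pivot elements and weights of monomials -/

section Weights

variable (p : ℕ) (S : ℕ → ℕ)

/-- The common length of the pivot elements `v_n`, `w_n`, `u_n` in the generators, for `R_n = 1`. -/
def pivotLength (n : ℕ) : ℕ := ∏ i ∈ Finset.range n, (p ^ S i + p - 1)

/-- The weight of an exponent vector. -/
def expWeight : (Letter →₀ ℕ) →+ ℕ := Finsupp.weight fun t => pivotLength p S t.gen

/-- The total degree in the variables of generation `n`. -/
def genDegree (n : ℕ) : (Letter →₀ ℕ) →+ ℕ := Finsupp.weight fun t => if t.gen = n then 1 else 0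

theorem pivotLength_zero : pivotLength p S 0 = 1 := rfl

theorem pivotLength_succ (n : ℕ) :
    pivotLength p S (n + 1) = pivotLength p S n * (p ^ S n + p - 1) :=
  Finset.prod_range_succ _ _

theorem expWeight_single (t : Letter) (i : ℕ) :
    expWeight p S (Finsupp.single t i) = i * pivotLength p S t.gen := by
  rw [expWeight, Finsupp.weight_single, smul_eq_mul]

theorem genDegree_single (n : ℕ) (t : Letter) (i : ℕ) :
    genDegree n (Finsupp.single t i) = if t.gen = n then i else 0 := by
  rw [genDegree, Finsupp.weight_single, smul_eq_mul]
  split_ifs <;> simp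

theorem expWeight_sub_single {a : Letter →₀ ℕ} {t : Letter} (h : a t ≠ 0) :
    expWeight p S (a - Finsupp.single t 1) + pivotLength p S t.gen = expWeight p S a :=
  Finsupp.weight_sub_single_add h

theorem genDegree_sub_single {n : ℕ} {a : Letter →₀ ℕ} {t : Letter} (h : a t ≠ 0) :
    genDegree n (a - Finsupp.single t 1) + (if t.gen = n then 1 else 0) = genDegree n a :=
  Finsupp.weight_sub_single_add h

theorem genDegree_eq_zero {n : ℕ} {a : Letter →₀ ℕ} (h : ∀ t, t.gen = n → a t = 0) :
    genDegree n a = 0 := by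
  rw [genDegree, Finsupp.weight_apply, Finsupp.sum]
  refine Finset.sum_eq_zero fun t _ => ?_
  split_ifs with ht
  · rw [h t ht, zero_smul]
  · rw [smul_zero]

variable {p S}

theorem pivotLength_pos (hp : 1 ≤ p) (n : ℕ) : 0 < pivotLength p S n :=
  Finset.prod_pos fun i _ => by
    have := Nat.pow_pos (n := S i) hp
    omega

theorem genDegree_tailExp (hp : 1 ≤ p) (k : Kind) (m n : ℕ) :
    genDegree m (tailExp p S paramR k n) = if n = m then p ^ S n + p - 2 else 0 := by
  have := Nat.pow_pos (n := S n) hp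
  rw [tailExp, map_add, genDegree_single, genDegree_single, k.gen_letter, k.other.gen_letter]
  split_ifs
  · cases k <;> simp only [height, Kind.letter, Kind.other, paramR, pow_one] <;> omega
  · rfl

/-- This identity makes `d_n` homogeneous: its head lowers weight by `ℓ_n`, and its tail lowers it
by `ℓ_{n+1}` less the weight of the coefficient. It is the reason for the factor `p ^ S n + p - 1`
in `pivotLength`. -/
theorem expWeight_tailExp (hp : 1 ≤ p) (k : Kind) (n : ℕ) :
    expWeight p S (tailExp p S paramR k n) + pivotLength p S n = pivotLength p S (n + 1) := by
  have h1 := Nat.pow_pos (n := S n) hp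
  rw [tailExp, map_add, expWeight_single, expWeight_single, k.gen_letter, k.other.gen_letter,
    pivotLength_succ, ← add_mul, ← Nat.succ_mul, mul_comm]
  congr 1
  cases k <;> simp only [height, Kind.letter, Kind.other, paramR, pow_one] <;> omega

theorem expWeight_sum_tailExp (hp : 1 ≤ p) (k : Kind) {n m : ℕ} (h : n ≤ m) :
    expWeight p S (∑ i ∈ Finset.Ico n m, tailExp p S paramR k i) + pivotLength p S n =
      pivotLength p S m := by
  induction m, h using Nat.le_induction with
  | base => simp
  | succ m h ih =>
    have := expWeight_tailExp (S := S) hp k m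
    rw [Finset.sum_Ico_succ_top h, map_add]
    omega

end Weights

/-! ### A Lie filtration by monomials times pivot elements -/

section UpperFiltration

variable (K : Type*) [Field K] (p : ℕ) (S : ℕ → ℕ) [Fact p.Prime] [CharP K p]

/-- Exponent vectors `a` for which `∏ t^{(a t)}` times a pivot element of generation `n` is
admitted in the filtration at level `s`. -/
structure Admissible (n s : ℕ) (a : Letter →₀ ℕ) : Prop where
  gen_lt : ∀ t, n ≤ t.gen → a t = 0
  genDegree_le : ∀ m, n = m + 1 → genDegree m a ≤ p ^ S m + p - 3
  weight_le : pivotLength p S n ≤ s + expWeight p S a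

/-- The products of monomials and pivot elements that span a Lie filtration containing the
clover Lie algebra. -/
def pivotMonomials (s : ℕ) : Set (Module.End K (CloverRing K p S paramR)) :=
  {b | ∃ k n a, Admissible p S n s a ∧ b =
    (mono K p (height S paramR) a • der K p S paramR k n : CloverDer K p S paramR).toLinearMap}

variable {K p S}

theorem smul_der_mem {s n : ℕ} {k : Kind} {a : Letter →₀ ℕ} {f : CloverRing K p S paramR}
    (hf : IsScalarMono f a) (ha : Admissible p S n s a) :
    (f • der K p S paramR k n : CloverDer K p S paramR).toLinearMap ∈
      Submodule.span K (pivotMonomials K p S s) := by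
  obtain ⟨c, rfl⟩ := hf
  rw [smul_assoc, Derivation.coe_smul_linearMap]
  exact Submodule.smul_mem _ _ (Submodule.subset_span ⟨k, n, a, ha, rfl⟩)

/-- As `d_m` kills `t^(a)`, there remain `t^(a) d_n(t^(b)) d_m` and `t^(a+b) [d_n, d_m]`. By
homogeneity the lengths add in both; the first stays in generation `m`, the second moves to
generation `m + 1`. -/
theorem pivotMonomials_lie_mem_of_le (hS : ∀ n, 0 < S n) {s s' n m : ℕ} (hnm : n ≤ m)
    (k l : Kind) {a b : Letter →₀ ℕ} (ha : Admissible p S n s a) (hb : Admissible p S m s' b) :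
    (⁅mono K p (height S paramR) a • der K p S paramR k n,
      mono K p (height S paramR) b • der K p S paramR l m⁆ : CloverDer K p S paramR).toLinearMap ∈
        Submodule.span K (pivotMonomials K p S (s + s')) := by
  have hpr : p.Prime := Fact.out
  have hp1 := hpr.one_le
  rw [smul_lie_smul_derivation, der_mono_eq_zero l m fun t ht => ha.gen_lt t (hnm.trans ht),
    mul_zero, zero_smul, sub_zero, Derivation.coe_add_linearMap]
  have hsum : ∀ {j t}, (t : Letter).gen < n ∨ j ≤ t.gen →
      (∑ i ∈ Finset.Ico n j, tailExp p S paramR k i) t = 0 := fun {j t} ht => by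
    rw [Finsupp.finsetSum_apply]
    refine Finset.sum_eq_zero fun i hi => tailExp_eq_zero k ?_
    have := Finset.mem_Ico.1 hi
    omega
  have hprod : ∀ j, IsScalarMono (∏ i ∈ Finset.Ico n j, tailCoeff K p S paramR k i)
      (∑ i ∈ Finset.Ico n j, tailExp p S paramR k i) := fun j =>
    IsScalarMono.prod fun i _ => isScalarMono_tailCoeff k i
  have hwa := ha.weight_le
  have hwb := hb.weight_le
  refine add_mem ?_ ?_
  · rw [der_mono k n hb.gen_lt, Finset.mul_sum, Finset.sum_smul]
    have hcoe : ∀ (T : Finset ℕ)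
        (D : ℕ → CloverDer K p S paramR), (∀ j ∈ T, (D j).toLinearMap ∈
          Submodule.span K (pivotMonomials K p S (s + s'))) →
        (∑ j ∈ T, D j : CloverDer K p S paramR).toLinearMap ∈
          Submodule.span K (pivotMonomials K p S (s + s')) := fun T D hD => by
      have : (∑ j ∈ T, D j : CloverDer K p S paramR).toLinearMap =
          ∑ j ∈ T, (D j).toLinearMap := by
        refine LinearMap.ext fun f => ?_
        rw [LinearMap.sum_apply]
        exact derivation_sum_apply T D f
      rw [this]
      exact Submodule.sum_mem _ hD
    refine hcoe _ _ fun j hj => ?_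
    obtain ⟨hnj, hjm⟩ := Finset.mem_Ico.1 hj
    by_cases hbj : b (k.letter j) = 0
    · rw [partialD_mono_of_eq_zero _ _ hbj, mul_zero, mul_zero, zero_smul]
      exact zero_mem _
    · refine smul_der_mem
        ((isScalarMono_mono a).mul ((hprod j).mul ((isScalarMono_mono b).partialD _))) ⟨?_, ?_, ?_⟩
      · intro t ht
        rw [Finsupp.add_apply, Finsupp.add_apply, ha.gen_lt t (hnm.trans ht), hsum (by omega),
          Finsupp.tsub_apply, hb.gen_lt t ht, Nat.zero_sub, add_zero, add_zero]
      · rintro m' rfl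
        rw [map_add, map_add, genDegree_eq_zero fun t ht => ha.gen_lt t (by omega),
          genDegree_eq_zero (a := ∑ i ∈ _, _) fun t ht => hsum (by omega)]
        have h1 := genDegree_sub_single (n := m') hbj
        have h2 := hb.genDegree_le m' rfl
        omega
      · have h1 := expWeight_sub_single p S hbj
        have h2 := expWeight_sum_tailExp (S := S) hp1 k hnj
        rw [k.gen_letter] at h1
        rw [map_add, map_add]
        omega
  · rw [der_lie_der_of_le k l hnm, der_lie_der_same hS, smul_smul, smul_sub, smul_smul, smul_smul,
      Derivation.coe_sub_linearMap]
    have key : ∀ k' l' : Kind, (((mono K p (height S paramR) a * mono K p (height S paramR) b *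
        ∏ i ∈ Finset.Ico n m, tailCoeff K p S paramR k i) *
        partialD (k'.letter m) (tailCoeff K p S paramR l' m)) • der K p S paramR l' (m + 1) :
        CloverDer K p S paramR).toLinearMap ∈
          Submodule.span K (pivotMonomials K p S (s + s')) := fun k' l' => by
      by_cases hc : tailExp p S paramR l' m (k'.letter m) = 0
      · rw [(isScalarMono_tailCoeff l' m).partialD_eq_zero hc, mul_zero, zero_smul]
        exact zero_mem _
      · refine smul_der_mem ((((isScalarMono_mono a).mul (isScalarMono_mono b)).mul
          (hprod m)).mul ((isScalarMono_tailCoeff l' m).partialD _)) ⟨?_, ?_, ?_⟩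
        · intro t ht
          rw [Finsupp.add_apply, Finsupp.add_apply, Finsupp.add_apply, ha.gen_lt t (by omega),
            hb.gen_lt t (by omega), hsum (by omega), Finsupp.tsub_apply,
            tailExp_eq_zero l' (by omega), Nat.zero_sub]
        -- Here the degree bound of `Admissible` originates: the tail coefficient has degree `p ^ S
        -- m + p - 2` in generation `m`, and one derivative has been applied to it.
        · rintro m' hm'
          obtain rfl : m = m' := by omega
          rw [map_add, map_add, map_add, genDegree_eq_zero fun t ht => ha.gen_lt t (by omega),
            genDegree_eq_zero (a := b) fun t ht => hb.gen_lt t (by omega),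
            genDegree_eq_zero (a := ∑ i ∈ _, _) fun t ht => hsum (by omega)]
          have h1 := genDegree_sub_single (n := m) hc
          rw [genDegree_tailExp hp1, if_pos rfl, if_pos (k'.gen_letter m)] at h1
          omega
        · have h1 := expWeight_sub_single p S hc
          have h2 := expWeight_sum_tailExp (S := S) hp1 k hnm
          have h3 := expWeight_tailExp (S := S) hp1 l' m
          rw [k'.gen_letter] at h1
          rw [map_add, map_add, map_add]
          omega
    exact sub_mem (key k l) (key l k)

variable (K p) in
theorem pivotMonomials_isLieFiltration (hS : ∀ n, 0 < S n) :
    IsLieFiltration K fun s => Submodule.span K (pivotMonomials K p S s) := by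
  have hm : Monotone fun s => Submodule.span K (pivotMonomials K p S s) := fun s s' hs =>
    Submodule.span_mono fun b ⟨k, n, a, ha, hb⟩ =>
      ⟨k, n, a, ⟨ha.gen_lt, ha.genDegree_le, ha.weight_le.trans (Nat.add_le_add_right hs _)⟩, hb⟩
  refine ⟨hm, fun {s t a b} ha hb => ?_⟩
  induction ha using Submodule.span_induction with
  | zero => rw [zero_lie]; exact zero_mem _
  | add x y _ _ hx hy => rw [add_lie]; exact add_mem hx hy
  | smul c x _ hx => rw [smul_lie]; exact Submodule.smul_mem _ _ hx
  | mem x hx =>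
    obtain ⟨k, n, a, ha, rfl⟩ := hx
    induction hb using Submodule.span_induction with
    | zero => rw [lie_zero]; exact zero_mem _
    | add x y _ _ hx hy => rw [lie_add]; exact add_mem hx hy
    | smul c x _ hx => rw [lie_smul]; exact Submodule.smul_mem _ _ hx
    | mem x hx =>
      obtain ⟨l, m, b, hb, rfl⟩ := hx
      rcases le_total n m with h | h
      · rw [← Derivation.commutator_coe_linear_map]
        exact pivotMonomials_lie_mem_of_le hS h k l ha hb
      · rw [← lie_skew, ← Derivation.commutator_coe_linear_map, add_comm]
        exact neg_mem (pivotMonomials_lie_mem_of_le hS h l k hb ha)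

/-- A spanning set of the space that contains the elements of length at most `m` of the clover
Lie algebra. -/
def upperSpanning (K : Type*) [Field K] (p : ℕ) [Fact p.Prime] [CharP K p] (S : ℕ → ℕ) (m : ℕ) :
    Set (Module.End K (CloverRing K p S paramR)) :=
  {b | ∃ k n a, (∀ t, a t < p ^ height S paramR t) ∧ Admissible p S n m a ∧
      b = (mono K p (height S paramR) a • der K p S paramR k n :
        CloverDer K p S paramR).toLinearMap} ∪
    {b | ∃ k n j, pivotLength p S n * p ^ j ≤ m ∧
      b = ((der K p S paramR k n).toLinearMap : Module.End K (CloverRing K p S paramR)) ^ p ^ j}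

/-- A pivot element kills its coefficient `t^(a)`, so powers of `t^(a) d_n` involve powers of
`t^(a)`, which vanish for `a ≠ 0`. Only powers of bare pivot elements have to be added. -/
theorem growthSpace_le_upperSpanning (hS : ∀ n, 0 < S n) (m : ℕ) :
    growthSpace K p (cloverGen K p S paramR) m ≤ Submodule.span K (upperSpanning K p S m) := by
  have hpr : p.Prime := Fact.out
  have hW := powerHull_isRestrictedFiltration p (pivotMonomials_isLieFiltration K p hS)
  have h0 : ∀ k, (der K p S paramR k 0).toLinearMap ∈
      powerHull K p (pivotMonomials K p S) 1 := fun k => by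
    refine span_le_powerHull p _ 1 (Submodule.subset_span ⟨k, 0, 0, ⟨fun t _ => rfl, ?_, ?_⟩, ?_⟩)
    · exact fun m hm => absurd hm (Nat.succ_ne_zero m).symm
    · rw [pivotLength_zero]; omega
    · rw [show mono K p (height S paramR) 0 = 1 from rfl, one_smul]
  have hX : cloverGen K p S paramR ⊆ powerHull K p (pivotMonomials K p S) 1 := by
    rintro x (rfl | rfl | rfl)
    exacts [h0 .v, h0 .w, h0 .u]
  have h1 := hW.growthSpace_le p hX m
  rw [one_mul] at h1
  refine h1.trans (Submodule.span_le.2 ?_)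
  rintro _ ⟨s, j, hs, _, ⟨k, n, a, ha, rfl⟩, rfl⟩
  rcases eq_or_ne a 0 with rfl | ha0
  · refine Submodule.subset_span (Or.inr ⟨k, n, j, ?_, ?_⟩)
    · have := ha.weight_le
      rw [map_zero, add_zero] at this
      exact (Nat.mul_le_mul_right _ this).trans hs
    · rw [show mono K p (height S paramR) 0 = 1 from rfl, one_smul]
  · rcases Nat.eq_zero_or_pos j with rfl | hj
    · rw [pow_zero, pow_one]
      rw [pow_zero, mul_one] at hs
      by_cases hv : ∀ t, a t < p ^ height S paramR t
      · exact Submodule.subset_span (Or.inl ⟨k, n, a, hv, ⟨ha.gen_lt, ha.genDegree_le,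
          ha.weight_le.trans (Nat.add_le_add_right hs _)⟩, rfl⟩)
      · rw [mono_eq_zero a hv, zero_smul]
        exact zero_mem _
    · have h2 : ((mono K p (height S paramR) a • der K p S paramR k n :
          CloverDer K p S paramR).toLinearMap : Module.End K (CloverRing K p S paramR)) ^ p ^ j = 0 := by
        refine LinearMap.ext fun g => ?_
        obtain ⟨i, rfl⟩ := Nat.exists_eq_succ_of_ne_zero hj.ne'
        rw [smul_derivation_pow _ _ (der_mono_eq_zero k n ha.gen_lt), pow_succ', pow_mul,
          mono_pow_prime ha0, zero_pow (pow_ne_zero _ hpr.ne_zero), zero_mul,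
          LinearMap.zero_apply]
      rw [h2]
      exact zero_mem _

end UpperFiltration

/-! ### Mixed radix expansions and bounds for weights -/

section Exponents

variable {p : ℕ} {S : ℕ → ℕ}

/-- The exponent vector with given exponents of the variables of generations `< n`. -/
def expVec (n : ℕ) (α β γ : ℕ → ℕ) : Letter →₀ ℕ :=
  ∑ i ∈ Finset.range n, (Finsupp.single (Letter.x i) (α i) + Finsupp.single (Letter.y i) (β i) +
    Finsupp.single (Letter.z i) (γ i))

theorem expVec_x (n : ℕ) (α β γ : ℕ → ℕ) (i : ℕ) :
    expVec n α β γ (.x i) = if i < n then α i else 0 := by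
  classical
  simp [expVec, Finsupp.finsetSum_apply, Finsupp.single_apply]

theorem expVec_y (n : ℕ) (α β γ : ℕ → ℕ) (i : ℕ) :
    expVec n α β γ (.y i) = if i < n then β i else 0 := by
  classical
  simp [expVec, Finsupp.finsetSum_apply, Finsupp.single_apply]

theorem expVec_z (n : ℕ) (α β γ : ℕ → ℕ) (i : ℕ) :
    expVec n α β γ (.z i) = if i < n then γ i else 0 := by
  classical
  simp [expVec, Finsupp.finsetSum_apply, Finsupp.single_apply]

theorem expVec_eq_self {n : ℕ} {a : Letter →₀ ℕ} (ha : ∀ t, n ≤ t.gen → a t = 0) :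
    expVec n (fun i => a (.x i)) (fun i => a (.y i)) (fun i => a (.z i)) = a := by
  ext t
  have := ha t
  cases t with
  | x i => rw [expVec_x]; split_ifs with h; exacts [rfl, (this (not_lt.1 h)).symm]
  | y i => rw [expVec_y]; split_ifs with h; exacts [rfl, (this (not_lt.1 h)).symm]
  | z i => rw [expVec_z]; split_ifs with h; exacts [rfl, (this (not_lt.1 h)).symm]

theorem expWeight_expVec (n : ℕ) (α β γ : ℕ → ℕ) :
    expWeight p S (expVec n α β γ) =
      ∑ i ∈ Finset.range n, (α i + β i + γ i) * pivotLength p S i := by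
  rw [expVec, map_sum]
  refine Finset.sum_congr rfl fun i _ => ?_
  rw [map_add, map_add, expWeight_single, expWeight_single, expWeight_single]
  simp only [Letter.gen]
  ring

theorem expWeight_eq_sum {n : ℕ} {a : Letter →₀ ℕ} (ha : ∀ t, n ≤ t.gen → a t = 0) :
    expWeight p S a =
      ∑ i ∈ Finset.range n, (a (.x i) + a (.y i) + a (.z i)) * pivotLength p S i := by
  conv_lhs => rw [← expVec_eq_self ha]
  exact expWeight_expVec n _ _ _

theorem genDegree_eq {n : ℕ} {a : Letter →₀ ℕ} (ha : ∀ t, n + 1 ≤ t.gen → a t = 0) :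
    genDegree n a = a (.x n) + a (.y n) + a (.z n) := by
  conv_lhs => rw [← expVec_eq_self ha, expVec, map_sum]
  rw [Finset.sum_eq_single n]
  · simp [genDegree_single, Letter.gen]
  · intro i _ hi
    simp [genDegree_single, Letter.gen, hi]
  · simp

theorem sum_mul_pivotLength (hp : 1 ≤ p) (n : ℕ) :
    ∑ i ∈ Finset.range n, (p ^ S i + p - 2) * pivotLength p S i + 1 = pivotLength p S n := by
  induction n with
  | zero => rfl
  | succ n ih =>
    have h1 := Nat.pow_pos (n := S n) hp
    rw [Finset.sum_range_succ, add_right_comm, ih, pivotLength_succ]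
    obtain ⟨r, hr⟩ : ∃ r, p ^ S n + p = r + 2 := ⟨p ^ S n + p - 2, by omega⟩
    rw [hr, Nat.add_sub_cancel, show r + 2 - 1 = r + 1 by omega]
    ring

theorem sum_digits_lt (hp : 1 ≤ p) {α : ℕ → ℕ} (hα : ∀ i, α i < p ^ S i) (n : ℕ) :
    ∑ i ∈ Finset.range n, α i * pivotLength p S i < pivotLength p S n := by
  rw [← sum_mul_pivotLength hp n, Nat.lt_succ_iff]
  refine Finset.sum_le_sum fun i _ => Nat.mul_le_mul_right _ ?_
  have := hα i
  omega

/-- The `ℓ_i` are the place values of a mixed radix system of bases `p ^ S i + p - 1`. Digits below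
`p ^ S i` are legitimate, hence determined by the sum. -/
theorem digits_unique (hp : 1 ≤ p) {α β : ℕ → ℕ} (hα : ∀ i, α i < p ^ S i)
    (hβ : ∀ i, β i < p ^ S i) : ∀ n, ∑ i ∈ Finset.range n, α i * pivotLength p S i =
      ∑ i ∈ Finset.range n, β i * pivotLength p S i → ∀ i < n, α i = β i
  | 0, _, i, hi => absurd hi (Nat.not_lt_zero i)
  | n + 1, h, i, hi => by
    rw [Finset.sum_range_succ, Finset.sum_range_succ] at h
    have h1 := sum_digits_lt hp hα n
    have h2 := sum_digits_lt hp hβ n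
    have hpos := pivotLength_pos (S := S) hp n
    have h3 : α n = β n := by
      have := congrArg (· / pivotLength p S n) h
      simpa [Nat.add_mul_div_right _ _ hpos, Nat.div_eq_of_lt h1, Nat.div_eq_of_lt h2] using this
    rcases Nat.lt_succ_iff_lt_or_eq.1 hi with hi | rfl
    · exact digits_unique hp hα hβ n (by rw [h3] at h; omega) i hi
    · exact h3

/-- In generation `i` the total exponent is at most `(p ^ S i - 1) + 2 (p - 1)`, which falls short
of `2 (p ^ S i + p - 2)` by `p ^ S i - 1`. The sum of these deficits is kept, as it bounds the
generations occurring at a given length. -/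
theorem expWeight_add_le (hp : 1 < p) {n : ℕ} {a : Letter →₀ ℕ}
    (hv : ∀ t, a t < p ^ height S paramR t) (ha : ∀ t, n ≤ t.gen → a t = 0) :
    expWeight p S a + 2 + ∑ i ∈ Finset.range n, (p ^ S i - 1) * pivotLength p S i ≤
      2 * pivotLength p S n := by
  rw [expWeight_eq_sum ha, ← sum_mul_pivotLength hp.le n, add_right_comm, ← Finset.sum_add_distrib,
    mul_add, Finset.mul_sum]
  refine Nat.add_le_add_right (Finset.sum_le_sum fun i _ => ?_) _
  rw [← add_mul, ← mul_assoc]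
  refine Nat.mul_le_mul_right _ ?_
  have h1 := hv (.x i)
  have h2 := hv (.y i)
  have h3 := hv (.z i)
  simp only [height, paramR, pow_one] at h1 h2 h3
  omega

/-- The degree bound in generation `m` leaves `2 ℓ_m` below `ℓ_{m+1}`, just enough room for the
weight of the earlier generations. -/
theorem expWeight_add_le_succ (hp : 1 < p) {m : ℕ} {a : Letter →₀ ℕ}
    (hv : ∀ t, a t < p ^ height S paramR t) (ha : ∀ t, m + 1 ≤ t.gen → a t = 0)
    (hd : genDegree m a ≤ p ^ S m + p - 3) (hq : 1 < p ^ S m) :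
    expWeight p S a + 2 + ∑ i ∈ Finset.range m, (p ^ S i - 1) * pivotLength p S i ≤
      pivotLength p S (m + 1) := by
  classical
  let b := expVec m (fun i => a (.x i)) (fun i => a (.y i)) (fun i => a (.z i))
  have hb : ∀ t, m ≤ t.gen → b t = 0 := fun t ht => by
    cases t with
    | x i => exact (expVec_x _ _ _ _ _).trans (if_neg (not_lt.2 ht))
    | y i => exact (expVec_y _ _ _ _ _).trans (if_neg (not_lt.2 ht))
    | z i => exact (expVec_z _ _ _ _ _).trans (if_neg (not_lt.2 ht))
  have hba : ∀ t, b t ≤ a t := fun t => by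
    cases t with
    | x i => refine (expVec_x _ _ _ _ _).trans_le ?_; split_ifs; exacts [le_rfl, Nat.zero_le _]
    | y i => refine (expVec_y _ _ _ _ _).trans_le ?_; split_ifs; exacts [le_rfl, Nat.zero_le _]
    | z i => refine (expVec_z _ _ _ _ _).trans_le ?_; split_ifs; exacts [le_rfl, Nat.zero_le _]
  have h1 := expWeight_add_le hp (fun t => (hba t).trans_lt (hv t)) hb
  have h2 : expWeight p S a = expWeight p S b + genDegree m a * pivotLength p S m := by
    rw [expWeight_eq_sum ha, Finset.sum_range_succ, expWeight_expVec, genDegree_eq ha]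
  have h3 : genDegree m a * pivotLength p S m + 2 * pivotLength p S m ≤ pivotLength p S (m + 1) := by
    rw [pivotLength_succ, ← add_mul, mul_comm]
    exact Nat.mul_le_mul_left _ (by omega)
  omega

end Exponents

/-! ### Counting: the upper bound for the growth -/

section UpperBound

variable (K : Type*) [Field K] {p : ℕ} {S : ℕ → ℕ} [Fact p.Prime] [CharP K p]

/-- The admissible exponent vectors of actual monomials. -/
def admissibleSet (p : ℕ) (S : ℕ → ℕ) (n m : ℕ) : Set (Letter →₀ ℕ) :=
  {a | (∀ t, a t < p ^ height S paramR t) ∧ Admissible p S n m a}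

theorem one_lt_pow_height (hp : 1 < p) (hS : ∀ n, 0 < S n) (i : ℕ) : 1 < p ^ S i :=
  Nat.one_lt_pow (hS i).ne' hp

theorem expWeight_lt_of_admissible (hp : 1 < p) (hS : ∀ n, 0 < S n) {n m : ℕ} {a : Letter →₀ ℕ}
    (ha : a ∈ admissibleSet p S n m) : expWeight p S a < pivotLength p S n := by
  cases n with
  | zero => rw [expWeight_eq_sum ha.2.gen_lt]; simp [pivotLength_zero]
  | succ n =>
    have := expWeight_add_le_succ hp ha.1 ha.2.gen_lt (ha.2.genDegree_le n rfl)
      (one_lt_pow_height hp hS n)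
    omega

/-- The length `ℓ_n - wt a` is at least the deficit of `expWeight_add_le_succ`, whose last summand
is at least `ℓ_{n-2}`. For `n ≥ N + 3` this exceeds `m`. -/
theorem admissible_level_le (hp : 1 < p) (hS : ∀ n, 0 < S n) {n m N : ℕ}
    (hN : m < pivotLength p S (N + 1)) {a : Letter →₀ ℕ} (ha : a ∈ admissibleSet p S n m) :
    n < N + 3 := by
  by_contra! h
  obtain ⟨j, rfl⟩ : ∃ j, n = N + 1 + j + 2 := ⟨n - (N + 3), by omega⟩
  have h1 := expWeight_add_le_succ (m := N + 1 + j + 1) hp ha.1 ha.2.gen_lt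
    (ha.2.genDegree_le _ rfl) (one_lt_pow_height hp hS _)
  have h2 : pivotLength p S (N + 1 + j + 1 + 1) ≤ m + expWeight p S a := ha.2.weight_le
  have h3 : pivotLength p S (N + 1 + j) ≤
      ∑ i ∈ Finset.range (N + 1 + j + 1), (p ^ S i - 1) * pivotLength p S i := by
    rw [Finset.sum_range_succ]
    refine (Nat.le_mul_of_pos_left _ ?_).trans (Nat.le_add_left _ _)
    have := one_lt_pow_height hp hS (N + 1 + j)
    omega
  have h4 : pivotLength p S (N + 1) ≤ pivotLength p S (N + 1 + j) := by
    refine Finset.prod_le_prod_of_subset_of_one_le' (Finset.range_mono (Nat.le_add_right _ _)) ?_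
    intro i _ _
    have := one_lt_pow_height hp hS i
    omega
  omega

/-- There are `p ^ (2n)` choices for the exponents of the `y_i` and `z_i`, and the weight takes at
most `m` values just below `ℓ_n`. These data leave a fixed value for the digit sum of the exponents
of the `x_i`, hence the exponents themselves. -/
theorem card_admissibleSet (hp : 1 < p) (hS : ∀ n, 0 < S n) (n m : ℕ) :
    Finite (admissibleSet p S n m) ∧ Nat.card (admissibleSet p S n m) ≤ p ^ (2 * n) * m := by
  let F : admissibleSet p S n m → (Fin n → Fin p × Fin p) × Fin m := fun a =>
    (fun i => (⟨a.1 (.y i), by simpa [height, paramR] using a.2.1 (.y i)⟩,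
      ⟨a.1 (.z i), by simpa [height, paramR] using a.2.1 (.z i)⟩),
      ⟨pivotLength p S n - expWeight p S a.1 - 1, by
        have h1 := a.2.2.weight_le
        have h2 := expWeight_lt_of_admissible hp hS a.2
        omega⟩)
  have hF : Function.Injective F := by
    rintro ⟨a, ha⟩ ⟨b, hb⟩ hab
    have h1 : ∀ i < n, a (.y i) = b (.y i) ∧ a (.z i) = b (.z i) := fun i hi => by
      have := congrFun (congrArg Prod.fst hab) ⟨i, hi⟩
      simpa [F, Prod.ext_iff, Fin.ext_iff] using this
    have h2 : expWeight p S a = expWeight p S b := by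
      have h := congrArg Prod.snd hab
      simp only [F, Fin.mk.injEq] at h
      have h3 := expWeight_lt_of_admissible hp hS ha
      have h4 := expWeight_lt_of_admissible hp hS hb
      omega
    have h3 : ∑ i ∈ Finset.range n, a (.x i) * pivotLength p S i =
        ∑ i ∈ Finset.range n, b (.x i) * pivotLength p S i := by
      rw [expWeight_eq_sum ha.2.gen_lt, expWeight_eq_sum hb.2.gen_lt] at h2
      simp only [add_assoc, add_mul, Finset.sum_add_distrib] at h2
      have e1 : ∑ i ∈ Finset.range n, a (.y i) * pivotLength p S i =
        ∑ i ∈ Finset.range n, b (.y i) * pivotLength p S i :=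
          Finset.sum_congr rfl fun i hi => by rw [(h1 i (Finset.mem_range.1 hi)).1]
      have e2 : ∑ i ∈ Finset.range n, a (.z i) * pivotLength p S i =
        ∑ i ∈ Finset.range n, b (.z i) * pivotLength p S i :=
          Finset.sum_congr rfl fun i hi => by rw [(h1 i (Finset.mem_range.1 hi)).2]
      omega
    have h4 := digits_unique (S := S) hp.le (fun i => ha.1 (.x i)) (fun i => hb.1 (.x i)) n h3
    refine Subtype.ext (Finsupp.ext fun t => ?_)
    rcases le_or_gt n t.gen with ht | ht
    · rw [ha.2.gen_lt t ht, hb.2.gen_lt t ht]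
    · cases t with
      | x i => exact h4 i ht
      | y i => exact (h1 i ht).1
      | z i => exact (h1 i ht).2
  refine ⟨Finite.of_injective F hF, (Nat.card_le_card_of_injective F hF).trans_eq ?_⟩
  rw [Nat.card_eq_fintype_card, Fintype.card_prod, Fintype.card_fun, Fintype.card_prod,
    Fintype.card_fin, Fintype.card_fin, Fintype.card_fin, pow_mul, sq]

/-- Half of the factor `6` comes from the monomials times the three kinds of pivot elements, half
from a crude count of the powers of bare pivot elements. -/
theorem growth_le (hS : ∀ n, 0 < S n) {m N : ℕ} (hN : m < pivotLength p S (N + 1)) :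
    growth K p (cloverGen K p S paramR) m ≤ 6 * ((N + 3) * (p ^ (2 * (N + 2)) * m)) := by
  have hpr : p.Prime := Fact.out
  have hp := hpr.one_lt
  have hfin : ∀ n, Finite (admissibleSet p S n m) := fun n => (card_admissibleSet hp hS n m).1
  have hft : ∀ n, Fintype (admissibleSet p S n m) := fun n => Fintype.ofFinite _
  let I := (Kind × Σ n : Fin (N + 3), admissibleSet p S n m) ⊕ (Kind × Fin (N + 1) × Fin m)
  let b : I → Module.End K (CloverRing K p S paramR) := Sum.elim
    (fun i => (mono K p (height S paramR) i.2.2.1 • der K p S paramR i.1 i.2.1 :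
      CloverDer K p S paramR).toLinearMap)
    (fun i => ((der K p S paramR i.1 i.2.1).toLinearMap : Module.End K _) ^ p ^ (i.2.2 : ℕ))
  have hsub : upperSpanning K p S m ⊆ Set.range b := by
    rintro x (⟨k, n, a, hv, ha, rfl⟩ | ⟨k, n, j, hj, rfl⟩)
    · exact ⟨Sum.inl (k, ⟨⟨n, admissible_level_le hp hS hN ⟨hv, ha⟩⟩, ⟨a, hv, ha⟩⟩), rfl⟩
    · have h1 : n < N + 1 := by
        by_contra! h
        have h4 : pivotLength p S (N + 1) ≤ pivotLength p S n := by
          refine Finset.prod_le_prod_of_subset_of_one_le' (Finset.range_mono h) ?_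
          intro i _ _
          have := one_lt_pow_height hp hS i
          omega
        have := Nat.le_mul_of_pos_right (pivotLength p S n) (pow_pos hpr.pos j)
        omega
      have h2 : j < m := by
        have := Nat.le_mul_of_pos_left (p ^ j) (pivotLength_pos (S := S) hp.le n)
        have := Nat.lt_pow_self (n := j) hp
        omega
      exact ⟨Sum.inr (k, ⟨n, h1⟩, ⟨j, h2⟩), rfl⟩
  have hle := (growthSpace_le_upperSpanning (K := K) hS m).trans (Submodule.span_mono hsub)
  have hfd : FiniteDimensional K (Submodule.span K (Set.range b)) :=
    FiniteDimensional.span_of_finite K (Set.finite_range b)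
  refine (Submodule.finrank_mono hle).trans ((finrank_range_le_card b).trans ?_)
  have hK : Fintype.card Kind = 3 := rfl
  have hc : ∑ n : Fin (N + 3), Fintype.card (admissibleSet p S n m) ≤
      (N + 3) * (p ^ (2 * (N + 2)) * m) := by
    refine (Finset.sum_le_card_nsmul _ _ (p ^ (2 * (N + 2)) * m) fun n _ => ?_).trans_eq (by simp)
    rw [← Nat.card_eq_fintype_card]
    refine (card_admissibleSet hp hS n m).2.trans (Nat.mul_le_mul_right _ ?_)
    exact Nat.pow_le_pow_right hpr.pos (by omega)
  rw [Fintype.card_sum, Fintype.card_prod, Fintype.card_prod, Fintype.card_prod, Fintype.card_fin,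
    Fintype.card_fin, Fintype.card_sigma, hK]
  have h5 : (N + 1) * m ≤ (N + 3) * (p ^ (2 * (N + 2)) * m) :=
    Nat.mul_le_mul (by omega) (Nat.le_mul_of_pos_left _ (pow_pos hpr.pos _))
  omega

end UpperBound

/-! ### Powers of pivot elements -/

section PivotPowers

variable {K : Type*} [Field K] {p : ℕ} {S R : ℕ → ℕ} [Fact p.Prime] [CharP K p]

theorem mono_add_single {b : Letter →₀ ℕ} {t : Letter} (hb : b t = 0) (j : ℕ) :
    mono K p (height S R) (b + Finsupp.single t j) =
      dpow K p (height S R) t j * mono K p (height S R) b := by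
  classical
  have h : coef (Finsupp.single t j) b = 1 := by
    rw [coef_eq_prod _ _ (le_refl _)]
    refine Finset.prod_eq_one fun s _ => ?_
    rcases eq_or_ne s t with rfl | hs
    · rw [hb, Finsupp.single_eq_same, add_zero, Nat.choose_self]
    · rw [Finsupp.single_eq_of_ne hs, Nat.choose_zero_right]
  rw [dpow, mono_mul_mono, h, Nat.cast_one, one_smul, add_comm]

theorem mono_eq_dpow_mul (a : Letter →₀ ℕ) (t : Letter) :
    mono K p (height S R) a =
      dpow K p (height S R) t (a t) * mono K p (height S R) (a.erase t) := by
  rw [← mono_add_single Finsupp.erase_same, Finsupp.erase_add_single]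

theorem partialD_dpow_succ {t : Letter} {i : ℕ} (hi : i + 1 < p ^ height S R t) :
    partialD t (dpow K p (height S R) t (i + 1)) = dpow K p (height S R) t i := by
  have hpr : p.Prime := Fact.out
  rw [dpow, partialD_mono, if_neg (by simp), dpow, ← Finsupp.single_tsub, Nat.add_sub_cancel]
  intro s
  rcases eq_or_ne s t with rfl | hs
  · simpa using hi
  · rw [Finsupp.single_eq_of_ne hs]
    exact pow_pos hpr.pos _

theorem dpow_zero (t : Letter) : dpow K p (height S R) t 0 = 1 := by
  rw [dpow, Finsupp.single_zero]; rfl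

theorem der_dpow_eq_zero (k : Kind) {n : ℕ} {t : Letter} (ht : t.gen < n) (i : ℕ) :
    der K p S R k n (dpow K p (height S R) t i) = 0 :=
  der_mono_eq_zero k n fun s hs => Finsupp.single_eq_of_ne (fun h => by rw [h] at hs; omega)

theorem dpow_mul_tailCoeff (k : Kind) (n : ℕ) {i : ℕ} (hi : i ≠ 0) :
    dpow K p (height S R) (k.letter n) i * tailCoeff K p S R k n = 0 := by
  rw [tailCoeff, ← mul_assoc, dpow_mul_top hi, zero_mul]

/-- A positive divided power of the variable of `d_n` annihilates the tail coefficient, so only the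
head `∂` acts. -/
theorem der_dpow_succ_mul (k : Kind) {n : ℕ} {i : ℕ} (hi : i + 1 < p ^ height S R (k.letter n))
    {g : CloverRing K p S R} (hg : partialD (k.letter n) g = 0) :
    der K p S R k n (dpow K p (height S R) (k.letter n) (i + 1) * g) =
      dpow K p (height S R) (k.letter n) i * g := by
  have h1 : der K p S R k (n + 1) (dpow K p (height S R) (k.letter n) (i + 1)) = 0 :=
    der_dpow_eq_zero k (by rw [k.gen_letter]; exact n.lt_succ_self) _
  rw [der_rec, Derivation.add_apply, Derivation.smul_apply, Derivation.leibniz, Derivation.leibniz,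
    h1, partialDer_apply, partialDer_apply, hg, partialD_dpow_succ hi]
  simp only [smul_eq_mul, mul_zero, zero_add, add_zero]
  rw [← mul_assoc, mul_comm (tailCoeff K p S R k n), dpow_mul_tailCoeff k n (Nat.succ_ne_zero i),
    zero_mul, add_zero, mul_comm]

theorem der_pow_dpow_mul (k : Kind) {n : ℕ} (i : ℕ) {j : ℕ}
    (hi : i + j < p ^ height S R (k.letter n))
    {g : CloverRing K p S R} (hg : partialD (k.letter n) g = 0) :
    (((der K p S R k n).toLinearMap : Module.End K (CloverRing K p S R)) ^ i)
        (dpow K p (height S R) (k.letter n) (i + j) * g) =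
      dpow K p (height S R) (k.letter n) j * g := by
  induction i with
  | zero => rw [pow_zero, zero_add]; rfl
  | succ i ih =>
    rw [pow_succ, Module.End.mul_apply, Derivation.coeFn_coe,
      show i + 1 + j = i + j + 1 by ring, der_dpow_succ_mul k (by omega) hg]
    exact ih (by omega)

/-- On `t^(a) g`, with `g` free of `t`, the first `a` factors remove `t`. The next acts through its
tail and creates `t^(q-1)`, where `q = p ^ height`, and the last `q - 1 - a` bring this down to
`t^(a)` again. -/
theorem der_pow_eq (k : Kind) (n : ℕ) :
    ((der K p S R k n).toLinearMap : Module.End K (CloverRing K p S R)) ^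
        p ^ height S R (k.letter n) =
      (top K p S R (k.other.letter n) • der K p S R k (n + 1) : CloverDer K p S R).toLinearMap := by
  have hpr : p.Prime := Fact.out
  set t := k.letter n with ht
  set q := p ^ height S R t with hq
  have hqpos : 0 < q := pow_pos hpr.pos _
  have hgen : t.gen < n + 1 := by rw [ht, k.gen_letter]; exact n.lt_succ_self
  refine hom_ext fun a ha => ?_
  set g := mono K p (height S R) (a.erase t) with hgdef
  have hg : partialD t g = 0 := partialD_mono_of_eq_zero _ _ Finsupp.erase_same
  have hat : a t < q := ha t
  set E := der K p S R k (n + 1) with hE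
  have hEg : partialD t (E g) = 0 := by
    have h1 := Derivation.congr_fun (partialDer_lie_der (K := K) (p := p) (S := S) (R := R) k hgen) g
    rw [Derivation.commutator_apply, Derivation.zero_apply, sub_eq_zero] at h1
    rw [← partialDer_apply, h1, partialDer_apply, hg, map_zero]
  have hot : partialD t (top K p S R (k.other.letter n)) = 0 :=
    partialD_mono_of_eq_zero _ _ (Finsupp.single_eq_of_ne (k.letter_other_ne n).symm)
  have hoE : partialD t (top K p S R (k.other.letter n) * E g) = 0 := by
    rw [← partialDer_apply, Derivation.leibniz, partialDer_apply, partialDer_apply, hot, hEg,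
      smul_zero, smul_zero, add_zero]
  have hstep : der K p S R k n g = dpow K p (height S R) t (q - 1) *
      (top K p S R (k.other.letter n) * E g) := by
    rw [der_rec, Derivation.add_apply, Derivation.smul_apply, partialDer_apply, hg, zero_add,
      smul_eq_mul, tailCoeff, mul_assoc]
    rfl
  rw [mono_eq_dpow_mul a t, ← hgdef]
  have hsplit : q = (q - 1 - a t) + (1 + a t) := by omega
  conv_lhs => rw [hsplit, pow_add, pow_add, pow_one]
  rw [Module.End.mul_apply, Module.End.mul_apply]
  have e1 := der_pow_dpow_mul k (a t) (j := 0) (by rw [add_zero]; exact hat) hg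
  rw [add_zero, dpow_zero, one_mul] at e1
  rw [e1, Derivation.coeFn_coe, hstep]
  have e2 := der_pow_dpow_mul k (q - 1 - a t) (j := a t) (by rw [← ht, ← hq]; omega) hoE
  rw [show q - 1 - a t + a t = q - 1 by omega] at e2
  rw [e2, Derivation.coeFn_coe, Derivation.smul_apply, Derivation.leibniz,
    der_dpow_eq_zero k hgen, smul_zero, add_zero, smul_eq_mul, smul_eq_mul]
  ring

/-- Bracketing with a pivot element lowers an exponent of its variable. -/
theorem der_lie_dpow_smul (o k : Kind) {n i : ℕ} (hi : i + 1 < p ^ height S R (o.letter n))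
    {b : Letter →₀ ℕ} (hb : b (o.letter n) = 0) :
    ⁅der K p S R o n, mono K p (height S R) (b + Finsupp.single (o.letter n) (i + 1)) •
        der K p S R k (n + 1)⁆ =
      mono K p (height S R) (b + Finsupp.single (o.letter n) i) • der K p S R k (n + 1) := by
  have h1 := smul_lie_smul_derivation (1 : CloverRing K p S R)
    (mono K p (height S R) (b + Finsupp.single (o.letter n) (i + 1)))
    (der K p S R o n) (der K p S R k (n + 1))
  rw [one_smul, Derivation.map_one_eq_zero, mul_zero, zero_smul, sub_zero, one_mul, one_mul,
    der_lie_der_of_le o k n.le_succ, Nat.succ_eq_add_one, Nat.Ico_succ_singleton,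
    Finset.prod_singleton, smul_smul] at h1
  rw [h1, mono_add_single hb, mono_add_single hb,
    der_dpow_succ_mul o hi (partialD_mono_of_eq_zero _ _ hb), mul_right_comm,
    dpow_mul_tailCoeff o n (Nat.succ_ne_zero i), zero_mul, zero_smul, add_zero]

end PivotPowers

/-! ### Elements of known length: the lower bound for the growth -/

section LowerElements

variable (K : Type*) [Field K] {p : ℕ} {S : ℕ → ℕ} [Fact p.Prime] [CharP K p]

/-- The span of the elements of length at most `s` of the clover restricted Lie algebra. -/
abbrev cloverSpace (p : ℕ) (S : ℕ → ℕ) (s : ℕ) : Submodule K (Module.End K (CloverRing K p S paramR)) :=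
  growthSpace K p (cloverGen K p S paramR) s

/-- The operator `t^{(a)} d_n` for a pivot element `d_n`. -/
def monoDer (p : ℕ) [Fact p.Prime] [CharP K p] (S : ℕ → ℕ) (a : Letter →₀ ℕ) (k : Kind) (n : ℕ) :
    Module.End K (CloverRing K p S paramR) :=
  (mono K p (height S paramR) a • der K p S paramR k n : CloverDer K p S paramR).toLinearMap

/-- Each unit of the exponent costs one bracket with a pivot element of length `ℓ_n`, in accordance
with the weights. -/
theorem lower_exponent (o k : Kind) {n s d : ℕ} {t : Letter} (ht : o.letter n = t)
    (hd : d < p ^ height S paramR t) {b : Letter →₀ ℕ} (hb : b t = 0)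
    (ho : (der K p S paramR o n).toLinearMap ∈ cloverSpace K p S (pivotLength p S n))
    (h : monoDer K p S (b + Finsupp.single t d) k (n + 1) ∈ cloverSpace K p S s) {j : ℕ} (hj : j ≤ d) :
    monoDer K p S (b + Finsupp.single t j) k (n + 1) ∈ cloverSpace K p S (s + (d - j) * pivotLength p S n) := by
  subst ht
  induction hj using Nat.decreasingInduction with
  | self => simpa using h
  | of_succ j hj ih =>
    have h1 := (growthSpace_isRestrictedFiltration p _).lie_mem ho ih
    rw [monoDer, ← Derivation.commutator_coe_linear_map, der_lie_dpow_smul o k (by omega) hb] at h1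
    obtain ⟨r, hr⟩ : ∃ r, d - j = r + 1 := ⟨d - j - 1, by omega⟩
    rw [show d - (j + 1) = r by omega] at h1
    rw [hr, add_one_mul, ← add_assoc, add_comm]
    exact h1

theorem pow_height_add (k : Kind) (n : ℕ) :
    p ^ height S paramR (k.letter n) + p ^ height S paramR (k.other.letter n) = p ^ S n + p := by
  cases k <;> simp [Kind.letter, Kind.other, height, paramR, add_comm]

variable (p S) in
-- A `p ^ h`-th power of `d_n` produces `d_{n+1}` with a top divided power of the other variable.
-- Removing that power costs `p ^ h' - 1` brackets, where `h` and `h'` are the two heights. The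
-- total `(p ^ h + p ^ h' - 1) ℓ_n` is `ℓ_{n+1}`.
theorem der_mem_and (n : ℕ) : (∀ k, (der K p S paramR k n).toLinearMap ∈
      cloverSpace K p S (pivotLength p S n)) ∧
    (∀ k j s, j < p ^ height S paramR (k.other.letter n) →
      s + j * pivotLength p S n = pivotLength p S (n + 1) →
      monoDer K p S (Finsupp.single (k.other.letter n) j) k (n + 1) ∈ cloverSpace K p S s) := by
  have hpr : p.Prime := Fact.out
  have hW := growthSpace_isRestrictedFiltration (K := K) p (cloverGen K p S paramR)
  have step : ∀ n, (∀ k, (der K p S paramR k n).toLinearMap ∈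
      cloverSpace K p S (pivotLength p S n)) →
    (∀ k j s, j < p ^ height S paramR (k.other.letter n) →
      s + j * pivotLength p S n = pivotLength p S (n + 1) →
      monoDer K p S (Finsupp.single (k.other.letter n) j) k (n + 1) ∈ cloverSpace K p S s) := by
    intro n h k j s hj hs
    have h1 := hW.pow_pow_mem p (h k) (height S paramR (k.letter n))
    rw [der_pow_eq, top, dpow, ← zero_add (Finsupp.single (k.other.letter n) _)] at h1
    have h2 := lower_exponent K k.other k (b := 0) rfl (by omega) rfl (h k.other) h1
      (Nat.le_pred_of_lt hj)
    rw [zero_add] at h2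
    convert h2 using 2
    have h3 := pow_height_add (p := p) (S := S) k n
    rw [pivotLength_succ] at hs
    have h4 : p ^ S n + p - 1 = j + (p ^ height S paramR (k.letter n) +
      (p ^ height S paramR (k.other.letter n) - 1 - j)) := by omega
    rw [h4, mul_add, mul_comm _ j] at hs
    have h5 : s = pivotLength p S n * (p ^ height S paramR (k.letter n) +
      (p ^ height S paramR (k.other.letter n) - 1 - j)) := by omega
    rw [h5]
    ring
  have main : ∀ n k, (der K p S paramR k n).toLinearMap ∈
      cloverSpace K p S (pivotLength p S n) := by
    intro n
    induction n with
    | zero =>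
      intro k
      refine subset_growthSpace_one p _ ?_
      cases k
      exacts [Or.inl rfl, Or.inr (Or.inl rfl), Or.inr (Or.inr rfl)]
    | succ n ih =>
      intro k
      have := step n ih k 0 (pivotLength p S (n + 1)) (pow_pos hpr.pos _) (by simp)
      rwa [Finsupp.single_zero, monoDer, show mono K p (height S paramR) 0 = 1 from rfl, one_smul] at this
  exact ⟨main n, step n (main n)⟩

/-- Exponent vectors in generations `≤ n` for which the product with `u_{n+1}` lies in the clover
Lie algebra. -/
structure LowerExponent (p : ℕ) (S : ℕ → ℕ) (n : ℕ) (a : Letter →₀ ℕ) : Prop where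
  gen_lt : ∀ t, n + 1 ≤ t.gen → a t = 0
  x_lt : ∀ i, a (.x i) + 2 ≤ p ^ S i
  y_lt : ∀ i, a (.y i) < p
  z_lt : ∀ i, a (.z i) < p
  y_eq : a (.y n) = 0

theorem LowerExponent.valid {n : ℕ} {a : Letter →₀ ℕ} (ha : LowerExponent p S n a) (t : Letter) :
    a t < p ^ height S paramR t := by
  cases t with
  | x i => have := ha.x_lt i; simp only [height]; omega
  | y i => simpa [height, paramR] using ha.y_lt i
  | z i => simpa [height, paramR] using ha.z_lt i

theorem LowerExponent.weight_le {n : ℕ} {a : Letter →₀ ℕ} (ha : LowerExponent p S n a) :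
    expWeight p S a ≤ pivotLength p S (n + 1) := by
  have hpr : p.Prime := Fact.out
  have h1 := ha.x_lt n
  have h2 := ha.z_lt n
  have h3 := expWeight_add_le_succ hpr.one_lt ha.valid ha.gen_lt
    (by rw [genDegree_eq ha.gen_lt, ha.y_eq]; omega) (by omega)
  omega

/-- The part of an exponent vector in generations `< n`. -/
def restrictGen (n : ℕ) (a : Letter →₀ ℕ) : Letter →₀ ℕ :=
  expVec n (fun i => a (.x i)) (fun i => a (.y i)) (fun i => a (.z i))

theorem restrictGen_eq_zero (n : ℕ) (a : Letter →₀ ℕ) {t : Letter} (ht : n ≤ t.gen) :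
    restrictGen n a t = 0 := by
  cases t with
  | x i => exact (expVec_x _ _ _ _ _).trans (if_neg (not_lt.2 ht))
  | y i => exact (expVec_y _ _ _ _ _).trans (if_neg (not_lt.2 ht))
  | z i => exact (expVec_z _ _ _ _ _).trans (if_neg (not_lt.2 ht))

theorem restrictGen_le (n : ℕ) (a : Letter →₀ ℕ) (t : Letter) : restrictGen n a t ≤ a t := by
  cases t with
  | x i => refine (expVec_x _ _ _ _ _).trans_le ?_; split_ifs; exacts [le_rfl, Nat.zero_le _]
  | y i => refine (expVec_y _ _ _ _ _).trans_le ?_; split_ifs; exacts [le_rfl, Nat.zero_le _]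
  | z i => refine (expVec_z _ _ _ _ _).trans_le ?_; split_ifs; exacts [le_rfl, Nat.zero_le _]

theorem eq_restrictGen_add {n : ℕ} {a : Letter →₀ ℕ} (ha : ∀ t, n + 1 ≤ t.gen → a t = 0) :
    a = restrictGen n a + (Finsupp.single (.x n) (a (.x n)) + Finsupp.single (.y n) (a (.y n)) +
      Finsupp.single (.z n) (a (.z n))) := by
  conv_lhs => rw [← expVec_eq_self ha, expVec, Finset.sum_range_succ]
  rfl

theorem eq_of_add_weight_eq {p q s s₀ e x z A : ℕ} (hx : x + 2 ≤ q) (hz : z < p)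
    (hs : s + (e + (x + z) * A) = s₀ + e + (q + p - 3) * A) :
    s = s₀ + (p - 1 - z) * A + (q - 2 - x) * A := by
  obtain ⟨q', rfl⟩ := Nat.exists_eq_add_of_le hx
  obtain ⟨p', rfl⟩ := Nat.exists_eq_add_of_lt hz
  rw [show x + 2 + q' + (z + p' + 1) - 3 = x + z + (q' + p') by omega,
    add_mul _ (q' + p'), add_mul q'] at hs
  rw [show z + p' + 1 - 1 - z = p' by omega, show x + 2 + q' - 2 - x = q' by omega]
  omega

/-- Monomials times `u_{n+1}` are obtained from the one with maximal exponents of `x_n`, `z_n`. -/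
theorem mem_of_top_mem {n : ℕ} {a : Letter →₀ ℕ} (ha : LowerExponent p S n a) {s₀ s : ℕ}
    (hs₀ : s₀ + expWeight p S (restrictGen n a) + (p ^ S n + p - 3) * pivotLength p S n =
      pivotLength p S (n + 1))
    (h : monoDer K p S (restrictGen n a + Finsupp.single (.x n) (p ^ S n - 2) +
      Finsupp.single (.z n) (p - 1)) .u (n + 1) ∈ cloverSpace K p S s₀)
    (hs : s + expWeight p S a = pivotLength p S (n + 1)) :
    monoDer K p S a .u (n + 1) ∈ cloverSpace K p S s := by
  have hpr : p.Prime := Fact.out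
  have hp2 := hpr.two_le
  have hx := ha.x_lt n
  have hz := ha.z_lt n
  have hD := (der_mem_and K p S n).1
  have hr : ∀ t : Letter, n ≤ t.gen → restrictGen n a t = 0 := fun t ht =>
    restrictGen_eq_zero n a ht
  have har := eq_restrictGen_add ha.gen_lt
  rw [ha.y_eq, Finsupp.single_zero, add_zero] at har
  generalize restrictGen n a = r at hs₀ h hr har
  have hdx : p ^ S n - 2 < p ^ height S paramR (Letter.x n) := by
    simp only [height]; omega
  have hdz : p - 1 < p ^ height S paramR (Letter.z n) := by
    simp only [height, paramR, pow_one]; omega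
  have hbx : (r + Finsupp.single (Letter.z n) (a (.z n))) (Letter.x n) = 0 := by
    rw [Finsupp.add_apply, hr (.x n) le_rfl, Finsupp.single_eq_of_ne (by simp), add_zero]
  have hbz : (r + Finsupp.single (Letter.x n) (p ^ S n - 2)) (Letter.z n) = 0 := by
    rw [Finsupp.add_apply, hr (.z n) le_rfl, Finsupp.single_eq_of_ne (by simp), add_zero]
  have hjx : a (.x n) ≤ p ^ S n - 2 := by omega
  have hjz : a (.z n) ≤ p - 1 := by omega
  -- The exponent of `z_n` is lowered by `u_n`, then that of `x_n` by `v_n`; the variable `y_n` does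
  -- not occur.
  have h1 := @lower_exponent K _ p S _ _ .u .u n s₀ _ (.z n) rfl hdz _ hbz (hD .u) h _ hjz
  rw [add_right_comm r] at h1
  have h2 := @lower_exponent K _ p S _ _ .v .u n _ _ (.x n) rfl hdx _ hbx (hD .v) h1 _ hjx
  rw [add_right_comm r, add_assoc r, ← har] at h2
  have h3 : expWeight p S a = expWeight p S r + (a (.x n) + a (.z n)) * pivotLength p S n := by
    conv_lhs => rw [har]
    rw [map_add, map_add, expWeight_single, expWeight_single, add_mul]
    rfl
  have h5 : s = s₀ + (p - 1 - a (.z n)) * pivotLength p S n +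
      (p ^ S n - 2 - a (.x n)) * pivotLength p S n := by
    rw [h3, ← hs₀] at hs
    exact eq_of_add_weight_eq hx hz hs
  rw [h5]
  exact h2

/-- The bracket `[v_m, u_m]`. -/
theorem der_v_lie_der_u (hS : ∀ n, 0 < S n) (m : ℕ) :
    ⁅der K p S paramR .v m, der K p S paramR .u m⁆ =
      mono K p (height S paramR) (Finsupp.single (.x m) (p ^ S m - 2) +
        Finsupp.single (.z m) (p - 1)) • der K p S paramR .u (m + 1) := by
  have hpr : p.Prime := Fact.out
  have hq := one_lt_pow_height hpr.one_lt hS m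
  have h1 : partialD (Letter.z m) (tailCoeff K p S paramR .v m) = 0 :=
    (isScalarMono_tailCoeff .v m).partialD_eq_zero (by
      rw [tailExp, Finsupp.add_apply, Finsupp.single_eq_of_ne (by simp [Kind.letter]),
        Finsupp.single_eq_of_ne (by simp [Kind.letter, Kind.other]), add_zero])
  have h2 : partialD (Letter.x m) (top K p S paramR (.z m)) = 0 :=
    partialD_mono_of_eq_zero _ _ (Finsupp.single_eq_of_ne (by simp))
  have h3 : partialD (Letter.x m) (top K p S paramR (.x m)) =
      dpow K p (height S paramR) (.x m) (p ^ S m - 2) := by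
    rw [top, show p ^ height S paramR (.x m) - 1 = p ^ S m - 2 + 1 by simp only [height]; omega]
    exact partialD_dpow_succ (by simp only [height]; omega)
  rw [der_lie_der_same hS]
  simp only [Kind.letter]
  rw [h1, zero_smul, sub_zero]
  congr 1
  rw [tailCoeff]
  simp only [Kind.letter, Kind.other]
  rw [← partialDer_apply, Derivation.leibniz, partialDer_apply, partialDer_apply, h2, h3,
    smul_zero, add_zero, smul_eq_mul, mono_add_single (Finsupp.single_eq_of_ne (by simp))]
  simp only [top, dpow, height, paramR, pow_one]

/-- Maximal exponents of `x_{n+1}` and `z_{n+1}` arise from `[v_{n+1}, u_{n+1}]`, smaller ones by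
lowering. The earlier generations come from the induction hypothesis, which forbids `y_n` in front
of `u_{n+1}`; its power is carried by `v_{n+1}` instead. -/
theorem lowerExponent_mem (hS : ∀ n, 0 < S n) (n : ℕ) : ∀ (a : Letter →₀ ℕ) (s : ℕ),
    LowerExponent p S n a → s + expWeight p S a = pivotLength p S (n + 1) →
    monoDer K p S a .u (n + 1) ∈ cloverSpace K p S s := by
  have hpr : p.Prime := Fact.out
  have hp2 := hpr.two_le
  have hW := growthSpace_isRestrictedFiltration (K := K) p (cloverGen K p S paramR)
  induction n with
  | zero =>
    intro a s ha hs
    have hq := one_lt_pow_height hpr.one_lt hS 0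
    have h0 : restrictGen 0 a = 0 := rfl
    refine mem_of_top_mem K ha (s₀ := 2) ?_ ?_ hs
    · rw [h0, map_zero, pivotLength_succ, pivotLength_zero]; omega
    · rw [h0, zero_add, monoDer, ← der_v_lie_der_u K hS, Derivation.commutator_coe_linear_map]
      have := hW.lie_mem ((der_mem_and K p S 0).1 .v) ((der_mem_and K p S 0).1 .u)
      rwa [pivotLength_zero] at this
  | succ n ih =>
    intro a s ha hs
    have hq := one_lt_pow_height hpr.one_lt hS (n + 1)
    set r := restrictGen (n + 1) a with hr
    have hrg : ∀ t : Letter, n + 1 ≤ t.gen → r t = 0 := fun t ht => restrictGen_eq_zero _ a ht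
    have hrle := restrictGen_le (n + 1) a
    set r' := r.erase (.y n) with hr'
    have hr'le : ∀ t, r' t ≤ r t := fun t => by
      rcases eq_or_ne t (.y n) with rfl | ht
      · rw [hr', Finsupp.erase_same]; exact Nat.zero_le _
      · rw [hr', Finsupp.erase_ne ht]
    have hlow : LowerExponent p S n r' :=
      ⟨fun t ht => Nat.le_zero.1 ((hr'le t).trans (hrg t ht).le),
        fun i => (Nat.add_le_add_right ((hr'le _).trans (hrle _)) 2).trans (ha.x_lt i),
        fun i => ((hr'le _).trans (hrle _)).trans_lt (ha.y_lt i),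
        fun i => ((hr'le _).trans (hrle _)).trans_lt (ha.z_lt i), Finsupp.erase_same⟩
    have hk : r (.y n) < p := (hrle _).trans_lt (ha.y_lt n)
    obtain ⟨s₁, hs₁⟩ : ∃ s₁, s₁ + r (.y n) * pivotLength p S n = pivotLength p S (n + 1) := by
      refine ⟨pivotLength p S (n + 1) - r (.y n) * pivotLength p S n, Nat.sub_add_cancel ?_⟩
      rw [pivotLength_succ, mul_comm]
      exact Nat.mul_le_mul_left _ (by omega)
    obtain ⟨s₂, hs₂⟩ : ∃ s₂, s₂ + expWeight p S r' = pivotLength p S (n + 1) :=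
      ⟨_, Nat.sub_add_cancel hlow.weight_le⟩
    have h1 := (der_mem_and K p S n).2 .v (r (.y n)) s₁
      (by simpa [Kind.letter, Kind.other, height, paramR] using hk) hs₁
    have h2 := ih r' s₂ hlow hs₂
    have h3 := hW.lie_mem h1 h2
    have hrr : r = r' + Finsupp.single (.y n) (r (.y n)) := (Finsupp.erase_add_single _ _).symm
    have hwr : expWeight p S r = expWeight p S r' + r (.y n) * pivotLength p S n := by
      conv_lhs => rw [hrr]
      rw [map_add, expWeight_single]
      rfl
    refine mem_of_top_mem K ha (s₀ := s₁ + s₂) ?_ ?_ hs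
    · rw [← hr, hwr, pivotLength_succ p S (n + 1)]
      obtain ⟨c, hc⟩ : ∃ c, p ^ S (n + 1) + p = c + 3 := ⟨p ^ S (n + 1) + p - 3, by omega⟩
      rw [hc, Nat.add_sub_cancel, show c + 3 - 1 = c + 2 by omega, mul_add, mul_comm c]
      omega
    · rw [← hr]
      rw [monoDer, monoDer, ← Derivation.commutator_coe_linear_map, smul_lie_smul_derivation,
        der_mono_eq_zero .v (n + 1) hlow.gen_lt, der_mono_eq_zero .u (n + 1) (fun t ht =>
          Finsupp.single_eq_of_ne (fun h => by rw [h] at ht; simp [Letter.gen, Kind.letter, Kind.other] at ht)),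
        mul_zero, mul_zero, zero_smul, zero_smul, sub_zero, zero_add, der_v_lie_der_u K hS,
        smul_smul] at h3
      have e1 : mono K p (height S paramR) (Finsupp.single (Kind.v.other.letter n) (r (.y n))) *
          mono K p (height S paramR) r' = mono K p (height S paramR) r := by
        conv_rhs => rw [hrr]
        exact (mono_add_single Finsupp.erase_same _).symm
      rw [e1] at h3
      have e2 : mono K p (height S paramR) r * mono K p (height S paramR)
          (Finsupp.single (.x (n + 1)) (p ^ S (n + 1) - 2) + Finsupp.single (.z (n + 1)) (p - 1)) =
          mono K p (height S paramR) (r + Finsupp.single (.x (n + 1)) (p ^ S (n + 1) - 2) +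
            Finsupp.single (.z (n + 1)) (p - 1)) := by
        rw [mono_add_single (t := Letter.z (n + 1)) (b := r + Finsupp.single (Letter.x (n + 1)) _),
          mono_add_single (hrg _ le_rfl), mono_add_single (Finsupp.single_eq_of_ne (by simp)), dpow,
          dpow]
        · ring
        · rw [Finsupp.add_apply, hrg _ le_rfl, Finsupp.single_eq_of_ne (by simp), add_zero]
      rw [e2] at h3
      exact h3

theorem der_u_dpow_one (n : ℕ) :
    der K p S paramR .u n (dpow K p (height S paramR) (.z n) 1) = 1 := by
  have hpr : p.Prime := Fact.out
  rw [der_rec, Derivation.add_apply, Derivation.smul_apply,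
    der_dpow_eq_zero .u n.lt_succ_self, smul_zero, add_zero, partialDer_apply]
  have := partialD_dpow_succ (K := K) (p := p) (S := S) (R := paramR) (t := .z n) (i := 0)
    (by simpa [height, paramR] using hpr.one_lt)
  rw [← dpow_zero (K := K) (p := p) (S := S) (R := paramR) (.z n), ← this]
  rfl

/-- Distinct monomials times `u_{n+1}` are linearly independent. -/
theorem card_le_growth (hS : ∀ n, 0 < S n) {ι : Type*} [Fintype ι] {n m : ℕ}
    {a : ι → Letter →₀ ℕ} (hinj : Function.Injective a) (ha : ∀ i, LowerExponent p S n (a i))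
    (hw : ∀ i, pivotLength p S (n + 1) ≤ m + expWeight p S (a i)) :
    Fintype.card ι ≤ growth K p (cloverGen K p S paramR) m := by
  have hW := growthSpace_isRestrictedFiltration (K := K) p (cloverGen K p S paramR)
  have hfin : (cloverGen K p S paramR).Finite := by
    rw [cloverGen]; exact ((Set.finite_singleton _).insert _).insert _
  haveI := growthSpace_finite (K := K) p hfin m
  let b : ι → growthSpace K p (cloverGen K p S paramR) m := fun i =>
    ⟨monoDer K p S (a i) .u (n + 1), by
      have h1 := (ha i).weight_le
      have h2 := hw i
      exact hW.mono (by omega) (lowerExponent_mem K hS n (a i) _ (ha i) (Nat.sub_add_cancel h1))⟩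
  -- The operator `t^(a) u_{n+1}` maps `z_{n+1}` to `t^(a)`, so evaluation there reduces
  -- independence to that of basis monomials.
  let ev : growthSpace K p (cloverGen K p S paramR) m →ₗ[K] CloverRing K p S paramR :=
    (LinearMap.applyₗ (dpow K p (height S paramR) (.z (n + 1)) 1)).comp (Submodule.subtype _)
  have hev : ∀ i, ev (b i) = basisElt K p (height S paramR) ⟨a i, (ha i).valid⟩ := fun i => by
    change mono K p (height S paramR) (a i) • der K p S paramR .u (n + 1) _ = _
    rw [der_u_dpow_one, smul_eq_mul, mul_one, mono, dif_pos (ha i).valid]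
  have hli : LinearIndependent K (ev ∘ b) := by
    have h0 : LinearIndependent K fun c : DPIndex p (height S paramR) => basisElt K p _ c :=
      Finsupp.linearIndependent_single_one K _
    have h1 := h0.comp (fun i => (⟨a i, (ha i).valid⟩ : DPIndex p (height S paramR)))
      fun i j hij => hinj (congrArg Subtype.val hij)
    convert h1 using 1
    exact funext hev
  exact (LinearIndependent.of_comp ev hli).fintype_card_le_finrank

/-- Exponents in generations `< n` are free, up to one lost value for each `x_i`. In generation `n`
they are `z_n = p - 1`, `y_n = 0` and `x_n = p ^ S n - 2 - d` with `d < D`, which leaves a length of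
at most `(d + 2) ℓ_n ≤ (D + 1) ℓ_n`. -/
theorem le_growth (hS : ∀ n, 0 < S n) {n m D : ℕ} (hD : D + 1 ≤ p ^ S n)
    (hm : (D + 1) * pivotLength p S n ≤ m) :
    (∏ i ∈ Finset.range n, (p ^ S i - 1) * p ^ 2) * D ≤ growth K p (cloverGen K p S paramR) m := by
  have hpr : p.Prime := Fact.out
  have hp2 := hpr.two_le
  let I := (∀ i : Fin n, Fin (p ^ S i - 1) × Fin p × Fin p) × Fin D
  let α : I → ℕ → ℕ := fun f i => if h : i < n then (f.1 ⟨i, h⟩).1 else p ^ S i - 2 - f.2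
  let β : I → ℕ → ℕ := fun f i => if h : i < n then (f.1 ⟨i, h⟩).2.1 else 0
  let γ : I → ℕ → ℕ := fun f i => if h : i < n then (f.1 ⟨i, h⟩).2.2 else p - 1
  let a : I → Letter →₀ ℕ := fun f => expVec (n + 1) (α f) (β f) (γ f)
  have hax : ∀ f i, i < n + 1 → a f (.x i) = α f i := fun f i hi =>
    (expVec_x _ _ _ _ _).trans (if_pos hi)
  have hay : ∀ f i, i < n + 1 → a f (.y i) = β f i := fun f i hi =>
    (expVec_y _ _ _ _ _).trans (if_pos hi)
  have haz : ∀ f i, i < n + 1 → a f (.z i) = γ f i := fun f i hi =>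
    (expVec_z _ _ _ _ _).trans (if_pos hi)
  have hα : ∀ f i, α f i + 2 ≤ p ^ S i := fun f i => by
    have := one_lt_pow_height hpr.one_lt hS i
    by_cases h : i < n
    · simp only [α, dif_pos h]
      have := (f.1 ⟨i, h⟩).1.2
      simp only at this
      omega
    · simp only [α, dif_neg h]; omega
  have hβ : ∀ f i, β f i < p := fun f i => by
    by_cases h : i < n
    · simp only [β, dif_pos h]; exact Fin.is_lt _
    · simp only [β, dif_neg h]; omega
  have hγ : ∀ f i, γ f i < p := fun f i => by
    by_cases h : i < n
    · simp only [γ, dif_pos h]; exact Fin.is_lt _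
    · simp only [γ, dif_neg h]; omega
  have hinj : Function.Injective a := by
    intro f g hfg
    have h1 : ∀ i, i < n + 1 → α f i = α g i := fun i hi => by
      rw [← hax f i hi, ← hax g i hi, hfg]
    have h2 : ∀ i, i < n + 1 → β f i = β g i := fun i hi => by
      rw [← hay f i hi, ← hay g i hi, hfg]
    have h3 : ∀ i, i < n + 1 → γ f i = γ g i := fun i hi => by
      rw [← haz f i hi, ← haz g i hi, hfg]
    refine Prod.ext (funext fun i => ?_) ?_
    · have e1 := h1 i (by omega)
      have e2 := h2 i (by omega)
      have e3 := h3 i (by omega)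
      simp only [α, β, γ, dif_pos i.2] at e1 e2 e3
      exact Prod.ext (Fin.ext e1) (Prod.ext (Fin.ext e2) (Fin.ext e3))
    · have e1 := h1 n n.lt_succ_self
      simp only [α, dif_neg (lt_irrefl n)] at e1
      have := f.2.2
      have := g.2.2
      exact Fin.ext (by omega)
  have hlow : ∀ f, LowerExponent p S n (a f) := fun f => by
    refine ⟨fun t ht => ?_, fun i => ?_, fun i => ?_, fun i => ?_, ?_⟩
    · cases t with
      | x i => exact (expVec_x _ _ _ _ _).trans (if_neg (not_lt.2 ht))
      | y i => exact (expVec_y _ _ _ _ _).trans (if_neg (not_lt.2 ht))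
      | z i => exact (expVec_z _ _ _ _ _).trans (if_neg (not_lt.2 ht))
    · have := hα f i
      have h2 : a f (.x i) ≤ α f i :=
        (expVec_x _ _ _ _ _).trans_le (by split_ifs; exacts [le_rfl, Nat.zero_le _])
      omega
    · have h2 : a f (.y i) ≤ β f i :=
        (expVec_y _ _ _ _ _).trans_le (by split_ifs; exacts [le_rfl, Nat.zero_le _])
      exact h2.trans_lt (hβ f i)
    · have h2 : a f (.z i) ≤ γ f i :=
        (expVec_z _ _ _ _ _).trans_le (by split_ifs; exacts [le_rfl, Nat.zero_le _])
      exact h2.trans_lt (hγ f i)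
    · rw [hay f n n.lt_succ_self]
      simp only [β, dif_neg (lt_irrefl n)]
  have hw : ∀ f, pivotLength p S (n + 1) ≤ m + expWeight p S (a f) := fun f => by
    have h1 : (p ^ S n - 2 - f.2 + (p - 1)) * pivotLength p S n ≤ expWeight p S (a f) := by
      rw [expWeight_expVec, Finset.sum_range_succ]
      refine le_trans (Nat.mul_le_mul_right _ ?_) (Nat.le_add_left _ _)
      simp only [α, γ, dif_neg (lt_irrefl n)]
      omega
    have h2 : pivotLength p S (n + 1) ≤
        (D + 1) * pivotLength p S n + (p ^ S n - 2 - f.2 + (p - 1)) * pivotLength p S n := by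
      rw [pivotLength_succ, ← add_mul, mul_comm]
      refine Nat.mul_le_mul_right _ ?_
      have := f.2.2
      omega
    omega
  refine le_of_eq_of_le ?_ (card_le_growth K hS hinj hlow hw)
  rw [Fintype.card_prod, Fintype.card_pi, Fintype.card_fin]
  congr 1
  rw [← Fin.prod_univ_eq_prod_range (fun i => (p ^ S i - 1) * p ^ 2) n]
  refine Finset.prod_congr rfl fun i _ => ?_
  rw [Fintype.card_prod, Fintype.card_prod, Fintype.card_fin, Fintype.card_fin, sq]

end LowerElements

/-! ### Asymptotics of the lengths and of the generation reached -/

section Asymptotics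

/-- Bernoulli's inequality at `-1 / (i + 1)`. With its companion `le_rpow_sub` it telescopes to
estimates of power sums. -/
theorem mul_rpow_le_sub {t : ℝ} (ht : 1 ≤ t) (i : ℕ) :
    ((i : ℝ) + 1) ^ t - (i : ℝ) ^ t ≤ t * ((i : ℝ) + 1) ^ (t - 1) := by
  have hi : (0 : ℝ) < (i : ℝ) + 1 := by positivity
  have h1 := one_add_mul_self_le_rpow_one_add (s := -1 / ((i : ℝ) + 1))
    (by rw [le_div_iff₀ hi]; linarith [(Nat.cast_nonneg i : (0 : ℝ) ≤ i)]) ht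
  have h2 : 1 + -1 / ((i : ℝ) + 1) = i / ((i : ℝ) + 1) := by field_simp; ring
  rw [h2, Real.div_rpow (Nat.cast_nonneg i) hi.le, le_div_iff₀ (Real.rpow_pos_of_pos hi t)] at h1
  rw [Real.rpow_sub_one hi.ne']
  have h3 : (1 + t * (-1 / ((i : ℝ) + 1))) * ((i : ℝ) + 1) ^ t =
    ((i : ℝ) + 1) ^ t - t * (((i : ℝ) + 1) ^ t / ((i : ℝ) + 1)) := by ring
  linarith

theorem le_rpow_sub {t : ℝ} (ht : 1 ≤ t) (i : ℕ) :
    t * ((i : ℝ) + 1) ^ (t - 1) ≤ ((i : ℝ) + 2) ^ t - ((i : ℝ) + 1) ^ t := by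
  have hi : (0 : ℝ) < (i : ℝ) + 1 := by positivity
  have h1 := one_add_mul_self_le_rpow_one_add (s := 1 / ((i : ℝ) + 1))
    (by linarith [(one_div_pos.2 hi)]) ht
  have h2 : 1 + 1 / ((i : ℝ) + 1) = (i + 2) / ((i : ℝ) + 1) := by field_simp; ring
  rw [h2, Real.div_rpow (by positivity) hi.le, le_div_iff₀ (Real.rpow_pos_of_pos hi t)] at h1
  rw [Real.rpow_sub_one hi.ne']
  have h3 : (1 + t * (1 / ((i : ℝ) + 1))) * ((i : ℝ) + 1) ^ t =
    ((i : ℝ) + 1) ^ t + t * (((i : ℝ) + 1) ^ t / ((i : ℝ) + 1)) := by ring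
  linarith

theorem rpow_le_sum {t : ℝ} (ht : 1 ≤ t) (n : ℕ) :
    (n : ℝ) ^ t ≤ t * ∑ i ∈ Finset.range n, ((i : ℝ) + 1) ^ (t - 1) := by
  induction n with
  | zero => simp [Real.zero_rpow (by linarith : t ≠ 0)]
  | succ n ih =>
    rw [Finset.sum_range_succ, mul_add]
    push_cast
    linarith [mul_rpow_le_sub ht n]

theorem sum_le_rpow {t : ℝ} (ht : 1 ≤ t) (n : ℕ) :
    t * ∑ i ∈ Finset.range n, ((i : ℝ) + 1) ^ (t - 1) ≤ ((n : ℝ) + 1) ^ t := by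
  induction n with
  | zero => simp
  | succ n ih =>
    rw [Finset.sum_range_succ, mul_add]
    push_cast
    have := le_rpow_sub ht n
    rw [show (n : ℝ) + 1 + 1 = n + 2 by ring]
    linarith

variable {p : ℕ} {κ : ℝ}

theorem one_le_one_div (hκ : κ ∈ Set.Ioo (0 : ℝ) 1) : 1 < 1 / κ :=
  (one_lt_div hκ.1).2 hκ.2

theorem paramS_pos (hκ : κ ∈ Set.Ioo (0 : ℝ) 1) (n : ℕ) : 0 < paramS κ n := by
  refine Nat.floor_pos.2 (Real.one_le_rpow (by linarith [(Nat.cast_nonneg n : (0 : ℝ) ≤ n)]) ?_)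
  linarith [one_le_one_div hκ]

theorem paramS_le (κ : ℝ) (n : ℕ) : (paramS κ n : ℝ) ≤ ((n : ℝ) + 1) ^ (1 / κ - 1) :=
  Nat.floor_le (by positivity)

theorem le_paramS (κ : ℝ) (n : ℕ) : ((n : ℝ) + 1) ^ (1 / κ - 1) ≤ paramS κ n + 1 :=
  (Nat.lt_floor_add_one _).le

theorem tendsto_paramS (hκ : κ ∈ Set.Ioo (0 : ℝ) 1) : Tendsto (paramS κ) atTop atTop := by
  refine tendsto_nat_floor_atTop.comp ?_
  refine (tendsto_rpow_atTop (by linarith [one_le_one_div hκ])).comp ?_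
  exact tendsto_atTop_add_const_right _ _ tendsto_natCast_atTop_atTop

theorem log_pivotLength (hp : 1 < p) (S : ℕ → ℕ) (n : ℕ) :
    Real.log (pivotLength p S n) =
      ∑ i ∈ Finset.range n, Real.log ((p : ℝ) ^ S i + p - 1) := by
  induction n with
  | zero => simp [pivotLength_zero]
  | succ n ih =>
    have h1 : ((p ^ S n + p - 1 : ℕ) : ℝ) = (p : ℝ) ^ S n + p - 1 := by
      rw [Nat.cast_sub (by omega)]; push_cast; ring
    have h2 : 0 < p ^ S n := pow_pos (by omega) _
    have h3 : 0 < pivotLength p S n := pivotLength_pos hp.le n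
    rw [Finset.sum_range_succ, ← ih, pivotLength_succ, Nat.cast_mul, h1, Real.log_mul]
    · exact_mod_cast h3.ne'
    · rw [← h1]; exact_mod_cast (by omega : p ^ S n + p - 1 ≠ 0)

theorem log_pivotLength_le (hp : 1 < p) (hκ : κ ∈ Set.Ioo (0 : ℝ) 1) (n : ℕ) :
    Real.log (pivotLength p (paramS κ) n) ≤
      Real.log p * (κ * ((n : ℝ) + 1) ^ (1 / κ) + n) := by
  have hlp : 0 < Real.log p := Real.log_pos (by exact_mod_cast hp)
  have hp' : (1 : ℝ) < p := by exact_mod_cast hp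
  have hκ0 := hκ.1
  rw [log_pivotLength hp]
  have h1 : ∀ i ∈ Finset.range n, Real.log ((p : ℝ) ^ paramS κ i + p - 1) ≤
      Real.log p * (((i : ℝ) + 1) ^ (1 / κ - 1) + 1) := fun i _ => by
    have h2 : (p : ℝ) ^ paramS κ i + p - 1 ≤ (p : ℝ) ^ (paramS κ i + 1) := by
      have h3 : (p : ℝ) ≤ p ^ paramS κ i := le_self_pow₀ hp'.le (paramS_pos hκ i).ne'
      rw [pow_succ]
      nlinarith
    have h4 : 0 < (p : ℝ) ^ paramS κ i + p - 1 := by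
      have : 0 < (p : ℝ) ^ paramS κ i := by positivity
      linarith
    refine (Real.log_le_log h4 h2).trans ?_
    rw [Real.log_pow, mul_comm]
    push_cast
    exact mul_le_mul_of_nonneg_left (by linarith [paramS_le κ i]) hlp.le
  refine (Finset.sum_le_sum h1).trans ?_
  rw [← Finset.mul_sum, Finset.sum_add_distrib, Finset.sum_const, Finset.card_range, nsmul_eq_mul,
    mul_one]
  refine mul_le_mul_of_nonneg_left ?_ hlp.le
  have := sum_le_rpow (one_le_one_div hκ).le n
  rw [one_div_mul_eq_div, div_le_iff₀ hκ0] at this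
  linarith

theorem le_log_pivotLength (hp : 1 < p) (hκ : κ ∈ Set.Ioo (0 : ℝ) 1) (n : ℕ) :
    Real.log p * (κ * (n : ℝ) ^ (1 / κ) - n) ≤ Real.log (pivotLength p (paramS κ) n) := by
  have hlp : 0 < Real.log p := Real.log_pos (by exact_mod_cast hp)
  have hp' : (1 : ℝ) < p := by exact_mod_cast hp
  have hκ0 := hκ.1
  rw [log_pivotLength hp]
  have h1 : ∀ i ∈ Finset.range n, Real.log p * (((i : ℝ) + 1) ^ (1 / κ - 1) - 1) ≤
      Real.log ((p : ℝ) ^ paramS κ i + p - 1) := fun i _ => by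
    refine le_trans ?_ (Real.log_le_log (by positivity)
      (by linarith : (p : ℝ) ^ paramS κ i ≤ (p : ℝ) ^ paramS κ i + p - 1))
    rw [Real.log_pow, mul_comm]
    exact mul_le_mul_of_nonneg_right (by linarith [le_paramS κ i]) hlp.le
  refine le_trans ?_ (Finset.sum_le_sum h1)
  rw [← Finset.mul_sum, Finset.sum_sub_distrib, Finset.sum_const, Finset.card_range, nsmul_eq_mul,
    mul_one]
  refine mul_le_mul_of_nonneg_left ?_ hlp.le
  have := rpow_le_sum (one_le_one_div hκ).le n
  rw [one_div_mul_eq_div, le_div_iff₀ hκ0] at this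
  linarith

theorem tendsto_rpow_div (t : ℝ) :
    Tendsto (fun n : ℕ => ((n : ℝ) + 1) ^ t / (n : ℝ) ^ t) atTop (𝓝 1) := by
  have h1 : Tendsto (fun n : ℕ => ((n : ℝ) + 1) / n) atTop (𝓝 1) := by
    have := tendsto_one_div_atTop_nhds_zero_nat (𝕜 := ℝ)
    have h2 := this.const_add 1
    rw [add_zero] at h2
    refine h2.congr' ?_
    filter_upwards [eventually_gt_atTop 0] with n hn
    have : (n : ℝ) ≠ 0 := by exact_mod_cast hn.ne'
    field_simp
  have h3 := h1.rpow_const (p := t) (Or.inl one_ne_zero)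
  rw [Real.one_rpow] at h3
  exact h3.congr fun n => Real.div_rpow (by positivity) (Nat.cast_nonneg n) t

/-- Each factor of `ℓ_n` lies between `p ^ S i` and `p ^ (S i + 1)`, so `ln ℓ_n` is `ln p` times a
power sum with exponent `1 / κ - 1`, up to an error linear in `n`. As `1 / κ > 1`, the error is
negligible. -/
theorem tendsto_log_pivotLength (hp : 1 < p) (hκ : κ ∈ Set.Ioo (0 : ℝ) 1) :
    Tendsto (fun n : ℕ => Real.log (pivotLength p (paramS κ) n) / (n : ℝ) ^ (1 / κ)) atTop
      (𝓝 (κ * Real.log p)) := by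
  have h0 : Tendsto (fun n : ℕ => (n : ℝ) / (n : ℝ) ^ (1 / κ)) atTop (𝓝 0) := by
    have h1 := (tendsto_rpow_neg_atTop (sub_pos.2 (one_le_one_div hκ))).comp
      (tendsto_natCast_atTop_atTop (R := ℝ))
    refine h1.congr' ?_
    filter_upwards [eventually_gt_atTop 0] with n hn
    have hn' : (0 : ℝ) < n := by exact_mod_cast hn
    rw [Function.comp_apply, neg_sub, Real.rpow_sub hn', Real.rpow_one]
  have hl : Tendsto (fun n : ℕ => Real.log p * (κ - (n : ℝ) / (n : ℝ) ^ (1 / κ))) atTop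
      (𝓝 (κ * Real.log p)) := by
    have := (h0.const_sub κ).const_mul (Real.log p)
    rwa [sub_zero, mul_comm] at this
  have hu : Tendsto (fun n : ℕ => Real.log p *
      (κ * (((n : ℝ) + 1) ^ (1 / κ) / (n : ℝ) ^ (1 / κ)) + (n : ℝ) / (n : ℝ) ^ (1 / κ))) atTop
      (𝓝 (κ * Real.log p)) := by
    have := (((tendsto_rpow_div (1 / κ)).const_mul κ).add h0).const_mul (Real.log p)
    rwa [add_zero, mul_one, mul_comm] at this
  refine tendsto_of_tendsto_of_tendsto_of_le_of_le' hl hu ?_ ?_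
  · filter_upwards [eventually_gt_atTop 0] with n hn
    have hn' : (0 : ℝ) < n := by exact_mod_cast hn
    have hpos := Real.rpow_pos_of_pos hn' (1 / κ)
    rw [le_div_iff₀ hpos]
    refine le_trans (le_of_eq ?_) (le_log_pivotLength hp hκ n)
    field_simp
  · filter_upwards [eventually_gt_atTop 0] with n hn
    have hn' : (0 : ℝ) < n := by exact_mod_cast hn
    have hpos := Real.rpow_pos_of_pos hn' (1 / κ)
    rw [div_le_iff₀ hpos]
    refine (log_pivotLength_le hp hκ n).trans (le_of_eq ?_)
    field_simp

/-- The generation reached at length `m`: the largest `n` with `pivotLength p S n ≤ m`. -/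
def reach (p : ℕ) (S : ℕ → ℕ) (m : ℕ) : ℕ := Nat.findGreatest (fun n => pivotLength p S n ≤ m) m

theorem lt_pivotLength (hp : 1 < p) (S : ℕ → ℕ) (n : ℕ) : n < pivotLength p S n := by
  induction n with
  | zero => rw [pivotLength_zero]; exact one_pos
  | succ n ih =>
    have h2 : 0 < p ^ S n := pow_pos (by omega) _
    rw [pivotLength_succ]
    have : pivotLength p S n * 2 ≤ pivotLength p S n * (p ^ S n + p - 1) :=
      Nat.mul_le_mul_left _ (by omega)
    omega

theorem pivotLength_reach_le (S : ℕ → ℕ) {m : ℕ} (hm : 0 < m) :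
    pivotLength p S (reach p S m) ≤ m :=
  Nat.findGreatest_spec (P := fun n => pivotLength p S n ≤ m) (Nat.zero_le m)
    (by rw [pivotLength_zero]; exact hm)

theorem lt_pivotLength_reach (hp : 1 < p) (S : ℕ → ℕ) (m : ℕ) :
    m < pivotLength p S (reach p S m + 1) := by
  by_contra h
  rw [not_lt] at h
  have h1 := lt_pivotLength hp S (reach p S m + 1)
  exact Nat.findGreatest_is_greatest (P := fun n => pivotLength p S n ≤ m) (Nat.lt_succ_self _)
    (h1.le.trans h) h

theorem tendsto_reach (hp : 1 < p) (S : ℕ → ℕ) : Tendsto (reach p S) atTop atTop := by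
  refine tendsto_atTop.2 fun b => ?_
  filter_upwards [eventually_ge_atTop (pivotLength p S b)] with m hm
  exact Nat.le_findGreatest (((lt_pivotLength hp S b).trans_le hm).le) hm

/-- Squeeze `ln m` between `ln ℓ_N` and `ln ℓ_{N+1}`, which have the same asymptotics, and take
`κ`-th powers. -/
theorem tendsto_log_div_reach (hp : 1 < p) (hκ : κ ∈ Set.Ioo (0 : ℝ) 1) :
    Tendsto (fun m : ℕ => Real.log m ^ κ / reach p (paramS κ) m) atTop
      (𝓝 ((κ * Real.log p) ^ κ)) := by
  have hlp : 0 < Real.log p := Real.log_pos (by exact_mod_cast hp)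
  have hκ0 := hκ.1
  set N := reach p (paramS κ) with hN
  have hNt := tendsto_reach hp (paramS κ)
  have h1 := (tendsto_log_pivotLength hp hκ).comp hNt
  have h2 : Tendsto (fun n : ℕ => Real.log (pivotLength p (paramS κ) (n + 1)) / (n : ℝ) ^ (1 / κ))
      atTop (𝓝 (κ * Real.log p)) := by
    have h3 := ((tendsto_log_pivotLength hp hκ).comp (tendsto_add_atTop_nat 1)).mul
      (tendsto_rpow_div (1 / κ))
    rw [mul_one] at h3
    refine h3.congr fun n => ?_
    have : ((n : ℝ) + 1) ^ (1 / κ) ≠ 0 := by positivity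
    simp only [Function.comp_apply]
    push_cast
    field_simp
  have h4 : Tendsto (fun m : ℕ => Real.log m / (N m : ℝ) ^ (1 / κ)) atTop
      (𝓝 (κ * Real.log p)) := by
    refine tendsto_of_tendsto_of_tendsto_of_le_of_le' h1 (h2.comp hNt) ?_ ?_
    · filter_upwards [eventually_gt_atTop 0] with m hm
      refine div_le_div_of_nonneg_right (Real.log_le_log ?_ ?_) (by positivity)
      · exact_mod_cast (Nat.zero_le _).trans_lt (lt_pivotLength hp (paramS κ) _)
      · exact_mod_cast pivotLength_reach_le (paramS κ) hm
    · filter_upwards [eventually_gt_atTop 0] with m hm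
      refine div_le_div_of_nonneg_right (Real.log_le_log (by exact_mod_cast hm) ?_) (by positivity)
      exact_mod_cast (lt_pivotLength_reach hp (paramS κ) m).le
  have h5 := h4.rpow_const (p := κ) (Or.inr hκ0.le)
  refine h5.congr' ?_
  filter_upwards [eventually_gt_atTop 0] with m hm
  have hlog : 0 ≤ Real.log m := Real.log_natCast_nonneg m
  rw [Real.div_rpow hlog (by positivity), ← Real.rpow_mul (Nat.cast_nonneg _), one_div,
    inv_mul_cancel₀ hκ0.ne', Real.rpow_one]

/-- The choice of parameters in the lower bound for the growth. -/
theorem exists_lower_parameters (hp : 1 < p) {S : ℕ → ℕ} (hS : ∀ n, 0 < S n) {m : ℕ}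
    (hm : 0 < m) (hN : 0 < reach p S m) :
    ∃ n D, n ≤ reach p S m ∧ reach p S m ≤ n + 1 ∧ 0 < D ∧ D + 1 ≤ p ^ S n ∧
      (D + 1) * pivotLength p S n ≤ m ∧ m ≤ 2 * (p + 1) * D * pivotLength p S n := by
  have h1 := pivotLength_reach_le (p := p) S hm
  have h2 := lt_pivotLength_reach hp S m
  set N := reach p S m
  have hq : ∀ n, 1 < p ^ S n := fun n => Nat.one_lt_pow (hS n).ne' hp
  -- With `m ≥ 2 ℓ_N`, the level `N` admits `D + 1 = min (m / ℓ_N) (p ^ S N) ≥ 2`, as `0 < D`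
  -- demands.
  rcases le_or_gt (2 * pivotLength p S N) m with h | h
  · have hA : 0 < pivotLength p S N := (Nat.zero_le _).trans_lt (lt_pivotLength hp S N)
    have hqN := hq N
    rw [pivotLength_succ] at h2
    set A := pivotLength p S N with hAdef
    have hd : 2 ≤ m / A := (Nat.le_div_iff_mul_le hA).2 h
    obtain ⟨D, hD⟩ : ∃ D, min (m / A) (p ^ S N) = D + 1 := ⟨min (m / A) (p ^ S N) - 1, by omega⟩
    have hle : D + 1 ≤ m / A := hD ▸ min_le_left _ _
    refine ⟨N, D, le_rfl, by omega, by omega, by omega, (Nat.le_div_iff_mul_le hA).1 hle, ?_⟩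
    have hD0 : 0 < D := by omega
    have h3 : m ≤ (D + p) * A ∨ m ≤ (D + 2) * A := by
      rcases min_choice (m / A) (p ^ S N) with h4 | h4
      · right
        have := Nat.lt_mul_of_div_lt (Nat.lt_succ_self (m / A)) hA
        rw [← h4, hD, mul_comm, Nat.succ_eq_add_one, mul_comm] at this
        exact this.le
      · left
        rw [← h4, hD, mul_comm] at h2
        rw [show D + p = D + 1 + p - 1 by omega]
        exact h2.le
    have h4 : D + p ≤ 2 * (p + 1) * D := by nlinarith
    have h5 : D + 2 ≤ 2 * (p + 1) * D := by nlinarith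
    rcases h3 with h3 | h3
    · exact h3.trans (Nat.mul_le_mul_right _ h4)
    · exact h3.trans (Nat.mul_le_mul_right _ h5)
  -- For `ℓ_N ≤ m < 2 ℓ_N` the level `N` would give `D = 0`; the full range of level `N - 1` serves
  -- instead, at the cost of the factor `2`.
  · obtain ⟨n, hn⟩ : ∃ n, N = n + 1 := ⟨N - 1, by omega⟩
    have hqn := hq n
    rw [hn] at h h1
    obtain ⟨D, hD⟩ : ∃ D, p ^ S n = D + 1 := ⟨p ^ S n - 1, by omega⟩
    refine ⟨n, D, by omega, by omega, by omega, hD.ge, ?_, ?_⟩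
    · refine le_trans ?_ h1
      rw [pivotLength_succ, mul_comm]
      exact Nat.mul_le_mul_left _ (by omega)
    · refine h.le.trans ?_
      rw [pivotLength_succ, hD, mul_comm (pivotLength p S n), ← mul_assoc]
      refine Nat.mul_le_mul_right _ ?_
      rw [mul_assoc]
      refine Nat.mul_le_mul_left _ ?_
      have : 0 < D := by omega
      rw [show D + 1 + p - 1 = D + p by omega]
      nlinarith

/-- The lower bound has factors `p ^ S i - 1` where `ℓ_n` has `p ^ S i + p - 1`. Since `S i → ∞`,
the logarithms of the quotients tend to `0`, and so do their averages. -/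
theorem tendsto_cesaro_defect (hp : 1 < p) (hκ : κ ∈ Set.Ioo (0 : ℝ) 1) :
    Tendsto (fun n : ℕ => (∑ i ∈ Finset.range n, (Real.log ((p : ℝ) ^ paramS κ i + p - 1) -
      Real.log ((p : ℝ) ^ paramS κ i - 1))) / n) atTop (𝓝 0) := by
  have hp' : (1 : ℝ) < p := by exact_mod_cast hp
  have h1 : Tendsto (fun n => (p : ℝ) ^ paramS κ n) atTop atTop :=
    (tendsto_pow_atTop_atTop_of_one_lt hp').comp (tendsto_paramS hκ)
  have h2 : Tendsto (fun n => ((p : ℝ) ^ paramS κ n - 1)) atTop atTop :=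
    tendsto_atTop_add_const_right _ _ h1
  have h3 : Tendsto (fun n => Real.log (1 + p * ((p : ℝ) ^ paramS κ n - 1)⁻¹)) atTop (𝓝 0) := by
    have h4 := ((tendsto_inv_atTop_zero.comp h2).const_mul (p : ℝ)).const_add 1
    rw [mul_zero, add_zero] at h4
    have h5 := h4.log one_ne_zero
    rwa [Real.log_one] at h5
  have h6 := h3.cesaro
  refine h6.congr fun n => ?_
  rw [div_eq_inv_mul]
  congr 1
  refine Finset.sum_congr rfl fun i _ => ?_
  have h7 : 1 < (p : ℝ) ^ paramS κ i := one_lt_pow₀ hp' (paramS_pos hκ i).ne'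
  rw [← Real.log_div (by linarith) (by linarith)]
  congr 1
  have : (p : ℝ) ^ paramS κ i - 1 ≠ 0 := by linarith
  field_simp
  ring

end Asymptotics

/-! ### The asymptotic formula for the growth -/

section CloverGrowth

variable {p : ℕ} {κ : ℝ}

theorem log_div_le_of_upper (hp : 1 < p) {S γ : ℕ → ℕ}
    (hU : ∀ m N, m < pivotLength p S (N + 1) → γ m ≤ 6 * ((N + 3) * (p ^ (2 * (N + 2)) * m)))
    {m : ℕ} (hm : 0 < m) (hγ : 0 < γ m) :
    Real.log (γ m / m) ≤ Real.log 6 + Real.log (reach p S m + 3) +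
      2 * (reach p S m + 2) * Real.log p := by
  have h1 := hU m _ (lt_pivotLength_reach hp S m)
  set N := reach p S m
  have hm' : (0 : ℝ) < m := by exact_mod_cast hm
  have hp' : (0 : ℝ) < p := by exact_mod_cast (by omega : 0 < p)
  have h2 : (γ m / m : ℝ) ≤ 6 * (N + 3) * (p : ℝ) ^ (2 * (N + 2)) := by
    rw [div_le_iff₀ hm']
    have : (γ m : ℝ) ≤ 6 * ((N + 3) * ((p : ℝ) ^ (2 * (N + 2)) * m)) := by exact_mod_cast h1
    linarith
  refine (Real.log_le_log (div_pos (by exact_mod_cast hγ) hm') h2).trans (le_of_eq ?_)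
  rw [Real.log_mul (by positivity) (by positivity), Real.log_mul (by positivity) (by positivity),
    Real.log_pow]
  push_cast
  ring

/-- The parameter `D` occurs both in the number of elements and in the bound for `m`, and cancels in
the quotient `γ m / m`. -/
theorem le_log_div_of_lower (hp : 1 < p) {S γ : ℕ → ℕ} (hS : ∀ n, 0 < S n)
    (hL : ∀ n m D, D + 1 ≤ p ^ S n → (D + 1) * pivotLength p S n ≤ m →
      (∏ i ∈ Finset.range n, (p ^ S i - 1) * p ^ 2) * D ≤ γ m)
    {m : ℕ} (hm : 0 < m) (hN : 0 < reach p S m) :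
    0 < γ m ∧ 2 * ((reach p S m : ℝ) - 1) * Real.log p - (∑ i ∈ Finset.range (reach p S m),
      (Real.log ((p : ℝ) ^ S i + p - 1) - Real.log ((p : ℝ) ^ S i - 1))) -
      Real.log (2 * (p + 1)) ≤ Real.log (γ m / m) := by
  obtain ⟨n, D, hn, hn', hD, hDq, hDm, hmD⟩ := exists_lower_parameters hp hS hm hN
  set N := reach p S m
  have h1 := hL n m D hDq hDm
  have hp' : (1 : ℝ) < p := by exact_mod_cast hp
  have hq : ∀ i, 1 < p ^ S i := fun i => Nat.one_lt_pow (hS i).ne' hp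
  have hq' : ∀ i, 1 < (p : ℝ) ^ S i := fun i => by exact_mod_cast hq i
  have hA : 0 < pivotLength p S n := pivotLength_pos hp.le n
  set P := ∏ i ∈ Finset.range n, (p ^ S i - 1) * p ^ 2 with hP
  have hPpos : 0 < P := Finset.prod_pos fun i _ =>
    Nat.mul_pos (Nat.sub_pos_of_lt (hq i)) (pow_pos (by omega) _)
  have hγ : 0 < γ m := (Nat.mul_pos hPpos hD).trans_le h1
  refine ⟨hγ, ?_⟩
  have hm' : (m : ℝ) ≠ 0 := by exact_mod_cast hm.ne'
  have hγ' : (γ m : ℝ) ≠ 0 := by exact_mod_cast hγ.ne'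
  have hA' : (pivotLength p S n : ℝ) ≠ 0 := by exact_mod_cast hA.ne'
  have hP' : (P : ℝ) ≠ 0 := by exact_mod_cast hPpos.ne'
  have h2 : P * m ≤ 2 * (p + 1) * pivotLength p S n * γ m := by
    calc P * m ≤ P * (2 * (p + 1) * D * pivotLength p S n) := Nat.mul_le_mul_left _ hmD
      _ = 2 * (p + 1) * pivotLength p S n * (P * D) := by ring
      _ ≤ _ := Nat.mul_le_mul_left _ h1
  have h3 : (P : ℝ) * m ≤ 2 * (p + 1) * pivotLength p S n * γ m := by exact_mod_cast h2
  have h4 := Real.log_le_log (by positivity) h3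
  rw [Real.log_mul hP' hm', Real.log_mul (by positivity) hγ', Real.log_mul (by positivity) hA',
    log_pivotLength hp] at h4
  have h5 : Real.log P = ∑ i ∈ Finset.range n, Real.log ((p : ℝ) ^ S i - 1) +
      2 * n * Real.log p := by
    rw [hP, Nat.cast_prod, Real.log_prod]
    · have : ∀ i ∈ Finset.range n, Real.log (((p ^ S i - 1) * p ^ 2 : ℕ) : ℝ) =
          Real.log ((p : ℝ) ^ S i - 1) + 2 * Real.log p := fun i _ => by
        rw [Nat.cast_mul, Nat.cast_sub (hq i).le, Nat.cast_pow, Nat.cast_pow, Nat.cast_one,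
          Real.log_mul (by linarith [hq' i]) (by positivity), Real.log_pow]
        push_cast
        ring
      rw [Finset.sum_congr rfl this, Finset.sum_add_distrib, Finset.sum_const, Finset.card_range,
        nsmul_eq_mul]
      ring
    · intro i _
      exact_mod_cast (Nat.mul_pos (Nat.sub_pos_of_lt (hq i)) (pow_pos (by omega) _)).ne'
  have h6 : ∑ i ∈ Finset.range n,
      (Real.log ((p : ℝ) ^ S i + p - 1) - Real.log ((p : ℝ) ^ S i - 1)) ≤
      ∑ i ∈ Finset.range N,
      (Real.log ((p : ℝ) ^ S i + p - 1) - Real.log ((p : ℝ) ^ S i - 1)) := by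
    refine Finset.sum_le_sum_of_subset_of_nonneg (Finset.range_mono hn) fun i _ _ => ?_
    exact sub_nonneg.2 (Real.log_le_log (by linarith [hq' i]) (by linarith))
  have h7 : ((N : ℝ) - 1) * Real.log p ≤ n * Real.log p := by
    refine mul_le_mul_of_nonneg_right ?_ (Real.log_nonneg hp'.le)
    have : (N : ℝ) ≤ n + 1 := by exact_mod_cast hn'
    linarith
  rw [Real.log_div hγ' hm']
  rw [Finset.sum_sub_distrib] at h6
  linarith

/-- Divided by `N`, both bounds for `ln (γ m / m)` tend to `2 ln p`. Dividing by the limit `(κ ln p)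
^ κ` of `(ln m) ^ κ / N` gives the constant. -/
theorem tendsto_log_div (hp : 1 < p) (hκ : κ ∈ Set.Ioo (0 : ℝ) 1) {γ : ℕ → ℕ}
    (hU : ∀ m N, m < pivotLength p (paramS κ) (N + 1) →
      γ m ≤ 6 * ((N + 3) * (p ^ (2 * (N + 2)) * m)))
    (hL : ∀ n m D, D + 1 ≤ p ^ paramS κ n → (D + 1) * pivotLength p (paramS κ) n ≤ m →
      (∏ i ∈ Finset.range n, (p ^ paramS κ i - 1) * p ^ 2) * D ≤ γ m) :
    (∀ᶠ m in atTop, 0 < γ m) ∧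
    Tendsto (fun m : ℕ => Real.log (γ m / m) / Real.log m ^ κ) atTop
      (𝓝 (2 * Real.log p ^ (1 - κ) / κ ^ κ)) := by
  have hlp : 0 < Real.log p := Real.log_pos (by exact_mod_cast hp)
  have hκ0 := hκ.1
  have hS := paramS_pos hκ
  have hNt := tendsto_reach hp (paramS κ)
  set N := reach p (paramS κ) with hNdef
  have hev : ∀ᶠ m in atTop, 0 < m ∧ 0 < N m :=
    (eventually_gt_atTop 0).and (hNt.eventually_gt_atTop 0)
  have hlow : ∀ m, 0 < m ∧ 0 < N m → _ := fun m hm => le_log_div_of_lower hp hS hL hm.1 hm.2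
  refine ⟨hev.mono fun m hm => (hlow m hm).1, ?_⟩
  have hinv : Tendsto (fun n : ℕ => (n : ℝ)⁻¹) atTop (𝓝 0) := tendsto_inv_atTop_nhds_zero_nat
  have hlog : Tendsto (fun n : ℕ => Real.log ((n : ℝ) + 3) / n) atTop (𝓝 0) := by
    have h1 : Tendsto (fun x : ℝ => Real.log x / x) atTop (𝓝 0) :=
      Real.isLittleO_log_id_atTop.tendsto_div_nhds_zero
    have h2 : Tendsto (fun n : ℕ => (n : ℝ) + 3) atTop atTop :=
      tendsto_atTop_add_const_right _ _ tendsto_natCast_atTop_atTop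
    have h3 := (h1.comp h2).mul ((hinv.const_mul 3).const_add 1)
    rw [zero_mul] at h3
    refine h3.congr' ?_
    filter_upwards [eventually_gt_atTop 0] with n hn
    have : (n : ℝ) ≠ 0 := by exact_mod_cast hn.ne'
    simp only [Function.comp_apply]
    field_simp
  have hup : Tendsto (fun n : ℕ => Real.log 6 * (n : ℝ)⁻¹ + Real.log ((n : ℝ) + 3) / n +
      2 * (1 + 2 * (n : ℝ)⁻¹) * Real.log p) atTop (𝓝 (2 * Real.log p)) := by
    have h1 := ((hinv.const_mul (Real.log 6)).add hlog).add
      ((((hinv.const_mul 2).const_add 1).const_mul 2).mul_const (Real.log p))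
    simpa using h1
  have hlo : Tendsto (fun n : ℕ => 2 * (1 - (n : ℝ)⁻¹) * Real.log p -
      (∑ i ∈ Finset.range n, (Real.log ((p : ℝ) ^ paramS κ i + p - 1) -
      Real.log ((p : ℝ) ^ paramS κ i - 1))) / n - Real.log (2 * (p + 1)) * (n : ℝ)⁻¹) atTop
      (𝓝 (2 * Real.log p)) := by
    have h1 := ((((hinv.const_sub 1).const_mul 2).mul_const (Real.log p)).sub
      (tendsto_cesaro_defect hp hκ)).sub (hinv.const_mul (Real.log (2 * (p + 1))))
    simpa using h1
  have hmain : Tendsto (fun m => Real.log (γ m / m) / N m) atTop (𝓝 (2 * Real.log p)) := by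
    refine tendsto_of_tendsto_of_tendsto_of_le_of_le' (hlo.comp hNt) (hup.comp hNt) ?_ ?_
    · filter_upwards [hev] with m hm
      have hN : (0 : ℝ) < N m := by exact_mod_cast hm.2
      rw [le_div_iff₀ hN]
      refine le_trans (le_of_eq ?_) (hlow m hm).2
      simp only [Function.comp_apply, ← hNdef]
      field_simp
    · filter_upwards [hev] with m hm
      have hN : (0 : ℝ) < N m := by exact_mod_cast hm.2
      rw [div_le_iff₀ hN]
      refine (log_div_le_of_upper hp hU hm.1 (hlow m hm).1).trans (le_of_eq ?_)
      simp only [Function.comp_apply, ← hNdef]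
      field_simp
  have hden := tendsto_log_div_reach hp hκ
  have hC : 2 * Real.log p / (κ * Real.log p) ^ κ = 2 * Real.log p ^ (1 - κ) / κ ^ κ := by
    rw [Real.mul_rpow hκ0.le hlp.le, Real.rpow_sub hlp, Real.rpow_one]
    field_simp
  have h := hmain.div hden (by positivity)
  rw [hC] at h
  refine h.congr' ?_
  filter_upwards [hev] with m hm
  have hN : (N m : ℝ) ≠ 0 := by exact_mod_cast hm.2.ne'
  simp only [Pi.div_apply]
  rw [div_div_div_cancel_right₀ hN]

theorem growth_cloverGen_asymptotics (p : ℕ) [Fact p.Prime] (K : Type*) [Field K] [CharP K p]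
    (hκ : κ ∈ Set.Ioo (0 : ℝ) 1) :
    (∀ᶠ m in atTop, 0 < growth K p (cloverGen K p (paramS κ) paramR) m) ∧
    Tendsto (fun m : ℕ => Real.log (growth K p (cloverGen K p (paramS κ) paramR) m / m) /
      Real.log m ^ κ) atTop (𝓝 (2 * Real.log p ^ (1 - κ) / κ ^ κ)) :=
  tendsto_log_div (Fact.out : p.Prime).one_lt hκ
    (fun _ _ h => growth_le K (paramS_pos hκ) h)
    (fun _ _ _ h h' => le_growth K (paramS_pos hκ) h h')

theorem growth_cloverGen_eq (p : ℕ) [Fact p.Prime] (K : Type*) [Field K] [CharP K p]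
    (hκ : κ ∈ Set.Ioo (0 : ℝ) 1) :
    ∃ ε : ℕ → ℝ, Tendsto ε atTop (𝓝 0) ∧ ∀ᶠ m : ℕ in atTop,
      (growth K p (cloverGen K p (paramS κ) paramR) m : ℝ) =
        m * Real.exp ((2 * Real.log p ^ (1 - κ) / κ ^ κ + ε m) * Real.log m ^ κ) := by
  obtain ⟨h1, h2⟩ := growth_cloverGen_asymptotics p K hκ
  refine ⟨_, by simpa using h2.sub_const (2 * Real.log p ^ (1 - κ) / κ ^ κ), ?_⟩
  filter_upwards [h1, eventually_gt_atTop 1] with m hm hm1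
  have hm' : (0 : ℝ) < m := by exact_mod_cast (by omega : 0 < m)
  have hlog : 0 < Real.log m := Real.log_pos (by exact_mod_cast hm1)
  have hpow := (Real.rpow_pos_of_pos hlog κ).ne'
  rw [add_sub_cancel, div_mul_cancel₀ _ hpow, Real.exp_log (div_pos (by exact_mod_cast hm) hm'),
    mul_div_cancel₀ _ hm'.ne']

end CloverGrowth

/-! ### Invariants of quasi-linear growth functions -/

section QuasiLinear

theorem tendsto_log_natCast : Tendsto (fun n : ℕ => Real.log n) atTop atTop :=
  Real.tendsto_log_atTop.comp tendsto_natCast_atTop_atTop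

theorem tendsto_log_mul_rpow_div {α β : ℝ} (hβα : β < α) {b : ℕ} (hb : 0 < b) :
    Tendsto (fun n : ℕ => Real.log ((b * n : ℕ) : ℝ) ^ β / Real.log n ^ α) atTop (𝓝 0) := by
  have h1 : Tendsto (fun n : ℕ => Real.log ((b * n : ℕ) : ℝ) / Real.log n) atTop (𝓝 1) := by
    have h2 := ((tendsto_inv_atTop_zero.comp tendsto_log_natCast).const_mul (Real.log b)).add_const 1
    rw [mul_zero, zero_add] at h2
    refine h2.congr' ?_
    filter_upwards [eventually_gt_atTop 1] with n hn
    have hn0 : (n : ℝ) ≠ 0 := by exact_mod_cast (by omega : n ≠ 0)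
    have hb0 : (b : ℝ) ≠ 0 := by exact_mod_cast hb.ne'
    have hlog : 0 < Real.log n := Real.log_pos (by exact_mod_cast hn)
    rw [Nat.cast_mul, Real.log_mul hb0 hn0, Function.comp_apply]
    field_simp
  have h3 := (h1.rpow_const (p := β) (Or.inl one_ne_zero)).mul
    ((tendsto_rpow_neg_atTop (sub_pos.2 hβα)).comp tendsto_log_natCast)
  rw [mul_zero] at h3
  refine h3.congr' ?_
  filter_upwards [eventually_gt_atTop 1] with n hn
  have hlog : 0 < Real.log n := Real.log_pos (by exact_mod_cast hn)
  rw [Function.comp_apply, Real.div_rpow (Real.log_natCast_nonneg _) hlog.le, neg_sub,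
    Real.rpow_sub hlog]
  have := (Real.rpow_pos_of_pos hlog β).ne'
  field_simp

theorem tendsto_add_log_rpow_div {α β : ℝ} (hα : 0 < α) (hβα : β < α) {b : ℕ} (hb : 0 < b)
    (a c : ℝ) :
    Tendsto (fun n : ℕ => (a + c * Real.log ((b * n : ℕ) : ℝ) ^ β) / Real.log n ^ α) atTop
      (𝓝 0) := by
  have h1 := ((tendsto_rpow_neg_atTop hα).comp tendsto_log_natCast).const_mul a
  have h2 := h1.add ((tendsto_log_mul_rpow_div hβα hb).const_mul c)
  rw [mul_zero, mul_zero, add_zero] at h2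
  refine h2.congr fun n => ?_
  rw [Function.comp_apply, Real.rpow_neg (Real.log_natCast_nonneg _)]
  ring

/-- The constant `a` absorbs the factor produced by a linear substitution, and `b` the substitution
inside the logarithm; neither matters against a larger power of `ln n`. -/
theorem eventually_add_log_rpow_lt {α β : ℝ} (hα : 0 < α) (hβα : β < α) {b : ℕ} (hb : 0 < b)
    (a c : ℝ) {d : ℝ} (hd : 0 < d) :
    ∀ᶠ n : ℕ in atTop, a + c * Real.log ((b * n : ℕ) : ℝ) ^ β < d * Real.log n ^ α := by
  filter_upwards [(tendsto_add_log_rpow_div hα hβα hb a c).eventually_lt_const hd,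
    eventually_gt_atTop 1] with n hn hn1
  have hlog : 0 < Real.log n := Real.log_pos (by exact_mod_cast hn1)
  rwa [div_lt_iff₀ (Real.rpow_pos_of_pos hlog α)] at hn

/-- Growth functions between `m exp (c₁ (ln m) ^ κ)` and `m exp (c₂ (ln m) ^ κ)`, up to linear
substitutions. -/
structure IsQuasiLinear (κ : ℝ) (f : ℕ → ℝ) : Prop where
  mono : Monotone f
  upper : ∃ (b : ℕ) (c : ℝ), 0 < b ∧ ∀ᶠ n : ℕ in atTop,
    f n ≤ (b * n : ℕ) * Real.exp (c * Real.log ((b * n : ℕ) : ℝ) ^ κ)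
  lower : ∃ (b : ℕ) (c : ℝ), 0 < b ∧ 0 < c ∧ ∀ᶠ n : ℕ in atTop,
    n * Real.exp (c * Real.log n ^ κ) ≤ f (b * n)

theorem tendsto_mul_left_nat {b : ℕ} (hb : 0 < b) : Tendsto (fun n : ℕ => b * n) atTop atTop :=
  tendsto_id.const_mul_atTop' hb

theorem GrowthLE.of_eventually {f g : ℕ → ℝ} {C : ℕ} (hC : 0 < C)
    (h : ∀ᶠ n : ℕ in atTop, f n ≤ g (C * n)) : GrowthLE f g := by
  obtain ⟨N, hN⟩ := eventually_atTop.1 h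
  exact ⟨N + 1, C, N.succ_pos, hC, fun n hn => hN n (by omega)⟩

theorem GrowthLE.eventually {f g : ℕ → ℝ} (h : GrowthLE f g) :
    ∃ C, 0 < C ∧ ∀ᶠ n : ℕ in atTop, f n ≤ g (C * n) := by
  obtain ⟨N, C, -, hC, h⟩ := h
  exact ⟨C, hC, eventually_atTop.2 ⟨N, h⟩⟩

theorem exp_le_of_mul_le {n b : ℕ} (hn : 0 < n) (hb : 0 < b) {x y : ℝ}
    (h : n * Real.exp x ≤ (b * n : ℕ) * Real.exp y) : x ≤ Real.log b + y := by
  have hn' : (0 : ℝ) < n := by exact_mod_cast hn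
  have hb' : (0 : ℝ) < b := by exact_mod_cast hb
  rw [← Real.exp_le_exp, Real.exp_add, Real.exp_log hb']
  push_cast at h
  refine le_of_mul_le_mul_left (h.trans_eq ?_) hn'
  ring

namespace IsQuasiLinear

variable {κ β : ℝ} {f : ℕ → ℝ}

theorem growthLE_quasiLin (hf : IsQuasiLinear κ f) (hκ : 0 < κ) (hβ : κ < β) :
    GrowthLE f (quasiLin β) := by
  obtain ⟨b, c, hb, h⟩ := hf.upper
  refine .of_eventually hb ?_
  have h1 := eventually_add_log_rpow_lt (hκ.trans hβ) hβ one_pos 0 c one_pos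
  filter_upwards [h, (tendsto_mul_left_nat hb).eventually h1] with n hn hn1
  rw [zero_add, one_mul, one_mul] at hn1
  exact hn.trans (mul_le_mul_of_nonneg_left (Real.exp_le_exp.2 hn1.le) (Nat.cast_nonneg _))

theorem quasiLin_growthLE (hf : IsQuasiLinear κ f) (hκ : 0 < κ) (hβ : β < κ) :
    GrowthLE (quasiLin β) f := by
  obtain ⟨b, c, hb, hc, h⟩ := hf.lower
  refine .of_eventually hb ?_
  filter_upwards [h, eventually_add_log_rpow_lt hκ hβ one_pos 0 1 hc] with n hn hn1
  rw [zero_add, one_mul, one_mul] at hn1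
  exact (mul_le_mul_of_nonneg_left (Real.exp_le_exp.2 hn1.le) (Nat.cast_nonneg _)).trans hn

/-- Chaining the lower bound for `f` with the assumed upper one and cancelling `n` would bound `c
(ln n) ^ κ` by a constant plus a `β`-th power of a logarithm. -/
theorem not_growthLE_quasiLin (hf : IsQuasiLinear κ f) (hκ : 0 < κ) (hβ : β < κ) :
    ¬ GrowthLE f (quasiLin β) := by
  intro h
  obtain ⟨D, hD, h⟩ := h.eventually
  obtain ⟨b, c, hb, hc, hl⟩ := hf.lower
  have hDb := Nat.mul_pos hD hb
  have h1 := eventually_add_log_rpow_lt hκ hβ hDb (Real.log (D * b : ℕ)) 1 hc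
  obtain ⟨n, hn1, hn2, hn3, hn⟩ := (h1.and (((tendsto_mul_left_nat hb).eventually h).and
    (hl.and (eventually_gt_atTop 0)))).exists
  have h2 := hn3.trans hn2
  rw [quasiLin, ← mul_assoc] at h2
  have h3 := exp_le_of_mul_le hn hDb h2
  rw [one_mul] at hn1
  linarith

theorem not_quasiLin_growthLE (hf : IsQuasiLinear κ f) (hκ : 0 < κ) (hβ : κ < β) :
    ¬ GrowthLE (quasiLin β) f := by
  intro h
  obtain ⟨D, hD, h⟩ := h.eventually
  obtain ⟨b, c, hb, hu⟩ := hf.upper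
  have hDb := Nat.mul_pos hb hD
  have h1 := eventually_add_log_rpow_lt (hκ.trans hβ) hβ hDb (Real.log (b * D : ℕ)) c one_pos
  obtain ⟨n, hn1, hn2, hn3, hn⟩ := (h1.and (((tendsto_mul_left_nat hD).eventually hu).and
    (h.and (eventually_gt_atTop 0)))).exists
  have h2 := hn3.trans hn2
  rw [quasiLin, ← mul_assoc] at h2
  have h3 := exp_le_of_mul_le hn hDb h2
  rw [one_mul] at hn1
  linarith

theorem upperLdim_eq (hf : IsQuasiLinear κ f) (hκ : κ ∈ Set.Ioo (0 : ℝ) 1) : upperLdim f = κ := by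
  refine csInf_eq_of_forall_ge_of_forall_gt_exists_lt ⟨1, Or.inr rfl⟩ ?_ ?_
  · rintro β (⟨-, h⟩ | rfl)
    · exact not_lt.1 fun hβ => hf.not_growthLE_quasiLin hκ.1 hβ h
    -- The adjoined default value `1` is harmless, as it lies above `κ`.
    · exact hκ.2.le
  · intro w hw
    obtain ⟨β, h1, h2⟩ := exists_between (lt_min hw hκ.2)
    exact ⟨β, Or.inl ⟨⟨hκ.1.trans h1, h2.trans_le (min_le_right _ _)⟩,
      hf.growthLE_quasiLin hκ.1 h1⟩, h2.trans_le (min_le_left _ _)⟩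

theorem lowerLdim_eq (hf : IsQuasiLinear κ f) (hκ : κ ∈ Set.Ioo (0 : ℝ) 1) : lowerLdim f = κ := by
  refine csSup_eq_of_forall_le_of_forall_lt_exists_gt ⟨0, Or.inr rfl⟩ ?_ ?_
  · rintro β (⟨-, h⟩ | rfl)
    · exact not_lt.1 fun hβ => hf.not_quasiLin_growthLE hκ.1 hβ h
    · exact hκ.1.le
  · intro w hw
    obtain ⟨β, h1, h2⟩ := exists_between (max_lt hw hκ.1)
    exact ⟨β, Or.inl ⟨⟨(le_max_right _ _).trans_lt h1, h2.trans hκ.2⟩,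
      hf.quasiLin_growthLE hκ.1 h2⟩, (le_max_left _ _).trans_lt h1⟩

/-- Linear growth would lie below every quasi-linear function, in particular below that of parameter
`κ / 2`. -/
theorem not_linearGrowth (hf : IsQuasiLinear κ f) (hκ : 0 < κ) : ¬ LinearGrowth f := by
  rintro ⟨⟨N, C, hN, hC, h⟩, -⟩
  refine hf.not_growthLE_quasiLin hκ (half_lt_self hκ) ⟨N, C, hN, hC, fun n hn => ?_⟩
  refine (h n hn).trans (le_mul_of_one_le_right (Nat.cast_nonneg _) (Real.one_le_exp ?_))
  exact Real.rpow_nonneg (Real.log_natCast_nonneg _) _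

theorem tendsto_log_div_log (hf : IsQuasiLinear κ f) (hκ : κ < 1) :
    Tendsto (fun n : ℕ => Real.log (f n) / Real.log n) atTop (𝓝 1) := by
  obtain ⟨b, c, hb, hu⟩ := hf.upper
  obtain ⟨b', c', hb', hc', hl⟩ := hf.lower
  have hb0 : (0 : ℝ) < b := by exact_mod_cast hb
  have hb0' : (0 : ℝ) < b' := by exact_mod_cast hb'
  -- The lower bound for `f` is known only at multiples of `b'`; monotonicity and rounding down
  -- extend it, the factor `2` paying for the rounding.
  have hlower : ∀ᶠ n : ℕ in atTop, (n : ℝ) / (2 * b') ≤ f n := by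
    have h1 : Tendsto (fun n : ℕ => n / b') atTop atTop := Nat.tendsto_div_const_atTop hb'.ne'
    filter_upwards [h1.eventually hl, h1.eventually (eventually_gt_atTop 0)] with n hn hn0
    have h2 : ((n / b' : ℕ) : ℝ) ≤ f n := by
      refine le_trans ?_ (hn.trans (hf.mono (Nat.mul_div_le n b')))
      refine le_mul_of_one_le_right (Nat.cast_nonneg _) (Real.one_le_exp ?_)
      exact mul_nonneg hc'.le (Real.rpow_nonneg (Real.log_natCast_nonneg _) _)
    refine le_trans ?_ h2
    rw [div_le_iff₀ (by positivity)]
    have h3 : n < b' * (n / b' + 1) := Nat.lt_mul_div_succ n hb'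
    have h4 : n ≤ n / b' * (2 * b') := by nlinarith
    exact_mod_cast h4
  have hlo : Tendsto (fun n : ℕ => 1 - Real.log (2 * b') * (Real.log n)⁻¹) atTop (𝓝 1) := by
    have := ((tendsto_inv_atTop_zero.comp tendsto_log_natCast).const_mul
      (Real.log (2 * b'))).const_sub 1
    simpa using this
  have hup : Tendsto (fun n : ℕ => 1 + (Real.log b + c * Real.log ((b * n : ℕ) : ℝ) ^ κ) /
      Real.log n ^ (1 : ℝ)) atTop (𝓝 1) := by
    have := (tendsto_add_log_rpow_div one_pos hκ hb (Real.log b) c).const_add 1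
    simpa using this
  refine tendsto_of_tendsto_of_tendsto_of_le_of_le' hlo hup ?_ ?_
  · filter_upwards [hlower, eventually_gt_atTop 1] with n hn hn1
    have hn0 : (0 : ℝ) < n := by exact_mod_cast (by omega : 0 < n)
    have hlog : 0 < Real.log n := Real.log_pos (by exact_mod_cast hn1)
    have h1 := Real.log_le_log (by positivity) hn
    rw [Real.log_div hn0.ne' (by positivity)] at h1
    rw [le_div_iff₀ hlog, sub_mul, one_mul, mul_assoc, inv_mul_cancel₀ hlog.ne', mul_one]
    exact h1
  · filter_upwards [hlower, hu, eventually_gt_atTop 1] with n hn hn2 hn1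
    have hn0 : (0 : ℝ) < n := by exact_mod_cast (by omega : 0 < n)
    have hlog : 0 < Real.log n := Real.log_pos (by exact_mod_cast hn1)
    have hf0 : 0 < f n := (by positivity : (0 : ℝ) < n / (2 * b')).trans_le hn
    have h1 := Real.log_le_log hf0 hn2
    have hbn : ((b * n : ℕ) : ℝ) ≠ 0 := by push_cast; positivity
    rw [Real.log_mul hbn (Real.exp_pos _).ne', Real.log_exp] at h1
    rw [Real.rpow_one, div_le_iff₀ hlog, add_mul, one_mul, div_mul_cancel₀ _ hlog.ne']
    have h2 : Real.log ((b * n : ℕ) : ℝ) = Real.log b + Real.log n := by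
      rw [Nat.cast_mul, Real.log_mul hb0.ne' hn0.ne']
    linarith

theorem upperGKdim_eq (hf : IsQuasiLinear κ f) (hκ : κ < 1) : upperGKdim f = 1 :=
  ((continuous_coe_real_ereal.tendsto 1).comp (hf.tendsto_log_div_log hκ)).limsup_eq

theorem lowerGKdim_eq (hf : IsQuasiLinear κ f) (hκ : κ < 1) : lowerGKdim f = 1 :=
  ((continuous_coe_real_ereal.tendsto 1).comp (hf.tendsto_log_div_log hκ)).liminf_eq

end IsQuasiLinear

variable {κ : ℝ} (p : ℕ) [Fact p.Prime] (K : Type*) [Field K] [CharP K p]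

theorem finite_cloverGen (S R : ℕ → ℕ) : (cloverGen K p S R).Finite := by
  rw [cloverGen]; exact ((Set.finite_singleton _).insert _).insert _

/-- The generating set is compared with the standard one in both directions. The error `ε` is
absorbed by replacing `C` with `C + 1` above and `C / 2` below. -/
theorem isQuasiLinear_growth (hκ : κ ∈ Set.Ioo (0 : ℝ) 1)
    {X : Set (Module.End K (CloverRing K p (paramS κ) paramR))} (hX : X.Finite)
    (h : lieP K p X = lieP K p (cloverGen K p (paramS κ) paramR)) :
    IsQuasiLinear κ fun m => (growth K p X m : ℝ) := by
  have hG := finite_cloverGen p K (paramS κ) paramR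
  obtain ⟨b, hb, hub⟩ := exists_growth_le (K := K) p hX hG (h ▸ subset_lieP p X)
  obtain ⟨b', hb', hlb⟩ := exists_growth_le (K := K) p hG hX (h ▸ subset_lieP p _)
  obtain ⟨ε, hε, hg⟩ := growth_cloverGen_eq p K hκ
  set C := 2 * Real.log p ^ (1 - κ) / κ ^ κ with hC
  have hCpos : 0 < C := by
    have hlp : 0 < Real.log p := Real.log_pos (by exact_mod_cast (Fact.out : p.Prime).one_lt)
    have := hκ.1
    positivity
  refine ⟨fun m n hmn => Nat.cast_le.2 (growth_mono p hX hmn), ⟨b, C + 1, hb, ?_⟩,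
    ⟨b', C / 2, hb', half_pos hCpos, ?_⟩⟩
  · filter_upwards [(tendsto_mul_left_nat hb).eventually (hg.and (hε.eventually_lt_const one_pos))]
      with n hn
    refine (Nat.cast_le.2 (hub n)).trans (hn.1.le.trans ?_)
    refine mul_le_mul_of_nonneg_left (Real.exp_le_exp.2 ?_) (Nat.cast_nonneg _)
    exact mul_le_mul_of_nonneg_right (by linarith [hn.2])
      (Real.rpow_nonneg (Real.log_natCast_nonneg _) _)
  · filter_upwards [hg, hε.eventually_const_lt (by linarith : -(C / 2) < 0)] with n hn hn2
    refine le_trans ?_ (hn.ge.trans (Nat.cast_le.2 (hlb n)))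
    refine mul_le_mul_of_nonneg_left (Real.exp_le_exp.2 ?_) (Nat.cast_nonneg _)
    exact mul_le_mul_of_nonneg_right (by linarith)
      (Real.rpow_nonneg (Real.log_natCast_nonneg _) _)

end QuasiLinear

end Clover

end

theorem theorem3p5 (p : ℕ) [Fact p.Prime] (K : Type*) [Field K] [CharP K p] :
    (∀ κ ∈ Set.Ioo (0 : ℝ) 1,
      (∃ ε : ℕ → ℝ, Tendsto ε atTop (𝓝 0) ∧ ∀ᶠ m : ℕ in atTop,
        (Clover.growth K p (Clover.cloverGen K p (Clover.paramS κ) Clover.paramR) m : ℝ) =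
          m * Real.exp ((2 * Real.log p ^ (1 - κ) / κ ^ κ + ε m) * Real.log m ^ κ)) ∧
      ∀ X : Set (Module.End K (Clover.CloverRing K p (Clover.paramS κ) Clover.paramR)),
        X.Finite →
        Clover.lieP K p X =
          Clover.lieP K p (Clover.cloverGen K p (Clover.paramS κ) Clover.paramR) →
        Clover.upperGKdim (fun m => (Clover.growth K p X m : ℝ)) = 1 ∧
        Clover.lowerGKdim (fun m => (Clover.growth K p X m : ℝ)) = 1 ∧
        Clover.upperLdim (fun m => (Clover.growth K p X m : ℝ)) = κ ∧
        Clover.lowerLdim (fun m => (Clover.growth K p X m : ℝ)) = κ ∧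
        ¬ Clover.LinearGrowth (fun m => (Clover.growth K p X m : ℝ))) ∧
    (∀ κ ∈ Set.Ioo (0 : ℝ) 1, ∀ κ' ∈ Set.Ioo (0 : ℝ) 1, κ ≠ κ' →
      ¬ Clover.RestrictedIsomorphic K p
        (Clover.cloverGen K p (Clover.paramS κ) Clover.paramR)
        (Clover.cloverGen K p (Clover.paramS κ') Clover.paramR)) := by
  refine ⟨fun κ hκ => ⟨Clover.growth_cloverGen_eq p K hκ, fun X hX h => ?_⟩,
    fun κ hκ κ' hκ' hne hiso => hne ?_⟩
  · have hq := Clover.isQuasiLinear_growth p K hκ hX h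
    exact ⟨hq.upperGKdim_eq hκ.2, hq.lowerGKdim_eq hκ.2, hq.upperLdim_eq hκ, hq.lowerLdim_eq hκ,
      hq.not_linearGrowth hκ.1⟩
  -- The images of the standard generators form a generating set of the second algebra with the
  -- growth of the first, so one function has `Ldim⁰` equal to both `κ` and `κ'`.
  · obtain ⟨Y, hY, hlie, hgr⟩ := hiso.exists_generators
      (Clover.finite_cloverGen p K (Clover.paramS κ) Clover.paramR)
    have h1 := (Clover.isQuasiLinear_growth p K hκ' hY hlie).upperLdim_eq hκ'
    have h2 := (Clover.isQuasiLinear_growth p K hκ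
      (Clover.finite_cloverGen p K (Clover.paramS κ) Clover.paramR) rfl).upperLdim_eq hκ
    rw [hgr] at h1
    exact h2.symm.trans h1
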